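/- **Setting.** Let $N\ge 2$ and write $\mathbf x=(\tilde{\mathbf x},z)\in\mathbb R^{N-1}\times\mathbb R$, $\nabla_T$ for the gradient in $\tilde{\mathbf x}$, and $\mathbf w_T,\mathbf w_N$ for the first $N-1$ components and the last component of a field $\mathbf w$. Let $G,G_0\subset\mathbb R^{N-1}$ be bounded domains with $\overline G\subset G_0$, $\zeta\in C^2(G_0)$, and for $c\ge0$ let $\Gamma+c=\{(\tilde{\mathbf x},\zeta(\tilde{\mathbf x})+c):\tilde{\mathbf x}\in G\}$, $\Gamma=\Gamma+0$, and $\Omega_2=\{(\tilde{\mathbf x},z):\tilde{\mathbf x}\in G,\ \zeta(\tilde{\mathbf x})<z<\zeta(\tilde{\mathbf x})+1\}$. Let $\Omega_1\subset\mathbb R^N$ be a bounded domain, disjoint from $\Omega_2$, with $\partial\Omega_1\cap\partial\Omega_2=\overline\Gamma$ and $\Omega=\Omega_1\cup\Gamma\cup\Omega_2$ open. Let $\hat{\mathbf n}=\hat{\mathbf n}(\tilde{\mathbf x})=(1+|\nabla_T\zeta|^2)^{-1/2}(-\nabla_T\zeta,1)$ be the upward unit normal to $\Gamma$, and $dS=(1+|\nabla_T\zeta|^2)^{1/2}d\tilde{\mathbf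 x}$. For a field $\mathbf w$ on $\Omega_2$ put $\mathbf w_{\hat n}=\mathbf w\cdot\hat{\mathbf n}$ and $\mathbf w(\tau)=\mathbf w-\mathbf w_{\hat n}\hat{\mathbf n}$. Let $H(\partial_z,\Omega_2)=\{w\in L^2(\Omega_2):\partial_zw\in L^2(\Omega_2)\}$ with its natural inner product; its elements have traces on $\Gamma$ and $\Gamma+1$. **Spaces.** $\mathbf X$ is the set of pairs $[\mathbf w^1,\mathbf w^2]\in\mathbf H_{\rm div}(\Omega_1)\times\mathbf H^1(\Omega_2)$ with $\mathbf w^2=0$ on the lateral wall $\partial\Omega_2-(\Gamma\cup(\Gamma+1))$, $\mathbf w^2\cdot\hat{\mathbf n}=0$ on $\Gamma+1$ and $\mathbf w^1\cdot\hat{\mathbf n}=\mathbf w^2\cdot\hat{\mathbf n}$ on $\Gamma$; here $\mathbf w^2=0$ on the lateral wall means that $\mathbf w^2$ is an $\mathbf H^1(\Omega_2)$-limit of smooth fields vanishing near the wall, and $\mathbf w^1\cdot\hat{\mathbf n}=g$ on $\Gamma$ means $\int_{\Omega_1}(\mathbf w^1\cdot\nabla\varphi+\varphi\,\nabla\!\cdot\mathbf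 w^1)=\int_\Gamma g\varphi\,dS$ for all $\varphi\in C_c^\infty(\Omega)$. Pressures $[p^1,p^2]$ belong to $L^2(\Omega_1)\times L^2(\Omega_2)$. **Data.** $\mu>0$ is constant; $\alpha,\beta$ are measurable, nonnegative and bounded a.e. on $\Gamma$; $\mathcal Q$ is a measurable, bounded, uniformly elliptic field of $N\times N$ matrices on $\Omega_1\cup\Gamma$, and $\sqrt{\mathcal Q}$ is its principal square root; $\mathbf f^{2,\epsilon}$ and $h^{1,\epsilon}$ ($\epsilon>0$) are bounded, uniformly in $\epsilon$, in $\mathbf L^2(\Omega_2)$ and $L^2(\Omega_1)$. **Problem.** Put $\mathbf D^\epsilon\mathbf w=\nabla_T\mathbf w+(1-\frac1\epsilon)\,\partial_z\mathbf w\,\nabla_T\zeta$. For every $\epsilon>0$ let $[\mathbf v^\epsilon,p^\epsilon]$, with $\mathbf v^\epsilon=[\mathbf v^{1,\epsilon},\mathbf v^{2,\epsilon}]\in\mathbf X$ and $p^\epsilon=[p^{1,\epsilon},p^{2,\epsilon}]\in L^2(\Omega_1)\times L^2(\Omega_2)$, satisfy $$\int_{\Omega_1}\mathcal Q\mathbf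 v^{1,\epsilon}\cdot\mathbf w^1-\int_{\Omega_1}p^{1,\epsilon}\,\nabla\!\cdot\mathbf w^1-\epsilon\int_{\Omega_2}p^{2,\epsilon}\,\nabla_T\!\cdot\mathbf w^2_T-\epsilon\Big(1-\frac1\epsilon\Big)\int_{\Omega_2}p^{2,\epsilon}\,\partial_z\mathbf w^2_T\cdot\nabla_T\zeta-\int_{\Omega_2}p^{2,\epsilon}\,\partial_z\mathbf w^2_N$$ $$+\epsilon^2\int_{\Omega_2}\mu\,\mathbf D^\epsilon\mathbf v^{2,\epsilon}:\mathbf D^\epsilon\mathbf w^2+\int_{\Omega_2}\mu\,\partial_z\mathbf v^{2,\epsilon}\cdot\partial_z\mathbf w^2+\int_\Gamma\alpha\,(\mathbf v^{1,\epsilon}\cdot\hat{\mathbf n})(\mathbf w^1\cdot\hat{\mathbf n})\,dS+\epsilon^2\int_\Gamma\beta\sqrt{\mathcal Q}\,\mathbf v^{2,\epsilon}(\tau)\cdot\mathbf w^2(\tau)\,dS=\epsilon\int_{\Omega_2}\mathbf f^{2,\epsilon}\cdot\mathbf w^2,$$ $$\int_{\Omega_1}\nabla\!\cdot\mathbf v^{1,\epsilon}\,\varphi^1+\epsilon\int_{\Omega_2}\nabla_T\!\cdot\mathbf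 v^{2,\epsilon}_T\,\varphi^2+\epsilon\Big(1-\frac1\epsilon\Big)\int_{\Omega_2}\partial_z\mathbf v^{2,\epsilon}_T\cdot\nabla_T\zeta\,\varphi^2+\int_{\Omega_2}\partial_z\mathbf v^{2,\epsilon}_N\,\varphi^2=\int_{\Omega_1}h^{1,\epsilon}\varphi^1$$ for all $[\mathbf w^1,\mathbf w^2]\in\mathbf X$ and $[\varphi^1,\varphi^2]\in L^2(\Omega_1)\times L^2(\Omega_2)$. **Corollary (Convergence of the Velocities).** For every $\epsilon>0$, $\nabla\!\cdot\mathbf v^{1,\epsilon}=h^{1,\epsilon}$ and $\mathbf v^{2,\epsilon}_{\hat n}\in H(\partial_z,\Omega_2)$. Every sequence of positive parameters $\epsilon\to0$ has a subsequence along which the following hold. 1. There are $\mathbf v^1\in\mathbf H_{\rm div}(\Omega_1)$ and $h^1\in L^2(\Omega_1)$ with $\mathbf v^{1,\epsilon}\rightharpoonup\mathbf v^1$ weakly in $\mathbf H_{\rm div}(\Omega_1)$, $h^{1,\epsilon}\rightharpoonup h^1$ weakly in $L^2(\Omega_1)$ and $\nabla\!\cdot\mathbf v^1=h^1$. 2.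 There are $\chi\in\mathbf L^2(\Omega_2)$ and $\mathbf v^2\in\mathbf H^1(\Omega_2)$ with $\partial_z\mathbf v^{2,\epsilon}\rightharpoonup\chi$ weakly and $\partial_z(\epsilon\mathbf v^{2,\epsilon})\to\mathbf 0$ strongly in $\mathbf L^2(\Omega_2)$, and $\epsilon\mathbf v^{2,\epsilon}\to\mathbf v^2$ weakly in $\mathbf H^1(\Omega_2)$ and strongly in $\mathbf L^2(\Omega_2)$; moreover $\mathbf v^2=\mathbf v^2(\tilde{\mathbf x})$ does not depend on $z$. 3. There is $\xi\in H(\partial_z,\Omega_2)$ with $\mathbf v^{2,\epsilon}_{\hat n}\rightharpoonup\xi$ weakly and $\epsilon\,\mathbf v^{2,\epsilon}_{\hat n}\to0$ strongly in $H(\partial_z,\Omega_2)$; furthermore $\xi|_\Gamma=\mathbf v^1\cdot\hat{\mathbf n}|_\Gamma$ and $\xi|_{\Gamma+1}=0$. 4. $\mathbf v^2\cdot\hat{\mathbf n}=0$ and $\chi\cdot\hat{\mathbf n}=\partial_z\xi$ a.e. in $\Omega_2$. -/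

import Mathlib

open MeasureTheory Filter Topology Set
open scoped ContDiff ENNReal

namespace DarcyStokes

noncomputable section

/-! ### Ambient spaces and geometry -/

/-- `ℝ^{N-1}`, with `N = d + 1`. -/
abbrev Base (d : ℕ) := EuclideanSpace ℝ (Fin d)

/-- `ℝ^N`, with `N = d + 1`; the last coordinate is the vertical one. -/
abbrev Space (d : ℕ) := EuclideanSpace ℝ (Fin (d + 1))

variable {d : ℕ}

/-- The first `N - 1` coordinates of a point of `ℝ^N`. -/
def horiz (x : Space d) : Base d := WithLp.toLp 2 fun i => x i.castSucc

/-- The point `(x', z)` of `ℝ^N`. -/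
def pt (x' : Base d) (z : ℝ) : Space d :=
  WithLp.toLp 2 (Fin.snoc (α := fun _ => ℝ) (fun i => x' i) z)

/-- The graph of `ζ + c` over `G`: this is `Γ` for `c = 0` and `Γ + c` in general. -/
def surface (G : Set (Base d)) (ζ : Base d → ℝ) (c : ℝ) : Set (Space d) :=
  (fun x' => pt x' (ζ x' + c)) '' G

/-- The reference channel `Ω₂ = {(x', z) : x' ∈ G, ζ x' < z < ζ x' + 1}`. -/
def channel (G : Set (Base d)) (ζ : Base d → ℝ) : Set (Space d) :=
  {x | horiz x ∈ G ∧ ζ (horiz x) < x (Fin.last d) ∧ x (Fin.last d) < ζ (horiz x) + 1}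

/-- The lateral wall `∂Ω₂ - (Γ ∪ (Γ + 1))` of the channel. -/
def lateralWall (G : Set (Base d)) (ζ : Base d → ℝ) : Set (Space d) :=
  frontier (channel G ζ) \ (surface G ζ 0 ∪ surface G ζ 1)

/-- The whole reference domain `Ω = Ω₁ ∪ Γ ∪ Ω₂`. -/
def wholeDomain (Ω₁ : Set (Space d)) (G : Set (Base d)) (ζ : Base d → ℝ) : Set (Space d) :=
  Ω₁ ∪ surface G ζ 0 ∪ channel G ζ

/-- The geometric assumptions: `G`, `G₀`, `Ω₁` are bounded domains, `closure G ⊆ G₀`, `ζ` is `C²` on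
`G₀`, the domains `Ω₁` and `Ω₂` are disjoint and share the interface `Γ` (up to its
`(N-2)`-dimensional edge, which belongs to the closed set `∂Ω₁ ∩ ∂Ω₂` and not to the open surface
`Γ`), and `Ω₁ ∪ Γ ∪ Ω₂` is open. -/
structure IsGeometry (G₀ G : Set (Base d)) (ζ : Base d → ℝ) (Ω₁ : Set (Space d)) : Prop where
  isOpen_G₀ : IsOpen G₀
  isConnected_G₀ : IsConnected G₀
  isBounded_G₀ : Bornology.IsBounded G₀
  isOpen_G : IsOpen G
  isConnected_G : IsConnected G
  closure_subset : closure G ⊆ G₀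
  contDiffOn : ContDiffOn ℝ 2 ζ G₀
  isOpen_Ω₁ : IsOpen Ω₁
  isConnected_Ω₁ : IsConnected Ω₁
  isBounded_Ω₁ : Bornology.IsBounded Ω₁
  disjoint : Disjoint Ω₁ (channel G ζ)
  interface : frontier Ω₁ ∩ frontier (channel G ζ) = closure (surface G ζ 0)
  isOpen_whole : IsOpen (wholeDomain Ω₁ G ζ)

/-- The surface element `√(1 + |∇ζ|²)` of `Γ`, in the parametrization `x' ↦ (x', ζ x')`. -/
def areaElement (ζ : Base d → ℝ) (x' : Base d) : ℝ := √(1 + ‖gradient ζ x'‖ ^ 2)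

/-- The upward unit normal `n̂ (x')` to `Γ` at `(x', ζ x')`. -/
def normal (ζ : Base d → ℝ) (x' : Base d) : Space d :=
  (areaElement ζ x')⁻¹ • pt (-gradient ζ x') 1

/-- The tangential part `w(τ) = w - (w · n̂) n̂` of a vector `w` at the point of `Γ` over `x'`. -/
def tangential (ζ : Base d → ℝ) (x' : Base d) (w : Space d) : Space d :=
  w - inner ℝ w (normal ζ x') • normal ζ x'

/-! ### Function spaces -/

/-- `L²(Ω; F)`. -/
abbrev L2 (Ω : Set (Space d)) (F : Type) [NormedAddCommGroup F] :=
  Lp F 2 (volume.restrict Ω)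

/-- Test functions `C_c^∞(U)`. -/
def IsTest (U : Set (Space d)) (φ : Space d → ℝ) : Prop :=
  ContDiff ℝ ∞ φ ∧ HasCompactSupport φ ∧ tsupport φ ⊆ U

/-- The classical partial derivative `∂φ/∂x_j`. -/
def pderiv {F : Type} [NormedAddCommGroup F] [NormedSpace ℝ F]
    (j : Fin (d + 1)) (φ : Space d → F) (x : Space d) : F :=
  fderiv ℝ φ x (EuclideanSpace.single j 1)

/-- `g` is the weak partial derivative `∂_j u` in `Ω`. -/
def IsWeakPartial {F : Type} [NormedAddCommGroup F] [NormedSpace ℝ F]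
    (Ω : Set (Space d)) (j : Fin (d + 1)) (u g : L2 Ω F) : Prop :=
  ∀ φ : Space d → ℝ, IsTest Ω φ →
    ∫ x in Ω, pderiv j φ x • u x = - ∫ x in Ω, φ x • g x

/-- `δ` is the weak divergence of `u` in `Ω`. -/
def IsWeakDiv (Ω : Set (Space d)) (u : L2 Ω (Space d)) (δ : L2 Ω ℝ) : Prop :=
  ∀ φ : Space d → ℝ, IsTest Ω φ →
    ∫ x in Ω, inner ℝ (gradient φ x) (u x) = - ∫ x in Ω, φ x * δ x

section helpers

variable {F : Type} [NormedAddCommGroup F] [NormedSpace ℝ F] {Ω : Set (Space d)}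

lemma integrable_smul_L2 {ψ : Space d → ℝ} (hc : Continuous ψ) (hs : HasCompactSupport ψ)
    (u : L2 Ω F) : Integrable (fun x => ψ x • u x) (volume.restrict Ω) :=
  by
  have hm : MemLp ψ 2 (volume.restrict Ω) := hc.memLp_of_hasCompactSupport hs
  exact memLp_one_iff_integrable.1 ((Lp.memLp u).smul (r := 1) hm)

lemma IsTest.pderiv {φ : Space d → ℝ} (hφ : IsTest Ω φ) (j : Fin (d + 1)) :
    Continuous (pderiv j φ) ∧ HasCompactSupport (DarcyStokes.pderiv j φ) :=
  ⟨(hφ.1.continuous_fderiv (by simp)).clm_apply continuous_const,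
    hφ.2.1.fderiv_apply (𝕜 := ℝ) _⟩

lemma integral_smul_add {ψ : Space d → ℝ} (hc : Continuous ψ) (hs : HasCompactSupport ψ)
    (u v : L2 Ω F) : ∫ x in Ω, ψ x • (u + v : L2 Ω F) x
      = (∫ x in Ω, ψ x • u x) + ∫ x in Ω, ψ x • v x := by
  rw [← integral_add (integrable_smul_L2 hc hs u) (integrable_smul_L2 hc hs v)]
  refine integral_congr_ae ?_
  filter_upwards [Lp.coeFn_add u v] with x hx
  rw [hx, Pi.add_apply, smul_add]

lemma integral_smul_smul (ψ : Space d → ℝ) (c : ℝ) (u : L2 Ω F) :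
    ∫ x in Ω, ψ x • (c • u : L2 Ω F) x = c • ∫ x in Ω, ψ x • u x := by
  rw [← integral_smul]
  refine integral_congr_ae ?_
  filter_upwards [Lp.coeFn_smul c u] with x hx
  rw [hx, Pi.smul_apply, smul_comm]

lemma integral_smul_zero (ψ : Space d → ℝ) :
    ∫ x in Ω, ψ x • (0 : L2 Ω F) x = 0 := by
  have := integral_smul_smul (Ω := Ω) (F := F) ψ 0 0
  simpa using this

lemma IsWeakPartial.zero (j : Fin (d + 1)) : IsWeakPartial Ω j (0 : L2 Ω F) 0 := by
  intro φ _
  rw [integral_smul_zero, integral_smul_zero, neg_zero]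

lemma IsWeakPartial.add {j : Fin (d + 1)} {u u' g g' : L2 Ω F} (h : IsWeakPartial Ω j u g)
    (h' : IsWeakPartial Ω j u' g') : IsWeakPartial Ω j (u + u') (g + g') := by
  intro φ hφ
  rw [integral_smul_add (hφ.pderiv j).1 (hφ.pderiv j).2,
    integral_smul_add hφ.1.continuous hφ.2.1, h φ hφ, h' φ hφ, neg_add]

lemma IsWeakPartial.smul {j : Fin (d + 1)} {u g : L2 Ω F} (c : ℝ) (h : IsWeakPartial Ω j u g) :
    IsWeakPartial Ω j (c • u) (c • g) := by
  intro φ hφ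
  rw [integral_smul_smul, integral_smul_smul, h φ hφ, smul_neg]

lemma integrable_inner_gradient {φ : Space d → ℝ} (hφ : IsTest Ω φ) (u : L2 Ω (Space d)) :
    Integrable (fun x => inner ℝ (gradient φ x) (u x)) (volume.restrict Ω) := by
  have hc : Continuous (gradient φ) :=
    (InnerProductSpace.toDual ℝ (Space d)).symm.continuous.comp
      (hφ.1.continuous_fderiv (by simp))
  have hs : HasCompactSupport (gradient φ) :=
    (hφ.2.1.fderiv (𝕜 := ℝ)).comp_left
      (g := (InnerProductSpace.toDual ℝ (Space d)).symm) (map_zero _)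
  have hm : MemLp (gradient φ) 2 (volume.restrict Ω) := hc.memLp_of_hasCompactSupport hs
  refine (MeasureTheory.L2.integrable_inner (𝕜 := ℝ) hm.toLp u).congr ?_
  filter_upwards [hm.coeFn_toLp] with x hx
  rw [hx]

lemma IsWeakDiv.zero : IsWeakDiv Ω (0 : L2 Ω (Space d)) 0 := by
  intro φ _
  have h1 : ∫ x in Ω, inner ℝ (gradient φ x) ((0 : L2 Ω (Space d)) x) = 0 := by
    refine integral_eq_zero_of_ae ?_
    filter_upwards [Lp.coeFn_zero (Space d) 2 (volume.restrict Ω)] with x hx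
    rw [hx, Pi.zero_apply, inner_zero_right, Pi.zero_apply]
  have h2 := integral_smul_zero (Ω := Ω) (F := ℝ) φ
  simp only [smul_eq_mul] at h2
  rw [h1, h2, neg_zero]

lemma IsWeakDiv.add {u u' : L2 Ω (Space d)} {δ δ' : L2 Ω ℝ} (h : IsWeakDiv Ω u δ)
    (h' : IsWeakDiv Ω u' δ') : IsWeakDiv Ω (u + u') (δ + δ') := by
  intro φ hφ
  have h1 : ∫ x in Ω, inner ℝ (gradient φ x) ((u + u' : L2 Ω (Space d)) x)
      = (∫ x in Ω, inner ℝ (gradient φ x) (u x)) + ∫ x in Ω, inner ℝ (gradient φ x) (u' x) := by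
    rw [← integral_add (integrable_inner_gradient hφ u) (integrable_inner_gradient hφ u')]
    refine integral_congr_ae ?_
    filter_upwards [Lp.coeFn_add u u'] with x hx
    rw [hx, Pi.add_apply, inner_add_right]
  have h2 := integral_smul_add hφ.1.continuous hφ.2.1 δ δ'
  simp only [smul_eq_mul] at h2
  rw [h1, h2, h φ hφ, h' φ hφ, neg_add]

lemma IsWeakDiv.smul {u : L2 Ω (Space d)} {δ : L2 Ω ℝ} (c : ℝ) (h : IsWeakDiv Ω u δ) :
    IsWeakDiv Ω (c • u) (c • δ) := by
  intro φ hφ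
  have h1 : ∫ x in Ω, inner ℝ (gradient φ x) ((c • u : L2 Ω (Space d)) x)
      = c * ∫ x in Ω, inner ℝ (gradient φ x) (u x) := by
    rw [← integral_const_mul]
    refine integral_congr_ae ?_
    filter_upwards [Lp.coeFn_smul c u] with x hx
    rw [hx, Pi.smul_apply, inner_smul_right]
  have h2 := integral_smul_smul φ c δ
  simp only [smul_eq_mul] at h2
  rw [h1, h2, h φ hφ, mul_neg]

end helpers

/-- `H¹(Ω)^N`: pairs of a vector field in `L²` and the tuple of its weak partial derivatives, with
the natural inner product. -/
def h1Submodule (Ω : Set (Space d)) :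
    Submodule ℝ (WithLp 2 (L2 Ω (Space d) × PiLp 2 fun _ : Fin (d + 1) => L2 Ω (Space d))) where
  carrier := {w | ∀ j, IsWeakPartial Ω j w.fst (w.snd j)}
  zero_mem' := fun _ => IsWeakPartial.zero _
  add_mem' := fun hu hv j => (hu j).add (hv j)
  smul_mem' := fun c _ hu j => (hu j).smul c

/-- The inner product space `H¹(Ω)^N`. -/
abbrev H1V (Ω : Set (Space d)) : Type := ↥(h1Submodule Ω)

/-- The underlying `L²` vector field. -/
def H1V.fn {Ω : Set (Space d)} (w : H1V Ω) : L2 Ω (Space d) := w.1.fst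

/-- The weak partial derivative `∂_j w`. -/
def H1V.partial {Ω : Set (Space d)} (w : H1V Ω) (j : Fin (d + 1)) : L2 Ω (Space d) := w.1.snd j

/-- The weak vertical derivative `∂_z w`. -/
def H1V.dz {Ω : Set (Space d)} (w : H1V Ω) : L2 Ω (Space d) := w.partial (Fin.last d)

/-- `H_div(Ω)`: pairs of a vector field in `L²` and its weak divergence in `L²`, with the natural
inner product. -/
def hdivSubmodule (Ω : Set (Space d)) : Submodule ℝ (WithLp 2 (L2 Ω (Space d) × L2 Ω ℝ)) where
  carrier := {w | IsWeakDiv Ω w.fst w.snd}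
  zero_mem' := IsWeakDiv.zero
  add_mem' := fun hu hv => IsWeakDiv.add hu hv
  smul_mem' := fun c _ hu => IsWeakDiv.smul c hu

/-- The inner product space `H_div(Ω)`. -/
abbrev HDiv (Ω : Set (Space d)) : Type := ↥(hdivSubmodule Ω)

/-- The underlying `L²` vector field. -/
def HDiv.fn {Ω : Set (Space d)} (w : HDiv Ω) : L2 Ω (Space d) := w.1.fst

/-- The weak divergence. -/
def HDiv.div {Ω : Set (Space d)} (w : HDiv Ω) : L2 Ω ℝ := w.1.snd

/-- `H(∂_z, Ω)`: pairs of a scalar function in `L²` and its weak vertical derivative in `L²`, with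
the natural inner product. -/
def hzSubmodule (Ω : Set (Space d)) : Submodule ℝ (WithLp 2 (L2 Ω ℝ × L2 Ω ℝ)) where
  carrier := {w | IsWeakPartial Ω (Fin.last d) w.fst w.snd}
  zero_mem' := IsWeakPartial.zero _
  add_mem' := fun hu hv => IsWeakPartial.add hu hv
  smul_mem' := fun c _ hu => IsWeakPartial.smul c hu

/-- The inner product space `H(∂_z, Ω)`. -/
abbrev Hz (Ω : Set (Space d)) : Type := ↥(hzSubmodule Ω)

/-- The underlying `L²` function. -/
def Hz.fn {Ω : Set (Space d)} (w : Hz Ω) : L2 Ω ℝ := w.1.fst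

/-- The weak vertical derivative `∂_z w`. -/
def Hz.dz {Ω : Set (Space d)} (w : Hz Ω) : L2 Ω ℝ := w.1.snd

/-- Weak convergence of a sequence: convergence against every continuous linear functional. -/
def TendstoWeakly {H : Type*} [NormedAddCommGroup H] [NormedSpace ℝ H] (u : ℕ → H) (l : H) : Prop :=
  ∀ f : StrongDual ℝ H, Tendsto (fun k => f (u k)) atTop (𝓝 (f l))

/-! ### Boundary values

Functions on `Γ` and on `Γ + 1` are written as functions of the parameter `x' ∈ G`. -/

/-- For a function `w ∈ L²(Ω₂)` with vertical derivative `dw ∈ L²(Ω₂)`: the traces of `w` on `Γ` and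
on `Γ + 1` are `g₀` and `g₁`, in the sense of integration by parts in the vertical direction. -/
def HasTraces {F : Type} [NormedAddCommGroup F] [NormedSpace ℝ F] (G : Set (Base d))
    (ζ : Base d → ℝ) (w dw : L2 (channel G ζ) F) (g₀ g₁ : Lp F 2 (volume.restrict G)) : Prop :=
  ∀ φ : Space d → ℝ, ContDiff ℝ ∞ φ → HasCompactSupport φ →
    ∫ x in channel G ζ, (φ x • dw x + pderiv (Fin.last d) φ x • w x)
      = (∫ x' in G, φ (pt x' (ζ x' + 1)) • g₁ x') - ∫ x' in G, φ (pt x' (ζ x')) • g₀ x'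

/-- The normal trace `v · n̂` of `v ∈ H_div(Ω₁)` on `Γ` (`n̂` points out of `Ω₁` there) is `g`:
Green's formula holds against all smooth functions that vanish near `∂Ω₁ - Γ`. -/
def HasNormalTrace (Ω₁ : Set (Space d)) (G : Set (Base d)) (ζ : Base d → ℝ) (v : HDiv Ω₁)
    (g : Base d → ℝ) : Prop :=
  ∀ φ : Space d → ℝ, IsTest (wholeDomain Ω₁ G ζ) φ →
    ∫ x in Ω₁, (inner ℝ (gradient φ x) (v.fn x) + φ x * v.div x)
      = ∫ x' in G, φ (pt x' (ζ x')) * g x' * areaElement ζ x'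

/-- `w = 0` on the lateral wall: `w` is the limit in `H¹` of smooth fields that vanish near the
wall. -/
def VanishesOnWall (G : Set (Base d)) (ζ : Base d → ℝ) (w : H1V (channel G ζ)) : Prop :=
  ∃ ψ : ℕ → Space d → Space d,
    (∀ k, ContDiff ℝ ∞ (ψ k) ∧ HasCompactSupport (ψ k) ∧
      Disjoint (tsupport (ψ k)) (lateralWall G ζ)) ∧
    Tendsto (fun k => eLpNorm (fun x => w.fn x - ψ k x) 2 (volume.restrict (channel G ζ)))
      atTop (𝓝 0) ∧
    ∀ j, Tendsto (fun k => eLpNorm (fun x => w.partial j x - pderiv j (ψ k) x) 2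
      (volume.restrict (channel G ζ))) atTop (𝓝 0)

/-- `[w¹, w²]` belongs to the velocity space `X`: `w¹ ∈ H_div(Ω₁)`, `w² ∈ H¹(Ω₂)^N`, `w² = 0` on the
lateral wall, `w² · n̂ = 0` on `Γ + 1`, and `w¹ · n̂ = w² · n̂` on `Γ`. Moreover `g` is the trace of
`w²` on `Γ`. -/
def MemX (Ω₁ : Set (Space d)) (G : Set (Base d)) (ζ : Base d → ℝ) (w1 : HDiv Ω₁)
    (w2 : H1V (channel G ζ)) (g : Lp (Space d) 2 (volume.restrict G)) : Prop :=
  VanishesOnWall G ζ w2 ∧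
  (∃ g₁ : Lp (Space d) 2 (volume.restrict G), HasTraces G ζ w2.fn w2.dz g g₁ ∧
    ∀ᵐ x' ∂(volume.restrict G), inner ℝ (g₁ x') (normal ζ x') = 0) ∧
  HasNormalTrace Ω₁ G ζ w1 fun x' => inner ℝ (g x') (normal ζ x')

/-! ### The coupled problem on the reference domain -/

/-- `R` is the principal square root of `A`: the square root with nonnegative quadratic form. For an
elliptic matrix `A` there is exactly one, and it is the positive definite one if `A` is symmetric. -/
def IsPrincipalSqrt {n : ℕ} (R A : Matrix (Fin n) (Fin n) ℝ) : Prop :=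
  R * R = A ∧ ∀ ξ : Fin n → ℝ, 0 ≤ R.mulVec ξ ⬝ᵥ ξ

open Classical in
/-- The principal square root `√A` of an elliptic matrix `A`. -/
def matSqrt {n : ℕ} (A : Matrix (Fin n) (Fin n) ℝ) : Matrix (Fin n) (Fin n) ℝ :=
  if h : ∃ R, IsPrincipalSqrt R A then h.choose else 0

/-- A matrix acting on a vector. -/
def act (A : Matrix (Fin (d + 1)) (Fin (d + 1)) ℝ) (ξ : Space d) : Space d :=
  WithLp.toLp 2 (A.mulVec fun i => ξ i)

/-- The assumptions on the coefficients: `μ > 0`; `α`, `β` are nonnegative and bounded a.e. on `Γ`;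
the tensor field `Q` is bounded and uniformly elliptic. -/
structure IsCoefficients (Ω₁ : Set (Space d)) (G : Set (Base d)) (ζ : Base d → ℝ) (μ : ℝ)
    (α β : Base d → ℝ) (Q : Space d → Matrix (Fin (d + 1)) (Fin (d + 1)) ℝ) : Prop where
  mu_pos : 0 < μ
  measurable_α : AEStronglyMeasurable α (volume.restrict G)
  bound_α : ∃ C, ∀ᵐ x' ∂(volume.restrict G), 0 ≤ α x' ∧ α x' ≤ C
  measurable_β : AEStronglyMeasurable β (volume.restrict G)
  bound_β : ∃ C, ∀ᵐ x' ∂(volume.restrict G), 0 ≤ β x' ∧ β x' ≤ C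
  measurable_Q : ∀ i j, Measurable fun x => Q x i j
  bound_Q : ∃ C, ∀ x ∈ Ω₁ ∪ surface G ζ 0, ∀ i j, |Q x i j| ≤ C
  elliptic_Q : ∃ c > 0, ∀ x ∈ Ω₁ ∪ surface G ζ 0, ∀ ξ : Space d,
    c * ‖ξ‖ ^ 2 ≤ inner ℝ (act (Q x) ξ) ξ

/-- The `j`-th column `∂_j w + (1 - 1/ε) (∂_j ζ) ∂_z w` of `D^ε w`, for `j = 1, …, N - 1`. -/
def Deps (G : Set (Base d)) (ζ : Base d → ℝ) (ε : ℝ) (w : H1V (channel G ζ)) (j : Fin d)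
    (x : Space d) : Space d :=
  w.partial j.castSucc x + ((1 - 1 / ε) * gradient ζ (horiz x) j) • w.dz x

/-- The momentum equation of the problem on the reference domain, tested with `[w¹, w²]`; `g` and
`gw` are the traces on `Γ` of `v²` and `w²`, and `w¹ · n̂ = w² · n̂` there. -/
def MomentumEq (Ω₁ : Set (Space d)) (G : Set (Base d)) (ζ : Base d → ℝ) (μ : ℝ) (α β : Base d → ℝ)
    (Q : Space d → Matrix (Fin (d + 1)) (Fin (d + 1)) ℝ) (ε : ℝ)
    (f : L2 (channel G ζ) (Space d))
    (v1 : HDiv Ω₁) (v2 : H1V (channel G ζ)) (p1 : L2 Ω₁ ℝ) (p2 : L2 (channel G ζ) ℝ)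
    (g : Lp (Space d) 2 (volume.restrict G))
    (w1 : HDiv Ω₁) (w2 : H1V (channel G ζ)) (gw : Lp (Space d) 2 (volume.restrict G)) : Prop :=
  (∫ x in Ω₁, inner ℝ (act (Q x) (v1.fn x)) (w1.fn x))
    - (∫ x in Ω₁, p1 x * w1.div x)
    - ε * (∫ x in channel G ζ, p2 x * ∑ j : Fin d, w2.partial j.castSucc x j.castSucc)
    - ε * (1 - 1 / ε) * (∫ x in channel G ζ,
        p2 x * ∑ j : Fin d, w2.dz x j.castSucc * gradient ζ (horiz x) j)
    - (∫ x in channel G ζ, p2 x * w2.dz x (Fin.last d))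
    + ε ^ 2 * (∫ x in channel G ζ,
        μ * ∑ j : Fin d, inner ℝ (Deps G ζ ε v2 j x) (Deps G ζ ε w2 j x))
    + (∫ x in channel G ζ, μ * inner ℝ (v2.dz x) (w2.dz x))
    + (∫ x' in G, α x' * inner ℝ (g x') (normal ζ x') * inner ℝ (gw x') (normal ζ x')
        * areaElement ζ x')
    + ε ^ 2 * (∫ x' in G, β x' *
        inner ℝ (act (matSqrt (Q (pt x' (ζ x')))) (tangential ζ x' (g x')))
          (tangential ζ x' (gw x')) * areaElement ζ x')
  = ε * ∫ x in channel G ζ, inner ℝ (f x) (w2.fn x)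

/-- The mass conservation equation of the problem on the reference domain, tested with
`[φ¹, φ²]`. -/
def MassEq (Ω₁ : Set (Space d)) (G : Set (Base d)) (ζ : Base d → ℝ) (ε : ℝ) (h : L2 Ω₁ ℝ)
    (v1 : HDiv Ω₁) (v2 : H1V (channel G ζ)) (φ1 : L2 Ω₁ ℝ) (φ2 : L2 (channel G ζ) ℝ) : Prop :=
  (∫ x in Ω₁, v1.div x * φ1 x)
    + ε * (∫ x in channel G ζ, (∑ j : Fin d, v2.partial j.castSucc x j.castSucc) * φ2 x)
    + ε * (1 - 1 / ε) * (∫ x in channel G ζ,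
        (∑ j : Fin d, v2.dz x j.castSucc * gradient ζ (horiz x) j) * φ2 x)
    + (∫ x in channel G ζ, v2.dz x (Fin.last d) * φ2 x)
  = ∫ x in Ω₁, h x * φ1 x

/-- `[v, p] ∈ X × Y` solves the Darcy–Stokes problem with parameter `ε` on the reference domain. -/
def IsSolution (Ω₁ : Set (Space d)) (G : Set (Base d)) (ζ : Base d → ℝ) (μ : ℝ) (α β : Base d → ℝ)
    (Q : Space d → Matrix (Fin (d + 1)) (Fin (d + 1)) ℝ) (ε : ℝ)
    (f : L2 (channel G ζ) (Space d)) (h : L2 Ω₁ ℝ)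
    (v1 : HDiv Ω₁) (v2 : H1V (channel G ζ)) (p1 : L2 Ω₁ ℝ) (p2 : L2 (channel G ζ) ℝ) : Prop :=
  ∃ g : Lp (Space d) 2 (volume.restrict G), MemX Ω₁ G ζ v1 v2 g ∧
    (∀ (w1 : HDiv Ω₁) (w2 : H1V (channel G ζ)) (gw : Lp (Space d) 2 (volume.restrict G)),
      MemX Ω₁ G ζ w1 w2 gw → MomentumEq Ω₁ G ζ μ α β Q ε f v1 v2 p1 p2 g w1 w2 gw) ∧
    ∀ (φ1 : L2 Ω₁ ℝ) (φ2 : L2 (channel G ζ) ℝ), MassEq Ω₁ G ζ ε h v1 v2 φ1 φ2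

end

end DarcyStokes

/-!
# Convergence of the velocities for a Darcy–Stokes flow in a thin channel

Throughout, `u ↦ avg u` is the average over vertical lines, from `L²(Ω₂)` to `L²(G)`. It is the
adjoint of the isometry `lift` that extends a function on `G` constantly in `z`, because the channel
has height one over every point of `G`.

**A priori bounds.** Testing the momentum equation with the solution itself, and the mass equation
with the pressure, gives the energy inequality `IsSolution.energy`. It bounds `v¹`, `ε D^ε v²` and
`∂_z v²` once the two remaining terms `ε ∫ f · v²` and `∫ h p¹` are under control.

* For the pressure, `IsGeometry.exists_div_eq` constructs for every `p ∈ L²(Ω₁)` a vertical field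
  `W e_N` with divergence `p`, with zero normal trace on `Γ`, and with norm at most `C ‖p‖`; testing
  with it gives `‖p¹‖ ≤ C ‖v¹‖`. The field exists by Riesz representation, since
  `‖φ‖ ≤ C ‖∂_z φ‖` in `L²(Ω₁)` for test functions `φ` on `Ω`. This Poincaré inequality
  (`IsGeometry.exists_poincare`) follows by integrating `∂_z ((z - L) φ²)` over `Ω₁`: the boundary
  term on `Γ` has a favourable sign if `ζ ≤ L`. No regularity of `∂Ω₁` is needed.
* For `ε v²`, one uses the derivatives `∂_j w + ∂_j ζ ∂_z w` along the translates of `Γ`. They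
  control the translations of `avg w` in `ℝ^{N-1}` (`VanishesOnWall.norm_transDiff_avg_le`), because
  `w` vanishes on the lateral wall, and `∂_z w` controls `w - lift (avg w)`
  (`VanishesOnWall.norm_sub_lift_avg_le`). A translation by more than the diameter of `G` yields a
  Poincaré inequality. Since `ε (∂_j + ∂_j ζ ∂_z) = ε D^ε_j + ∂_j ζ ∂_z`, these derivatives of
  `ε v²` are bounded by the energy.

**Normal velocity.** If `u ∈ H(∂_z, Ω₂)` has the traces `g₀` on `Γ` and `0` on `Γ + 1`, testing with
`1` and `z` gives `g₀ = - avg (∂_z u)` and a bound for `avg u` by `∂_z u`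
(`HasTraces.avg_eq_of_top_zero`). As `n̂` does not depend on `z`, the traces of `w · n̂` are the
normal components of the traces of `w`, although `n̂` is merely measurable as far as the argument is
concerned: the definition of traces is first localized to an identity a.e. in `G`
(`HasTraces.avg_eq`). Hence `v² · n̂` is bounded in `H(∂_z, Ω₂)`.

**Limits.** Bounded sequences in Hilbert spaces have weakly convergent subsequences, and traces pass
to weak limits; the trace `- avg (∂_z ξ)` depends on `ξ` through a continuous linear map, which
identifies it with the normal trace of the limit of `v¹`. The strong convergence of `ε v²` comes
from the translation estimate, by the criterion of Fréchet and Kolmogorov for `avg (ε v²)`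
(`tendsto_of_tendstoWeakly_of_transDiff`), and from
`‖ε v² - lift (avg (ε v²))‖ ≤ ε ‖∂_z v²‖ → 0`; so the limit is a lift, that is, it does not depend
on `z`.
-/

namespace DarcyStokes

noncomputable section

variable {d : ℕ}

/-! ### The vertical shear and the geometry of the channel -/

@[simp] lemma horiz_apply (x : Space d) (i : Fin d) : horiz x i = x i.castSucc := rfl

@[simp] lemma pt_last (x' : Base d) (z : ℝ) : pt x' z (Fin.last d) = z := by
  simp [pt]

@[simp] lemma pt_castSucc (x' : Base d) (z : ℝ) (i : Fin d) : pt x' z i.castSucc = x' i := by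
  simp [pt]

@[simp] lemma horiz_pt (x' : Base d) (z : ℝ) : horiz (pt x' z) = x' := by
  ext i; simp

@[simp] lemma pt_horiz (x : Space d) : pt (horiz x) (x (Fin.last d)) = x := by
  ext i
  refine Fin.lastCases ?_ (fun j => ?_) i <;> simp

lemma contDiff_horiz {n : WithTop ℕ∞} : ContDiff ℝ n (horiz : Space d → Base d) := by
  rw [contDiff_euclidean]
  intro i
  exact (EuclideanSpace.proj (𝕜 := ℝ) (i.castSucc : Fin (d + 1))).contDiff

lemma continuous_horiz : Continuous (horiz : Space d → Base d) :=
  (contDiff_horiz (n := 0)).continuous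

/-- `pt` as a continuous linear map. -/
def ptL : Base d × ℝ →L[ℝ] Space d :=
  LinearMap.toContinuousLinearMap
    { toFun := fun p => pt p.1 p.2
      map_add' := fun p q => by
        ext i
        refine Fin.lastCases ?_ (fun j => ?_) i <;> simp
      map_smul' := fun c p => by
        ext i
        refine Fin.lastCases ?_ (fun j => ?_) i <;> simp }

@[simp] lemma ptL_apply (p : Base d × ℝ) : ptL p = pt p.1 p.2 := rfl

lemma pt_eq_sum (h : Base d) (z : ℝ) :
    pt h z = (∑ j : Fin d, h j • EuclideanSpace.single j.castSucc (1 : ℝ))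
      + z • EuclideanSpace.single (Fin.last d) (1 : ℝ) := by
  ext i
  refine Fin.lastCases ?_ (fun j => ?_) i
  · simp [(Fin.castSucc_lt_last _).ne']
  · simp [Fin.castSucc_ne_last, Pi.single_apply, Fin.castSucc_inj]

lemma measurePreserving_pt :
    MeasurePreserving (fun p : Base d × ℝ => pt p.1 p.2) (volume.prod volume) volume := by
  have h1 : MeasurePreserving (fun p : Base d × ℝ => (p.2, WithLp.ofLp p.1))
      (volume.prod volume) (volume.prod volume) :=
    (Measure.measurePreserving_swap (μ := (volume : Measure (Fin d → ℝ)))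
      (ν := (volume : Measure ℝ))).comp
      ((PiLp.volume_preserving_ofLp (Fin d)).prod (MeasurePreserving.id volume))
  have h2 := (volume_preserving_piFinSuccAbove (fun _ : Fin (d + 1) => ℝ) (Fin.last d)).symm
  have h3 := (PiLp.volume_preserving_toLp (Fin (d + 1))).comp (h2.comp
    (μa := (volume : Measure (Base d)).prod (volume : Measure ℝ)) h1)
  have e : (fun p : Base d × ℝ => pt p.1 p.2) = WithLp.toLp 2 ∘
      (MeasurableEquiv.piFinSuccAbove (fun _ => ℝ) (Fin.last d)).symm
        ∘ fun p : Base d × ℝ => (p.2, WithLp.ofLp p.1) := by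
    funext p
    simp [pt, MeasurableEquiv.piFinSuccAbove, Fin.insertNthEquiv]
  rw [e]
  exact h3

/-- The vertical shear `(x', s) ↦ (x', ζ x' + s)`. -/
def shear (ζ : Base d → ℝ) (hζ : Measurable ζ) : Base d × ℝ ≃ᵐ Space d where
  toFun p := pt p.1 (ζ p.1 + p.2)
  invFun x := (horiz x, x (Fin.last d) - ζ (horiz x))
  left_inv p := by simp
  right_inv x := by simp
  measurable_toFun := by
    have : Measurable fun p : Base d × ℝ => ptL (p.1, ζ p.1 + p.2) :=
      ptL.continuous.measurable.comp (by fun_prop)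
    exact this
  measurable_invFun := by
    have h1 : Measurable (horiz : Space d → Base d) := continuous_horiz.measurable
    have h2 : Measurable fun x : Space d => x (Fin.last d) := by fun_prop
    exact h1.prodMk (h2.sub (hζ.comp h1))

lemma shear_apply (ζ : Base d → ℝ) (hζ : Measurable ζ) (p : Base d × ℝ) :
    shear ζ hζ p = pt p.1 (ζ p.1 + p.2) := rfl

lemma measurePreserving_shear (ζ : Base d → ℝ) (hζ : Measurable ζ) :
    MeasurePreserving (shear ζ hζ) (volume.prod volume) volume := by
  have h : MeasurePreserving (fun p : Base d × ℝ => (p.1, ζ p.1 + p.2))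
      (volume.prod volume) (volume.prod volume) :=
    (MeasurePreserving.id volume).skew_product (g := fun x z => ζ x + z)
      (by fun_prop) (Eventually.of_forall fun x => map_add_left_eq_self volume (ζ x))
  exact measurePreserving_pt.comp h

variable {G : Set (Base d)} {ζ : Base d → ℝ}

lemma measurable_indicator_of_continuousOn (hG : IsOpen G) (hζ : ContinuousOn ζ G) :
    Measurable (G.indicator ζ) := by
  classical
  rw [← Set.piecewise_eq_indicator]
  exact hζ.measurable_piecewise continuousOn_const hG.measurableSet

lemma shear_preimage_channel (hm : Measurable (G.indicator ζ)) :
    shear (G.indicator ζ) hm ⁻¹' channel G ζ = G ×ˢ Ioo 0 1 := by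
  ext ⟨x, s⟩
  simp only [mem_preimage, shear_apply, channel, mem_ofPred_eq, horiz_pt, pt_last, mem_prod,
    mem_Ioo]
  refine and_congr_right fun hx => ?_
  rw [indicator_of_mem hx]
  constructor <;> rintro ⟨h1, h2⟩ <;> constructor <;> linarith

/-- Fubini's theorem on the channel: the shear carries the product measure on `G × (0, 1)` to the
volume of the channel. -/
lemma measurePreserving_shear_channel (hm : Measurable (G.indicator ζ)) :
    MeasurePreserving (shear (G.indicator ζ) hm)
      ((volume.restrict G).prod (volume.restrict (Ioo 0 1))) (volume.restrict (channel G ζ)) := by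
  have := (measurePreserving_shear (G.indicator ζ) hm).restrict_preimage_emb
    (shear (G.indicator ζ) hm).measurableEmbedding (channel G ζ)
  rwa [shear_preimage_channel, ← Measure.prod_restrict] at this

lemma isOpen_channel (hG : IsOpen G) (hζ : ContinuousOn ζ G) : IsOpen (channel G ζ) := by
  have h1 : ContinuousOn (fun x : Space d => ζ (horiz x)) (horiz ⁻¹' G) :=
    hζ.comp continuous_horiz.continuousOn fun x hx => hx
  have hU : IsOpen (horiz ⁻¹' G : Set (Space d)) := hG.preimage continuous_horiz
  have hl : Continuous fun x : Space d => x (Fin.last d) := by fun_prop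
  have h2 := (hl.continuousOn.sub h1).isOpen_inter_preimage hU (isOpen_Ioo (a := (0 : ℝ)) (b := 1))
  convert h2 using 1
  ext x
  simp only [channel, mem_ofPred_eq, mem_inter_iff, mem_preimage, mem_Ioo, Pi.sub_apply, sub_pos,
    sub_lt_iff_lt_add']

/-- The channel has height one, so that its projection to `G` preserves the measure. -/
lemma measurePreserving_horiz (hG : IsOpen G) (hζ : ContinuousOn ζ G) :
    MeasurePreserving horiz (volume.restrict (channel G ζ)) (volume.restrict G) := by
  have hm := measurable_indicator_of_continuousOn hG hζ
  have : IsProbabilityMeasure (volume.restrict (Ioo (0 : ℝ) 1)) := ⟨by simp⟩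
  have h1 : MeasurePreserving Prod.fst ((volume.restrict G).prod (volume.restrict (Ioo (0 : ℝ) 1)))
      (volume.restrict G) := measurePreserving_fst
  have h2 := h1.comp (measurePreserving_shear_channel hm).symm
  exact h2

lemma mem_channel_of_mem {x' : Base d} (hx : x' ∈ G) {s : ℝ} (hs : s ∈ Ioo (0 : ℝ) 1) :
    pt x' (ζ x' + s) ∈ channel G ζ := by
  refine ⟨?_, ?_, ?_⟩ <;> simp only [horiz_pt, pt_last]
  · exact hx
  · linarith [hs.1]
  · linarith [hs.2]

lemma volume_surface (hG : IsOpen G) (hζ : ContinuousOn ζ G) :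
    volume (surface G ζ 0) = 0 := by
  have hm := measurable_indicator_of_continuousOn hG hζ
  have hsub : surface G ζ 0 ⊆ (shear (G.indicator ζ) hm).symm ⁻¹' (univ ×ˢ {0}) := by
    rintro _ ⟨x', hx', rfl⟩
    have : (shear (G.indicator ζ) hm).symm (pt x' (ζ x' + 0))
        = (x', ζ x' + 0 - G.indicator ζ x') := by
      rw [MeasurableEquiv.symm_apply_eq, shear_apply]
      simp
    simp only [mem_preimage, this, indicator_of_mem hx']
    simp
  refine measure_mono_null hsub ?_
  rw [(measurePreserving_shear (G.indicator ζ) hm).symm.measure_preimage_equiv]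
  simp [Measure.prod_prod]

lemma isBounded_channel (hGb : Bornology.IsBounded G) {L : ℝ} (hζ : ∀ x ∈ G, |ζ x| ≤ L) :
    Bornology.IsBounded (channel G ζ) := by
  obtain ⟨R, hR⟩ := hGb.exists_norm_le
  have hK : Bornology.IsBounded (ptL '' (Metric.closedBall (0 : Base d) R ×ˢ Icc (-L) (L + 1))) :=
    (((isCompact_closedBall _ _).prod isCompact_Icc).image ptL.continuous).isBounded
  refine hK.subset fun x hx => ⟨(horiz x, x (Fin.last d)), ⟨?_, ?_⟩, by simp⟩
  · simpa using hR _ hx.1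
  · have := abs_le.1 (hζ _ hx.1)
    exact ⟨by linarith [hx.2.1], by linarith [hx.2.2]⟩

lemma closure_channel_diff_lateralWall (hG : IsOpen G) (hζ : ContinuousOn ζ G) {x : Space d}
    (hx : x ∈ closure (channel G ζ)) (hw : x ∉ lateralWall G ζ) : horiz x ∈ G := by
  by_cases h : x ∈ channel G ζ
  · exact h.1
  have hf : x ∈ frontier (channel G ζ) := by
    rw [frontier, (isOpen_channel hG hζ).interior_eq]
    exact ⟨hx, h⟩
  by_contra hx'
  refine hw ⟨hf, ?_⟩
  rintro (⟨y, hy, rfl⟩ | ⟨y, hy, rfl⟩) <;> exact hx' (by simpa using hy)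

/-! ### Operators on `L²` -/

section operators

variable {X E F : Type*} [MeasurableSpace X] {m : Measure X}
  [NormedAddCommGroup E] [NormedSpace ℝ E] [NormedAddCommGroup F] [NormedSpace ℝ F]

/-- `A` is an essentially bounded measurable field of linear maps, with bound `C`. -/
structure IsBddField (m : Measure X) (A : X → E →L[ℝ] F) (C : ℝ) : Prop where
  meas : AEStronglyMeasurable A m
  nonneg : 0 ≤ C
  bound : ∀ᵐ x ∂m, ‖A x‖ ≤ C

lemma IsBddField.memLp {A : X → E →L[ℝ] F} {C : ℝ} (h : IsBddField m A C) (u : Lp E 2 m) :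
    MemLp (fun x => A x (u x)) 2 m := by
  refine (Lp.memLp u).of_le_mul (c := C) ?_ ?_
  · exact (ContinuousLinearMap.id ℝ (E →L[ℝ] F)).aestronglyMeasurable_comp₂ h.meas
      (Lp.aestronglyMeasurable u)
  · filter_upwards [h.bound] with x hx
    exact (A x).le_of_opNorm_le hx _

/-- The operator `u ↦ A u` from `L²` to `L²` defined by a bounded field `A`. -/
def fieldMul {A : X → E →L[ℝ] F} {C : ℝ} (h : IsBddField m A C) : Lp E 2 m →L[ℝ] Lp F 2 m :=
  LinearMap.mkContinuous
    { toFun := fun u => (h.memLp u).toLp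
      map_add' := fun u v => by
        rw [← MemLp.toLp_add]
        refine MemLp.toLp_congr _ _ ?_
        filter_upwards [Lp.coeFn_add u v] with x hx
        rw [hx, Pi.add_apply, map_add, Pi.add_apply]
      map_smul' := fun c u => by
        rw [RingHom.id_apply, ← MemLp.toLp_const_smul]
        refine MemLp.toLp_congr _ _ ?_
        filter_upwards [Lp.coeFn_smul c u] with x hx
        rw [hx, Pi.smul_apply, map_smul, Pi.smul_apply] } C
    fun u => by
      refine Lp.norm_le_mul_norm_of_ae_le_mul ?_
      filter_upwards [(h.memLp u).coeFn_toLp, h.bound] with x hx hb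
      rw [LinearMap.coe_mk, AddHom.coe_mk, hx]
      exact (A x).le_of_opNorm_le hb _

lemma fieldMul_coe {A : X → E →L[ℝ] F} {C : ℝ} (h : IsBddField m A C) (u : Lp E 2 m) :
    ∀ᵐ x ∂m, fieldMul h u x = A x (u x) :=
  (h.memLp u).coeFn_toLp

lemma norm_fieldMul_le {A : X → E →L[ℝ] F} {C : ℝ} (h : IsBddField m A C) (u : Lp E 2 m) :
    ‖fieldMul h u‖ ≤ C * ‖u‖ :=
  (fieldMul h).le_of_opNorm_le (LinearMap.mkContinuous_norm_le _ h.nonneg _) u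

omit [NormedSpace ℝ E] in
lemma eLpNorm_two_sq (f : X → E) : eLpNorm f 2 m ^ 2 = ∫⁻ x, ‖f x‖ₑ ^ 2 ∂m := by
  rw [eLpNorm_eq_lintegral_rpow_enorm_toReal (by simp) (by simp)]
  rw [← ENNReal.rpow_natCast, ← ENNReal.rpow_mul]
  simp

/-- Jensen's inequality for the square. -/
lemma lintegral_sq_le [IsProbabilityMeasure m] {f : X → ℝ≥0∞} (hf : AEMeasurable f m) :
    (∫⁻ x, f x ∂m) ^ 2 ≤ ∫⁻ x, f x ^ 2 ∂m := by
  have h := ENNReal.lintegral_mul_le_Lp_mul_Lq m Real.HolderConjugate.two_two hf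
    (aemeasurable_const (b := (1 : ℝ≥0∞)))
  simp only [Pi.mul_apply, mul_one, ENNReal.one_rpow, lintegral_const, measure_univ] at h
  calc (∫⁻ x, f x ∂m) ^ 2 ≤ ((∫⁻ x, f x ^ (2 : ℝ) ∂m) ^ (1 / (2 : ℝ))) ^ 2 := by gcongr
    _ = ∫⁻ x, f x ^ 2 ∂m := by
      rw [← ENNReal.rpow_natCast, ← ENNReal.rpow_mul]
      simp

lemma enorm_integral_sq_le [IsProbabilityMeasure m] {f : X → E} (hf : AEStronglyMeasurable f m) :
    ‖∫ x, f x ∂m‖ₑ ^ 2 ≤ ∫⁻ x, ‖f x‖ₑ ^ 2 ∂m :=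
  (pow_le_pow_left' (enorm_integral_le_lintegral_enorm f) 2).trans (lintegral_sq_le hf.enorm)

omit [NormedSpace ℝ E] [NormedSpace ℝ F] in
lemma norm_le_of_lintegral_sq_le {Y : Type*} [MeasurableSpace Y] {n : Measure Y}
    {u : Lp E 2 m} {v : Lp F 2 n}
    (h : ∫⁻ x, ‖u x‖ₑ ^ 2 ∂m ≤ ∫⁻ x, ‖v x‖ₑ ^ 2 ∂n) : ‖u‖ ≤ ‖v‖ := by
  rw [← eLpNorm_two_sq, ← eLpNorm_two_sq, ENNReal.pow_le_pow_left_iff two_ne_zero] at h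
  rw [Lp.norm_def, Lp.norm_def]
  exact ENNReal.toReal_mono (Lp.eLpNorm_ne_top v) h

/-- For an isometry `J`, the operator `J J*` is the orthogonal projection to the range of `J`. -/
lemma norm_sub_isometry_adjoint_le {H K : Type*} [NormedAddCommGroup H] [InnerProductSpace ℝ H]
    [CompleteSpace H] [NormedAddCommGroup K] [InnerProductSpace ℝ K] [CompleteSpace K]
    (J : H →ₗᵢ[ℝ] K) (u : K) (q : H) :
    ‖u - J (ContinuousLinearMap.adjoint J.toContinuousLinearMap u)‖ ≤ ‖u - J q‖ := by
  set p := ContinuousLinearMap.adjoint J.toContinuousLinearMap u with hp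
  have horth : inner ℝ (u - J p) (J (p - q)) = 0 := by
    have h1 : inner ℝ (J (p - q)) u = inner ℝ (p - q) p :=
      (ContinuousLinearMap.adjoint_inner_right J.toContinuousLinearMap (p - q) u).symm
    rw [real_inner_comm, inner_sub_right, h1, J.inner_map_map, sub_self]
  have h := norm_add_sq_eq_norm_sq_add_norm_sq_real horth
  rw [map_sub, sub_add_sub_cancel] at h
  refine (abs_le_of_sq_le_sq' ?_ (norm_nonneg _)).2
  rw [sq, sq, h]
  exact le_add_of_nonneg_right (mul_self_nonneg _)

end operators

instance : IsProbabilityMeasure (volume.restrict (Ioo (0 : ℝ) 1)) := ⟨by simp⟩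

/-- The fundamental theorem of calculus with the Cauchy–Schwarz inequality on the unit interval. -/
lemma enorm_sub_sq_le {F : Type*} [NormedAddCommGroup F] [NormedSpace ℝ F] [CompleteSpace F]
    {f f' : ℝ → F} (hf : ∀ t, HasDerivAt f (f' t) t) (hc : Continuous f') {s : ℝ}
    (hs : s ∈ Icc (0 : ℝ) 1) :
    ‖f s - f 0‖ₑ ^ 2 ≤ ∫⁻ t in Ioo (0 : ℝ) 1, ‖f' t‖ₑ ^ 2 := by
  rw [← intervalIntegral.integral_eq_sub_of_hasDerivAt (fun t _ => hf t)
    (hc.intervalIntegrable 0 s), intervalIntegral.integral_of_le hs.1]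
  refine le_trans ?_ (lintegral_sq_le hc.enorm.aemeasurable)
  refine pow_le_pow_left' ((enorm_integral_le_lintegral_enorm _).trans ?_) 2
  rw [← restrict_Ioo_eq_restrict_Ioc]
  exact lintegral_mono_set (Ioo_subset_Ioo_right hs.2)

section base

variable {G : Set (Base d)} {ζ : Base d → ℝ}
variable {F : Type} [NormedAddCommGroup F] [InnerProductSpace ℝ F] [CompleteSpace F]

/-- The isometry `L²(G) → L²(Ω₂)` extending a function on `G` constantly in the vertical
direction. -/
def lift (hG : IsOpen G) (hζ : ContinuousOn ζ G) (F : Type) [NormedAddCommGroup F]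
    [InnerProductSpace ℝ F] :
    Lp F 2 (volume.restrict G) →ₗᵢ[ℝ] L2 (channel G ζ) F :=
  Lp.compMeasurePreservingₗᵢ ℝ horiz (measurePreserving_horiz hG hζ)

omit [CompleteSpace F] in
lemma lift_coe (hG : IsOpen G) (hζ : ContinuousOn ζ G) (q : Lp F 2 (volume.restrict G)) :
    ∀ᵐ x ∂(volume.restrict (channel G ζ)), lift hG hζ F q x = q (horiz x) :=
  Lp.coeFn_compMeasurePreserving q (measurePreserving_horiz hG hζ)

/-- The average over vertical lines, the adjoint of `lift`. -/
def avg (hG : IsOpen G) (hζ : ContinuousOn ζ G) (F : Type) [NormedAddCommGroup F]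
    [InnerProductSpace ℝ F] [CompleteSpace F] :
    L2 (channel G ζ) F →L[ℝ] Lp F 2 (volume.restrict G) :=
  ContinuousLinearMap.adjoint (lift hG hζ F).toContinuousLinearMap

lemma inner_avg (hG : IsOpen G) (hζ : ContinuousOn ζ G) (q : Lp F 2 (volume.restrict G))
    (u : L2 (channel G ζ) F) : inner ℝ q (avg hG hζ F u) = inner ℝ (lift hG hζ F q) u :=
  ContinuousLinearMap.adjoint_inner_right _ _ _

lemma norm_avg_le (hG : IsOpen G) (hζ : ContinuousOn ζ G) (u : L2 (channel G ζ) F) :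
    ‖avg hG hζ F u‖ ≤ ‖u‖ := by
  have h : ‖avg hG hζ F‖ ≤ 1 := by
    rw [avg, LinearIsometryEquiv.norm_map]
    exact (lift hG hζ F).norm_toContinuousLinearMap_le
  simpa using (avg hG hζ F).le_of_opNorm_le h u

/-- `lift ∘ avg` is an orthogonal projection, hence gives the best approximation by functions that
do not depend on the vertical variable. -/
lemma norm_sub_lift_avg_le (hG : IsOpen G) (hζ : ContinuousOn ζ G) (u : L2 (channel G ζ) F)
    (q : Lp F 2 (volume.restrict G)) :
    ‖u - lift hG hζ F (avg hG hζ F u)‖ ≤ ‖u - lift hG hζ F q‖ :=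
  norm_sub_isometry_adjoint_le _ u q

lemma lintegral_channel (hm : Measurable (G.indicator ζ)) (hG : MeasurableSet G)
    {f : Space d → ℝ≥0∞} (hf : Measurable f) :
    ∫⁻ x in channel G ζ, f x
      = ∫⁻ x' in G, ∫⁻ s in Ioo (0 : ℝ) 1, f (pt x' (ζ x' + s)) := by
  rw [← (measurePreserving_shear_channel hm).lintegral_comp hf, lintegral_prod]
  · refine setLIntegral_congr_fun hG fun x' hx' => ?_
    simp only [shear_apply, indicator_of_mem hx']
  · exact (hf.comp (shear _ hm).measurable).aemeasurable

lemma integral_channel {F : Type*} [NormedAddCommGroup F] [NormedSpace ℝ F]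
    (hm : Measurable (G.indicator ζ)) (hG : MeasurableSet G)
    {f : Space d → F} (hf : IntegrableOn f (channel G ζ)) :
    ∫ x in channel G ζ, f x
      = ∫ x' in G, ∫ s in Ioo (0 : ℝ) 1, f (pt x' (ζ x' + s)) := by
  rw [← (measurePreserving_shear_channel hm).integral_comp (shear _ hm).measurableEmbedding,
    integral_prod]
  · refine setIntegral_congr_fun hG fun x' hx' => ?_
    simp only [shear_apply, indicator_of_mem hx']
  · exact (measurePreserving_shear_channel hm).integrable_comp_of_integrable hf

lemma hasDerivAt_comp_pt {F : Type} [NormedAddCommGroup F] [NormedSpace ℝ F]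
    {ψ : Space d → F} (hψ : Differentiable ℝ ψ) (x' : Base d) (c s : ℝ) :
    HasDerivAt (fun s => ψ (pt x' (c + s))) (pderiv (Fin.last d) ψ (pt x' (c + s))) s := by
  have h1 : HasDerivAt (fun s : ℝ => pt x' (c + s)) (EuclideanSpace.single (Fin.last d) 1) s := by
    have h2 : HasDerivAt (fun s : ℝ => ((x', c + s) : Base d × ℝ)) (0, 1) s :=
      (hasDerivAt_const s x').prodMk ((hasDerivAt_id s).const_add c)
    have h3 := (ptL (d := d)).hasFDerivAt.comp_hasDerivAt s h2
    have h4 : ptL ((0, 1) : Base d × ℝ) = EuclideanSpace.single (Fin.last d) 1 := by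
      rw [ptL_apply, pt_eq_sum]; simp
    rw [h4] at h3
    exact h3
  exact (hψ _).hasFDerivAt.comp_hasDerivAt s h1

lemma continuous_pderiv {F : Type} [NormedAddCommGroup F] [NormedSpace ℝ F]
    {ψ : Space d → F} (hψ : ContDiff ℝ ∞ ψ) (j : Fin (d + 1)) : Continuous (pderiv j ψ) :=
  (hψ.continuous_fderiv (by simp)).clm_apply continuous_const

lemma hasCompactSupport_pderiv {F : Type} [NormedAddCommGroup F] [NormedSpace ℝ F]
    {ψ : Space d → F} (hψ : HasCompactSupport ψ) (j : Fin (d + 1)) :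
    HasCompactSupport (pderiv j ψ) :=
  hψ.fderiv_apply (𝕜 := ℝ) _

lemma continuous_pt (x' : Base d) : Continuous fun z : ℝ => pt x' z :=
  ptL.continuous.comp (continuous_const.prodMk continuous_id)

lemma aestronglyMeasurable_comp_pt {F : Type} [NormedAddCommGroup F] {ψ : Space d → F}
    (hψ : Continuous ψ) (hG : IsOpen G) (hζ : ContinuousOn ζ G) (c : ℝ) :
    AEStronglyMeasurable (fun x' => ψ (pt x' (ζ x' + c))) (volume.restrict G) := by
  refine ContinuousOn.aestronglyMeasurable ?_ hG.measurableSet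
  exact (hψ.comp ptL.continuous).comp_continuousOn
    (continuousOn_id.prodMk (hζ.add continuousOn_const))

/-- The restriction of a bounded continuous function to the surface `Γ + c` is square integrable. -/
lemma memLp_comp_pt {F : Type} [NormedAddCommGroup F] {ψ : Space d → F} (hψ : Continuous ψ)
    (hs : HasCompactSupport ψ) (hG : IsOpen G) (hGb : Bornology.IsBounded G)
    (hζ : ContinuousOn ζ G) (c : ℝ) :
    MemLp (fun x' => ψ (pt x' (ζ x' + c))) 2 (volume.restrict G) := by
  have : IsFiniteMeasure (volume.restrict G) := ⟨by simpa using hGb.measure_lt_top⟩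
  obtain ⟨C, hC⟩ := hψ.bounded_above_of_compact_support hs
  exact MemLp.of_bound (aestronglyMeasurable_comp_pt hψ hG hζ c) C
    (Eventually.of_forall fun _ => hC _)

/-- A continuous function with compact support, as an element of `L²`. -/
def smoothLp {F : Type} [NormedAddCommGroup F] (Ω : Set (Space d)) {ψ : Space d → F}
    (hψ : Continuous ψ) (hs : HasCompactSupport ψ) : L2 Ω F :=
  (hψ.memLp_of_hasCompactSupport hs).toLp

lemma smoothLp_coe {F : Type} [NormedAddCommGroup F] (Ω : Set (Space d)) {ψ : Space d → F}
    (hψ : Continuous ψ) (hs : HasCompactSupport ψ) :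
    ∀ᵐ x ∂(volume.restrict Ω), smoothLp Ω hψ hs x = ψ x :=
  MemLp.coeFn_toLp _

/-- The vertical Poincaré–Wirtinger inequality for smooth functions. -/
lemma norm_smoothLp_sub_lift_avg_le (hG : IsOpen G) (hGb : Bornology.IsBounded G)
    (hζ : ContinuousOn ζ G) {ψ : Space d → F} (hψ : ContDiff ℝ ∞ ψ) (hs : HasCompactSupport ψ) :
    ‖smoothLp (channel G ζ) hψ.continuous hs
        - lift hG hζ F (avg hG hζ F (smoothLp (channel G ζ) hψ.continuous hs))‖
      ≤ ‖smoothLp (channel G ζ) (continuous_pderiv hψ (Fin.last d))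
          (hasCompactSupport_pderiv hs _)‖ := by
  have hm := measurable_indicator_of_continuousOn hG hζ
  have hq := memLp_comp_pt hψ.continuous hs hG hGb hζ 0
  refine (norm_sub_lift_avg_le hG hζ _ hq.toLp).trans (norm_le_of_lintegral_sq_le ?_)
  have e1 : ∀ᵐ x ∂(volume.restrict (channel G ζ)),
      (smoothLp (channel G ζ) hψ.continuous hs - lift hG hζ F hq.toLp) x
        = ψ x - ψ (pt (horiz x) (G.indicator ζ (horiz x))) := by
    filter_upwards [Lp.coeFn_sub (smoothLp (channel G ζ) hψ.continuous hs) (lift hG hζ F hq.toLp),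
      smoothLp_coe (channel G ζ) hψ.continuous hs, lift_coe hG hζ hq.toLp,
      (measurePreserving_horiz hG hζ).quasiMeasurePreserving.ae hq.coeFn_toLp,
      ae_restrict_mem (isOpen_channel hG hζ).measurableSet] with x h1 h2 h3 h4 h5
    rw [h1, Pi.sub_apply, h2, h3, h4, indicator_of_mem h5.1, add_zero]
  have e2 := smoothLp_coe (channel G ζ) (continuous_pderiv hψ (Fin.last d))
    (hasCompactSupport_pderiv hs _)
  have l1 := lintegral_congr_ae (e1.mono fun x hx => congrArg (fun y => ‖y‖ₑ ^ 2) hx)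
  have l2 := lintegral_congr_ae (e2.mono fun x hx => congrArg (fun y => ‖y‖ₑ ^ 2) hx)
  rw [l1, l2, lintegral_channel hm hG.measurableSet, lintegral_channel hm hG.measurableSet]
  · refine setLIntegral_mono' hG.measurableSet fun x' hx' => ?_
    simp only [horiz_pt, indicator_of_mem hx']
    calc ∫⁻ s in Ioo (0 : ℝ) 1, ‖ψ (pt x' (ζ x' + s)) - ψ (pt x' (ζ x'))‖ₑ ^ 2
        ≤ ∫⁻ _ in Ioo (0 : ℝ) 1,
          ∫⁻ t in Ioo (0 : ℝ) 1, ‖pderiv (Fin.last d) ψ (pt x' (ζ x' + t))‖ₑ ^ 2 := by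
          refine setLIntegral_mono' measurableSet_Ioo fun s hs' => ?_
          have := enorm_sub_sq_le
            (fun t => hasDerivAt_comp_pt (hψ.differentiable (by simp)) x' (ζ x') t)
            ((continuous_pderiv hψ (Fin.last d)).comp
              ((continuous_pt x').comp (by fun_prop))) (Ioo_subset_Icc_self hs')
          simpa using this
      _ = _ := by simp
  · exact ((continuous_pderiv hψ (Fin.last d)).enorm.measurable).pow_const 2
  · have h1 : Measurable fun x : Space d => pt (horiz x) (G.indicator ζ (horiz x)) :=
      ptL.continuous.measurable.comp (continuous_horiz.measurable.prodMk
        (hm.comp continuous_horiz.measurable))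
    have h2 : Measurable fun p : Space d × Space d => ‖ψ p.1 - ψ p.2‖ₑ ^ 2 :=
      (((hψ.continuous.comp continuous_fst).sub
        (hψ.continuous.comp continuous_snd)).enorm.measurable).pow_const 2
    exact h2.comp (measurable_id.prodMk h1)

/-- The approximation of a field that vanishes on the lateral wall, in terms of elements of `L²`. -/
lemma VanishesOnWall.exists_tendsto {w : H1V (channel G ζ)} (hw : VanishesOnWall G ζ w) :
    ∃ (ψ : ℕ → Space d → Space d) (hψ : ∀ k, ContDiff ℝ ∞ (ψ k))
      (hs : ∀ k, HasCompactSupport (ψ k)),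
      (∀ k, Disjoint (tsupport (ψ k)) (lateralWall G ζ)) ∧
      Tendsto (fun k => smoothLp (channel G ζ) (hψ k).continuous (hs k)) atTop (𝓝 w.fn) ∧
      ∀ j, Tendsto (fun k => smoothLp (channel G ζ) (continuous_pderiv (hψ k) j)
        (hasCompactSupport_pderiv (hs k) j)) atTop (𝓝 (w.partial j)) := by
  obtain ⟨ψ, h1, h2, h3⟩ := hw
  refine ⟨ψ, fun k => (h1 k).1, fun k => (h1 k).2.1, fun k => (h1 k).2.2, ?_, fun j => ?_⟩
  · rw [Lp.tendsto_Lp_iff_tendsto_eLpNorm']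
    refine h2.congr fun k => ?_
    rw [← eLpNorm_neg]
    refine eLpNorm_congr_ae ?_
    filter_upwards [smoothLp_coe (channel G ζ) (h1 k).1.continuous (h1 k).2.1] with x hx
    simp [hx]
  · rw [Lp.tendsto_Lp_iff_tendsto_eLpNorm']
    refine (h3 j).congr fun k => ?_
    rw [← eLpNorm_neg]
    refine eLpNorm_congr_ae ?_
    filter_upwards [smoothLp_coe (channel G ζ) (continuous_pderiv (h1 k).1 j)
        (hasCompactSupport_pderiv (h1 k).2.1 j)] with x hx
    simp [hx]

/-- The vertical Poincaré–Wirtinger inequality. -/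
lemma VanishesOnWall.norm_sub_lift_avg_le (hG : IsOpen G) (hGb : Bornology.IsBounded G)
    (hζ : ContinuousOn ζ G) {w : H1V (channel G ζ)} (hw : VanishesOnWall G ζ w) :
    ‖w.fn - lift hG hζ _ (avg hG hζ _ w.fn)‖ ≤ ‖w.dz‖ := by
  obtain ⟨ψ, hψ, hs, -, h1, h2⟩ := hw.exists_tendsto
  refine le_of_tendsto_of_tendsto (h1.sub ((((lift hG hζ _).continuous.tendsto _).comp
    (((avg hG hζ _).continuous.tendsto _).comp h1)))).norm (h2 (Fin.last d)).norm
    (Eventually.of_forall fun k => ?_)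
  exact norm_smoothLp_sub_lift_avg_le hG hGb hζ (hψ k) (hs k)

end base

/-! ### Translation estimates and compactness on the base -/

section translation

variable {F : Type} [NormedAddCommGroup F] [NormedSpace ℝ F]

/-- Translations of a `C¹` function are controlled by its gradient in the mean-square sense. -/
lemma lintegral_translate_sub_le [CompleteSpace F] {u : Base d → F} (hu : ContDiff ℝ 1 u)
    (h : Base d) :
    ∫⁻ x, ‖u (x + h) - u x‖ₑ ^ 2 ≤ ∫⁻ x, ‖fderiv ℝ u x h‖ₑ ^ 2 := by
  have hc : Continuous fun x => fderiv ℝ u x h :=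
    (hu.continuous_fderiv (by simp)).clm_apply continuous_const
  have h1 : ∀ x, ‖u (x + h) - u x‖ₑ ^ 2
      ≤ ∫⁻ t in Ioo (0 : ℝ) 1, ‖fderiv ℝ u (x + t • h) h‖ₑ ^ 2 := by
    intro x
    have hd : ∀ t : ℝ, HasDerivAt (fun t : ℝ => u (x + t • h)) (fderiv ℝ u (x + t • h) h) t := by
      intro t
      have h2 : HasDerivAt (fun t : ℝ => x + t • h) h t := by
        simpa using ((hasDerivAt_id t).smul_const h).const_add x
      exact ((hu.differentiable (by simp)) _).hasFDerivAt.comp_hasDerivAt t h2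
    have := enorm_sub_sq_le hd (hc.comp (by fun_prop)) (s := 1) (by simp)
    simpa using this
  calc ∫⁻ x, ‖u (x + h) - u x‖ₑ ^ 2
      ≤ ∫⁻ x, ∫⁻ t in Ioo (0 : ℝ) 1, ‖fderiv ℝ u (x + t • h) h‖ₑ ^ 2 := lintegral_mono h1
    _ = ∫⁻ t in Ioo (0 : ℝ) 1, ∫⁻ x, ‖fderiv ℝ u (x + t • h) h‖ₑ ^ 2 := by
      refine lintegral_lintegral_swap (Measurable.aemeasurable ?_)
      have h3 : Continuous fun p : Base d × ℝ => ‖fderiv ℝ u (p.1 + p.2 • h) h‖ₑ :=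
        (hc.comp (by fun_prop)).enorm
      exact h3.measurable.pow_const 2
    _ = ∫⁻ t in Ioo (0 : ℝ) 1, ∫⁻ x, ‖fderiv ℝ u x h‖ₑ ^ 2 := by
      refine lintegral_congr fun t => ?_
      exact lintegral_add_right_eq_self (fun x => ‖fderiv ℝ u x h‖ₑ ^ 2) (t • h)
    _ = _ := by simp

/-- Extension by zero from `G` to the whole space, as an isometry of `L²` spaces. -/
def extZero {G : Set (Base d)} (hG : MeasurableSet G) (F : Type) [NormedAddCommGroup F]
    [NormedSpace ℝ F] : Lp F 2 (volume.restrict G) →ₗᵢ[ℝ] Lp F 2 (volume : Measure (Base d)) where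
  toFun q := ((memLp_indicator_iff_restrict hG).2 (Lp.memLp q)).toLp
  map_add' q r := by
    rw [← MemLp.toLp_add]
    refine MemLp.toLp_congr _ _ ?_
    have := (ae_restrict_iff' hG).1 (Lp.coeFn_add q r)
    filter_upwards [this] with x hx
    by_cases hxG : x ∈ G
    · simp only [Pi.add_apply, indicator_of_mem hxG]
      exact hx hxG
    · simp [hxG]
  map_smul' c q := by
    rw [RingHom.id_apply, ← MemLp.toLp_const_smul]
    refine MemLp.toLp_congr _ _ ?_
    have := (ae_restrict_iff' hG).1 (Lp.coeFn_smul c q)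
    filter_upwards [this] with x hx
    by_cases hxG : x ∈ G
    · simp only [Pi.smul_apply, indicator_of_mem hxG]
      exact hx hxG
    · simp [hxG]
  norm_map' q := by
    rw [LinearMap.coe_mk, AddHom.coe_mk, Lp.norm_toLp, eLpNorm_indicator_eq_eLpNorm_restrict hG,
      Lp.norm_def]

variable {G : Set (Base d)}

lemma extZero_coe (hG : MeasurableSet G) (q : Lp F 2 (volume.restrict G)) :
    ∀ᵐ x, extZero hG F q x = G.indicator q x :=
  ((memLp_indicator_iff_restrict hG).2 (Lp.memLp q)).coeFn_toLp

/-- The operator `q ↦ q(· + h) - q`, where `q` is extended by zero outside `G`. -/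
def transDiff (hG : MeasurableSet G) (F : Type) [NormedAddCommGroup F] [NormedSpace ℝ F]
    (h : Base d) : Lp F 2 (volume.restrict G) →L[ℝ] Lp F 2 (volume : Measure (Base d)) :=
  (Lp.compMeasurePreservingₗᵢ ℝ (fun x => x + h)
      (measurePreserving_add_right volume h)).toContinuousLinearMap ∘L
      (extZero hG F).toContinuousLinearMap
    - (extZero hG F).toContinuousLinearMap

lemma transDiff_coe (hG : MeasurableSet G) (h : Base d) (q : Lp F 2 (volume.restrict G)) :
    ∀ᵐ x, transDiff hG F h q x = G.indicator q (x + h) - G.indicator q x := by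
  have hp := measurePreserving_add_right (volume : Measure (Base d)) h
  have h1 : transDiff hG F h q
      = Lp.compMeasurePreserving (fun x => x + h) hp (extZero hG F q) - extZero hG F q := rfl
  rw [h1]
  filter_upwards [Lp.coeFn_sub (Lp.compMeasurePreserving (fun x => x + h) hp (extZero hG F q))
    (extZero hG F q), Lp.coeFn_compMeasurePreserving (extZero hG F q) hp, extZero_coe hG q,
    hp.quasiMeasurePreserving.ae (extZero_coe hG q)] with x h1 h2 h3 h4
  rw [h1, Pi.sub_apply, h2, Function.comp_apply, h3, h4]

/-- The Poincaré inequality, by a translation that moves `G` off itself. -/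
lemma norm_le_norm_transDiff (hG : MeasurableSet G) (h : Base d) (hh : ∀ x ∈ G, x + h ∉ G)
    (q : Lp F 2 (volume.restrict G)) : ‖q‖ ≤ ‖transDiff hG F h q‖ := by
  refine norm_le_of_lintegral_sq_le ?_
  calc ∫⁻ x in G, ‖q x‖ₑ ^ 2 = ∫⁻ x in G, ‖transDiff hG F h q x‖ₑ ^ 2 := by
        refine lintegral_congr_ae ?_
        filter_upwards [ae_restrict_mem hG, ae_restrict_of_ae (transDiff_coe hG h q)] with x hx h1
        simp [h1, hx, hh x hx]
    _ ≤ _ := setLIntegral_le_lintegral _ _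

end translation

lemma norm_sq_eq_lintegral {X F : Type*} [NormedAddCommGroup F] [MeasurableSpace X] {m : Measure X}
    (u : Lp F 2 m) : ‖u‖ ^ 2 = (∫⁻ x, ‖u x‖ₑ ^ 2 ∂m).toReal := by
  rw [Lp.norm_def, ← ENNReal.toReal_pow, eLpNorm_two_sq]

section rellich

variable {F : Type} [NormedAddCommGroup F] [InnerProductSpace ℝ F] [FiniteDimensional ℝ F]
variable {G : Set (Base d)}

omit [FiniteDimensional ℝ F] in
lemma norm_setIntegral_le (hGv : volume G ≠ ⊤) (B : Set (Base d))
    (q : Lp F 2 (volume.restrict G)) :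
    ‖∫ y in B, q y ∂(volume.restrict G)‖ ≤ (volume G).toReal ^ (1 / 2 : ℝ) * ‖q‖ := by
  have : IsFiniteMeasure (volume.restrict G) := ⟨by simpa using hGv.lt_top⟩
  have h1 : ‖∫ y in B, q y ∂(volume.restrict G)‖ₑ ≤ eLpNorm q 1 (volume.restrict G) := by
    rw [eLpNorm_one_eq_lintegral_enorm]
    exact (enorm_integral_le_lintegral_enorm _).trans (setLIntegral_le_lintegral _ _)
  have h2 := eLpNorm_le_eLpNorm_mul_rpow_measure_univ (p := 1) (q := 2) one_le_two
    (Lp.aestronglyMeasurable q)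
  have h3 := ENNReal.toReal_mono (by
    refine ENNReal.mul_ne_top (Lp.eLpNorm_ne_top q) (ENNReal.rpow_ne_top_of_nonneg ?_ ?_)
    · norm_num
    · simpa using hGv) (h1.trans h2)
  rw [ENNReal.toReal_mul, ← Lp.norm_def, ← ENNReal.toReal_rpow] at h3
  simp only [Measure.restrict_apply_univ, toReal_enorm] at h3
  rw [mul_comm]
  refine h3.trans_eq ?_
  norm_num

/-- The integral over a subset as a continuous linear functional on `L²(G)`. -/
def integralCLM (hGv : volume G ≠ ⊤) (B : Set (Base d)) :
    Lp F 2 (volume.restrict G) →L[ℝ] F :=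
  LinearMap.mkContinuous
    { toFun := fun q => ∫ y in B, q y ∂(volume.restrict G)
      map_add' := fun q r => by
        have : IsFiniteMeasure (volume.restrict G) := ⟨by simpa using hGv.lt_top⟩
        rw [← integral_add ((Lp.memLp q).integrable one_le_two).integrableOn
          ((Lp.memLp r).integrable one_le_two).integrableOn]
        exact integral_congr_ae (ae_restrict_of_ae (Lp.coeFn_add q r))
      map_smul' := fun c q => by
        rw [RingHom.id_apply, ← integral_smul]
        exact integral_congr_ae (ae_restrict_of_ae (Lp.coeFn_smul c q)) }
    ((volume G).toReal ^ (1 / 2 : ℝ))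
    (norm_setIntegral_le hGv B)

omit [FiniteDimensional ℝ F] in
lemma norm_integralCLM_le (hGv : volume G ≠ ⊤) (B : Set (Base d))
    (q : Lp F 2 (volume.restrict G)) :
    ‖integralCLM hGv B q‖ ≤ (volume G).toReal ^ (1 / 2 : ℝ) * ‖q‖ :=
  norm_setIntegral_le hGv B q

/-- A continuous linear map with values in a finite-dimensional space turns weak convergence into
convergence. -/
lemma TendstoWeakly.tendsto_apply {H : Type*} [NormedAddCommGroup H] [NormedSpace ℝ H]
    {u : ℕ → H} {l : H} (h : TendstoWeakly u l) (T : H →L[ℝ] F) :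
    Tendsto (fun k => T (u k)) atTop (𝓝 (T l)) := by
  let b := stdOrthonormalBasis ℝ F
  have h1 : Tendsto (fun k => ∑ i, inner ℝ (b i) (T (u k)) • b i) atTop
      (𝓝 (∑ i, inner ℝ (b i) (T l) • b i)) :=
    tendsto_finsetSum _ fun i _ => (h (innerSL ℝ (b i) ∘L T)).smul_const (b i)
  simpa only [b.sum_repr'] using h1

/-- Mean of `q` over the ball of radius `δ` around `x`, where `q` is extended by zero. -/
def ballMean (hGv : volume G ≠ ⊤) (δ : ℝ) (q : Lp F 2 (volume.restrict G)) (x : Base d) : F :=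
  (volume (Metric.ball (0 : Base d) δ)).toReal⁻¹ • integralCLM hGv (Metric.ball x δ) q

omit [FiniteDimensional ℝ F] in
lemma ballMean_eq (hG : MeasurableSet G) (hGv : volume G ≠ ⊤) {δ : ℝ}
    (q : Lp F 2 (volume.restrict G)) (x : Base d) :
    ballMean hGv δ q x = (volume (Metric.ball (0 : Base d) δ)).toReal⁻¹ •
      ∫ h in Metric.ball (0 : Base d) δ, extZero hG F q (x + h) := by
  have h1 : integralCLM hGv (Metric.ball x δ) q = ∫ y in Metric.ball x δ, extZero hG F q y := by
    rw [integral_congr_ae (ae_restrict_of_ae (extZero_coe hG q)),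
      setIntegral_indicator hG, ← Measure.restrict_restrict Metric.isOpen_ball.measurableSet]
    rfl
  have h2 : ∫ h in Metric.ball (0 : Base d) δ, extZero hG F q (x + h)
      = ∫ y in Metric.ball x δ, extZero hG F q y := by
    have := (measurePreserving_add_left (volume : Measure (Base d)) x).setIntegral_preimage_emb
      (measurableEmbedding_addLeft x) (extZero hG F q) (Metric.ball x δ)
    have hpre : (fun h => x + h) ⁻¹' Metric.ball x δ = Metric.ball (0 : Base d) δ := by
      ext y
      simp [Metric.mem_ball, dist_eq_norm]
    rwa [hpre] at this
  rw [ballMean, h1, h2]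

omit [FiniteDimensional ℝ F] in
lemma norm_ballMean_le (hGv : volume G ≠ ⊤) (δ : ℝ) (q : Lp F 2 (volume.restrict G))
    (x : Base d) :
    ‖ballMean hGv δ q x‖ ≤ (volume (Metric.ball (0 : Base d) δ)).toReal⁻¹
      * ((volume G).toReal ^ (1 / 2 : ℝ) * ‖q‖) := by
  rw [ballMean, norm_smul, Real.norm_of_nonneg (inv_nonneg.2 ENNReal.toReal_nonneg)]
  refine mul_le_mul_of_nonneg_left ?_ (inv_nonneg.2 ENNReal.toReal_nonneg)
  exact norm_integralCLM_le hGv _ q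

omit [FiniteDimensional ℝ F] in
lemma memLp_ballMean (hG : MeasurableSet G) (hGv : volume G ≠ ⊤) (δ : ℝ)
    (q : Lp F 2 (volume.restrict G)) : MemLp (ballMean hGv δ q) 2 (volume.restrict G) := by
  have : IsFiniteMeasure (volume.restrict G) := ⟨by simpa using hGv.lt_top⟩
  refine MemLp.of_bound ?_ _ (Eventually.of_forall fun x => norm_ballMean_le hGv δ q x)
  have h1 : StronglyMeasurable fun p : Base d × Base d => extZero hG F q (p.1 + p.2) :=
    (Lp.stronglyMeasurable _).comp_measurable (measurable_fst.add measurable_snd)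
  have h2 := (h1.integral_prod_right'
    (ν := volume.restrict (Metric.ball (0 : Base d) δ))).const_smul
    (volume (Metric.ball (0 : Base d) δ)).toReal⁻¹
  refine h2.aestronglyMeasurable.congr (Eventually.of_forall fun x => ?_)
  exact (ballMean_eq hG hGv q x).symm

/-- The error of the ball mean, as an average of translation differences. -/
lemma norm_sub_ballMean_le (hG : MeasurableSet G) (hGv : volume G ≠ ⊤) {δ : ℝ} (hδ : 0 < δ)
    {q : Lp F 2 (volume.restrict G)} {M : ℝ} (hM0 : 0 ≤ M)
    (hM : ∀ h, ‖transDiff hG F h q‖ ≤ M * ‖h‖) :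
    ‖(memLp_ballMean hG hGv δ q).toLp - q‖ ≤ M * δ := by
  set B := Metric.ball (0 : Base d) δ with hB
  have hB0 : volume B ≠ 0 := (Metric.measure_ball_pos volume 0 hδ).ne'
  have hBt : volume B ≠ ⊤ := measure_ball_lt_top.ne
  set f := extZero hG F q with hf
  have hfm : StronglyMeasurable f := Lp.stronglyMeasurable _
  let ν : Measure (Base d) := (volume B)⁻¹ • volume.restrict B
  have hν : IsProbabilityMeasure ν := ⟨by
    simp only [ν, Measure.smul_apply, Measure.restrict_apply_univ, smul_eq_mul]
    exact ENNReal.inv_mul_cancel hB0 hBt⟩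
  have hfsub : StronglyMeasurable fun p : Base d × Base d => f (p.1 + p.2) - f p.1 :=
    (hfm.comp_measurable (measurable_fst.add measurable_snd)).sub
      (hfm.comp_measurable measurable_fst)
  have h1 : ∀ x, ‖ballMean hGv δ q x - f x‖ₑ ^ 2 ≤ ∫⁻ h, ‖f (x + h) - f x‖ₑ ^ 2 ∂ν := by
    intro x
    have hi : Integrable (fun h => f (x + h)) ν := by
      refine Integrable.smul_measure ?_ (ENNReal.inv_ne_top.2 hB0)
      have h2 : MemLp (fun h => f (x + h)) 2 volume :=
        (Lp.memLp f).comp_measurePreserving (measurePreserving_add_left volume x)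
      have : IsFiniteMeasure (volume.restrict B) := ⟨by simpa using hBt.lt_top⟩
      exact (h2.restrict B).integrable one_le_two
    have h2 : ballMean hGv δ q x - f x = ∫ h, (f (x + h) - f x) ∂ν := by
      rw [integral_sub hi (integrable_const _), integral_const, ballMean_eq hG hGv q x]
      simp [ν, hB, hf]
    rw [h2]
    exact enorm_integral_sq_le
      ((hfsub.comp_measurable measurable_prodMk_left).aestronglyMeasurable)
  have h2 : ∀ᵐ h ∂ν, ∫⁻ x, ‖f (x + h) - f x‖ₑ ^ 2 ≤ ENNReal.ofReal ((M * δ) ^ 2) := by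
    have hb : ∀ᵐ h ∂ν, h ∈ B :=
      Measure.ae_smul_measure (ae_restrict_mem Metric.isOpen_ball.measurableSet) _
    filter_upwards [hb] with h hh
    have h3 : ∫⁻ x, ‖f (x + h) - f x‖ₑ ^ 2 = ∫⁻ x, ‖transDiff hG F h q x‖ₑ ^ 2 := by
      refine lintegral_congr_ae ?_
      filter_upwards [transDiff_coe hG h q, extZero_coe hG q,
        (measurePreserving_add_right (volume : Measure (Base d)) h).quasiMeasurePreserving.ae
          (extZero_coe hG q)] with x h4 h5 h6
      rw [h4, hf, h5, h6]
    have hfin : ∫⁻ x, ‖transDiff hG F h q x‖ₑ ^ 2 ≠ ⊤ := by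
      rw [← eLpNorm_two_sq]
      exact ENNReal.pow_ne_top (Lp.eLpNorm_ne_top _)
    rw [h3, ← ENNReal.ofReal_toReal hfin, ← norm_sq_eq_lintegral]
    refine ENNReal.ofReal_le_ofReal (pow_le_pow_left₀ (norm_nonneg _) ((hM h).trans ?_) 2)
    exact mul_le_mul_of_nonneg_left (by simpa using (mem_ball_zero_iff.1 hh).le) hM0
  have h3 : ∫⁻ x, ‖ballMean hGv δ q x - f x‖ₑ ^ 2 ≤ ENNReal.ofReal ((M * δ) ^ 2) := by
    calc ∫⁻ x, ‖ballMean hGv δ q x - f x‖ₑ ^ 2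
        ≤ ∫⁻ x, ∫⁻ h, ‖f (x + h) - f x‖ₑ ^ 2 ∂ν := lintegral_mono h1
      _ = ∫⁻ h, (∫⁻ x, ‖f (x + h) - f x‖ₑ ^ 2) ∂ν :=
        lintegral_lintegral_swap ((hfsub.enorm.pow_const 2).aemeasurable)
      _ ≤ ∫⁻ _, ENNReal.ofReal ((M * δ) ^ 2) ∂ν := lintegral_mono_ae h2
      _ = _ := by simp
  have h4 : ∫⁻ x in G, ‖((memLp_ballMean hG hGv δ q).toLp - q) x‖ₑ ^ 2
      ≤ ENNReal.ofReal ((M * δ) ^ 2) := by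
    refine le_trans (le_of_eq ?_) ((setLIntegral_le_lintegral G _).trans h3)
    refine lintegral_congr_ae ?_
    filter_upwards [Lp.coeFn_sub (memLp_ballMean hG hGv δ q).toLp q,
      (memLp_ballMean hG hGv δ q).coeFn_toLp, ae_restrict_of_ae (extZero_coe hG q),
      ae_restrict_mem hG] with x h5 h6 h7 h8
    rw [h5, Pi.sub_apply, h6, hf, h7, indicator_of_mem h8]
  have h5 := ENNReal.toReal_mono ENNReal.ofReal_ne_top h4
  rw [← norm_sq_eq_lintegral, ENNReal.toReal_ofReal (by positivity)] at h5
  exact (abs_le_of_sq_le_sq' h5 (by positivity)).2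

/-- Ball means are compact: they turn weak convergence into strong convergence. -/
lemma tendsto_ballMean (hG : MeasurableSet G) (hGv : volume G ≠ ⊤) (δ : ℝ)
    {q : ℕ → Lp F 2 (volume.restrict G)} {l : Lp F 2 (volume.restrict G)}
    (hq : TendstoWeakly q l) {B : ℝ} (hB : ∀ k, ‖q k‖ ≤ B) :
    Tendsto (fun k => (memLp_ballMean hG hGv δ (q k)).toLp) atTop
      (𝓝 (memLp_ballMean hG hGv δ l).toLp) := by
  have : IsFiniteMeasure (volume.restrict G) := ⟨by simpa using hGv.lt_top⟩
  rw [tendsto_iff_norm_sub_tendsto_zero]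
  set C := (volume (Metric.ball (0 : Base d) δ)).toReal⁻¹
      * ((volume G).toReal ^ (1 / 2 : ℝ) * (B + ‖l‖)) with hC
  have hB0 : 0 ≤ B := (norm_nonneg _).trans (hB 0)
  have hb : ∀ k x, ‖ballMean hGv δ (q k) x - ballMean hGv δ l x‖ ≤ C := by
    intro k x
    refine (norm_sub_le _ _).trans ((add_le_add (norm_ballMean_le hGv δ (q k) x)
      (norm_ballMean_le hGv δ l x)).trans ?_)
    rw [hC, ← mul_add, ← mul_add]
    gcongr
    exact hB k
  have h1 : Tendsto (fun k => ∫⁻ x in G, ‖ballMean hGv δ (q k) x - ballMean hGv δ l x‖ₑ ^ 2) atTop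
      (𝓝 (∫⁻ x in G, 0)) := by
    refine tendsto_lintegral_of_dominated_convergence' (fun _ => ENNReal.ofReal C ^ 2) ?_ ?_ ?_ ?_
    · exact fun k => ((memLp_ballMean hG hGv δ (q k)).1.sub
        (memLp_ballMean hG hGv δ l).1).enorm.pow_const 2
    · refine fun k => Eventually.of_forall fun x => pow_le_pow_left' ?_ 2
      rw [← ofReal_norm]
      exact ENNReal.ofReal_le_ofReal (hb k x)
    · rw [lintegral_const]
      exact ENNReal.mul_ne_top (ENNReal.pow_ne_top ENNReal.ofReal_ne_top) (measure_ne_top _ _)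
    · refine Eventually.of_forall fun x => ?_
      have h2 : Tendsto (fun k => ballMean hGv δ (q k) x - ballMean hGv δ l x) atTop (𝓝 0) := by
        rw [← sub_self (ballMean hGv δ l x)]
        exact ((hq.tendsto_apply (integralCLM hGv (Metric.ball x δ))).const_smul _).sub_const _
      have h3 := (ENNReal.continuous_pow 2).tendsto _ |>.comp h2.enorm
      simpa [Function.comp_def] using h3
  rw [lintegral_zero] at h1
  have h2 : ∀ k, ‖(memLp_ballMean hG hGv δ (q k)).toLp - (memLp_ballMean hG hGv δ l).toLp‖
      = √(∫⁻ x in G, ‖ballMean hGv δ (q k) x - ballMean hGv δ l x‖ₑ ^ 2).toReal := by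
    intro k
    rw [← Real.sqrt_sq (norm_nonneg _), norm_sq_eq_lintegral]
    congr 2
    refine lintegral_congr_ae ?_
    filter_upwards [Lp.coeFn_sub (memLp_ballMean hG hGv δ (q k)).toLp
      (memLp_ballMean hG hGv δ l).toLp, (memLp_ballMean hG hGv δ (q k)).coeFn_toLp,
      (memLp_ballMean hG hGv δ l).coeFn_toLp] with x h3 h4 h5
    rw [h3, Pi.sub_apply, h4, h5]
  simp_rw [h2]
  have h3 := (ENNReal.tendsto_toReal ENNReal.zero_ne_top).comp h1
  simpa [Function.comp_def] using (Real.continuous_sqrt.tendsto _).comp h3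

/-- Rellich's theorem in the form of Fréchet and Kolmogorov: under a uniform translation estimate,
weak convergence in `L²(G)` implies strong convergence. -/
lemma tendsto_of_tendstoWeakly_of_transDiff (hG : MeasurableSet G) (hGv : volume G ≠ ⊤)
    {q : ℕ → Lp F 2 (volume.restrict G)} {l : Lp F 2 (volume.restrict G)}
    (hq : TendstoWeakly q l) {B : ℝ} (hB : ∀ k, ‖q k‖ ≤ B) {M : ℝ} (hM0 : 0 ≤ M)
    (hM : ∀ k h, ‖transDiff hG F h (q k)‖ ≤ M * ‖h‖) :
    Tendsto q atTop (𝓝 l) := by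
  have hc : CauchySeq q := by
    rw [Metric.cauchySeq_iff']
    intro η hη
    set δ := η / (4 * (M + 1)) with hδ
    have hδ0 : 0 < δ := by positivity
    have hMδ : M * δ < η / 4 := by
      rw [hδ, mul_div_assoc', div_lt_div_iff₀ (by positivity) (by positivity)]
      nlinarith
    obtain ⟨N, hN⟩ := Metric.cauchySeq_iff'.1 (tendsto_ballMean hG hGv δ hq hB).cauchySeq (η / 4)
      (by positivity)
    refine ⟨N, fun k hk => ?_⟩
    have e1 := norm_sub_ballMean_le hG hGv hδ0 hM0 (hM k)
    have e2 := norm_sub_ballMean_le hG hGv hδ0 hM0 (hM N)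
    have e3 := hN k hk
    rw [← dist_eq_norm] at e1 e2
    rw [dist_comm] at e1
    have e4 := dist_triangle4 (q k) (memLp_ballMean hG hGv δ (q k)).toLp
      (memLp_ballMean hG hGv δ (q N)).toLp (q N)
    linarith
  obtain ⟨l', hl'⟩ := cauchySeq_tendsto_of_complete hc
  have : l' = l := ext_inner_left ℝ fun v =>
    tendsto_nhds_unique (((innerSL ℝ v).continuous.tendsto l').comp hl') (hq (innerSL ℝ v))
  rwa [this] at hl'

end rellich

/-! ### Horizontal regularity of vertical averages -/

section average

variable {G : Set (Base d)} {ζ : Base d → ℝ}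
variable {F : Type} [NormedAddCommGroup F] [InnerProductSpace ℝ F] [CompleteSpace F]

omit [InnerProductSpace ℝ F] [CompleteSpace F] in
lemma stronglyMeasurable_comp_shear (hm : Measurable (G.indicator ζ)) {ψ : Space d → F}
    (hψ : Continuous ψ) :
    StronglyMeasurable fun p : Base d × ℝ => ψ (pt p.1 (G.indicator ζ p.1 + p.2)) :=
  hψ.stronglyMeasurable.comp_measurable (shear _ hm).measurable

omit [CompleteSpace F] in
lemma aestronglyMeasurable_vertical_integral (hG : IsOpen G) (hζ : ContinuousOn ζ G)
    {ψ : Space d → F} (hψ : Continuous ψ) :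
    AEStronglyMeasurable (fun x' => ∫ s in Ioo (0 : ℝ) 1, ψ (pt x' (ζ x' + s)))
      (volume.restrict G) := by
  have hm := measurable_indicator_of_continuousOn hG hζ
  have h1 := (stronglyMeasurable_comp_shear hm hψ).integral_prod_right'
    (ν := volume.restrict (Ioo (0 : ℝ) 1))
  refine h1.aestronglyMeasurable.congr ?_
  filter_upwards [ae_restrict_mem hG.measurableSet] with x' hx'
  simp [indicator_of_mem hx']

omit [CompleteSpace F] in
lemma memLp_vertical_integral (hG : IsOpen G) (hGb : Bornology.IsBounded G)
    (hζ : ContinuousOn ζ G) {ψ : Space d → F} (hψ : Continuous ψ) (hs : HasCompactSupport ψ) :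
    MemLp (fun x' => ∫ s in Ioo (0 : ℝ) 1, ψ (pt x' (ζ x' + s))) 2 (volume.restrict G) := by
  have : IsFiniteMeasure (volume.restrict G) := ⟨by simpa using hGb.measure_lt_top⟩
  obtain ⟨C, hC⟩ := hψ.bounded_above_of_compact_support hs
  refine MemLp.of_bound (aestronglyMeasurable_vertical_integral hG hζ hψ) C
    (Eventually.of_forall fun x' => ?_)
  refine (norm_integral_le_of_norm_le_const (Eventually.of_forall fun s => hC _)).trans ?_
  simp

/-- The vertical average of a continuous function is given by integration over vertical lines. -/
lemma avg_smoothLp (hG : IsOpen G) (hGb : Bornology.IsBounded G)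
    (hζ : ContinuousOn ζ G) {ψ : Space d → F} (hψ : Continuous ψ) (hs : HasCompactSupport ψ) :
    avg hG hζ F (smoothLp (channel G ζ) hψ hs)
      = (memLp_vertical_integral hG hGb hζ hψ hs).toLp := by
  have hm := measurable_indicator_of_continuousOn hG hζ
  refine ext_inner_left ℝ fun q => ?_
  rw [inner_avg, L2.inner_def, L2.inner_def]
  have e1 : ∀ᵐ x ∂(volume.restrict (channel G ζ)),
      inner ℝ (lift hG hζ F q x) (smoothLp (channel G ζ) hψ hs x)
        = inner ℝ (q (horiz x)) (ψ x) := by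
    filter_upwards [lift_coe hG hζ q, smoothLp_coe (channel G ζ) hψ hs] with x h1 h2
    rw [h1, h2]
  rw [integral_congr_ae e1, integral_channel hm hG.measurableSet
    ((L2.integrable_inner (𝕜 := ℝ) (lift hG hζ F q) (smoothLp (channel G ζ) hψ hs)).congr e1)]
  refine integral_congr_ae ?_
  filter_upwards [(memLp_vertical_integral hG hGb hζ hψ hs).coeFn_toLp] with x' hx'
  simp only [horiz_pt]
  rw [hx', integral_inner]
  have hc : Continuous fun s : ℝ => ψ (pt x' (ζ x' + s)) :=
    hψ.comp ((continuous_pt x').comp (by fun_prop))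
  exact (hc.integrableOn_Icc).mono_set Ioo_subset_Icc_self

omit [CompleteSpace F] in
/-- A `C¹` function on `G` that vanishes outside a closed subset of `G` extends by zero to a `C¹`
function. -/
lemma contDiff_indicator {V : Base d → F} {K : Set (Base d)} (hG : IsOpen G) (hK : IsClosed K)
    (hKG : K ⊆ G) (hV : ContDiffOn ℝ 1 V G) (h0 : ∀ x ∈ G, x ∉ K → V x = 0) :
    ContDiff ℝ 1 (G.indicator V) ∧
      ∀ x h, fderiv ℝ (G.indicator V) x h = G.indicator (fun x => fderiv ℝ V x h) x := by
  have h1 : ∀ x ∈ G, G.indicator V =ᶠ[𝓝 x] V := fun x hx => by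
    filter_upwards [hG.mem_nhds hx] with y hy using indicator_of_mem hy _
  have h2 : ∀ x ∉ G, G.indicator V =ᶠ[𝓝 x] fun _ => 0 := fun x hx => by
    filter_upwards [hK.isOpen_compl.mem_nhds fun h => hx (hKG h)] with y hy
    by_cases hyG : y ∈ G
    · rw [indicator_of_mem hyG, h0 y hyG hy]
    · rw [indicator_of_notMem hyG]
  refine ⟨contDiff_iff_contDiffAt.2 fun x => ?_, fun x h => ?_⟩
  · by_cases hx : x ∈ G
    · exact (hV.contDiffAt (hG.mem_nhds hx)).congr_of_eventuallyEq (h1 x hx)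
    · exact contDiffAt_const.congr_of_eventuallyEq (h2 x hx)
  · by_cases hx : x ∈ G
    · rw [(h1 x hx).fderiv_eq, indicator_of_mem hx]
    · rw [(h2 x hx).fderiv_eq, indicator_of_notMem hx]
      simp

/-- The chain rule along the surfaces `Γ + s`. -/
lemma fderiv_comp_pt {F : Type} [NormedAddCommGroup F] [NormedSpace ℝ F] {ψ : Space d → F}
    (hψ : Differentiable ℝ ψ) {x : Base d} (hζ : DifferentiableAt ℝ ζ x) (s : ℝ) (h : Base d) :
    fderiv ℝ (fun x => ψ (pt x (ζ x + s))) x h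
      = ∑ j : Fin d, h j • (pderiv j.castSucc ψ (pt x (ζ x + s))
          + gradient ζ x j • pderiv (Fin.last d) ψ (pt x (ζ x + s))) := by
  have h1 : HasFDerivAt (fun x : Base d => ((x, ζ x + s) : Base d × ℝ))
      ((ContinuousLinearMap.id ℝ (Base d)).prod (fderiv ℝ ζ x)) x :=
    (hasFDerivAt_id x).prodMk (hζ.hasFDerivAt.add_const s)
  have h2 := (ptL (d := d)).hasFDerivAt.comp x h1
  have h3 := (hψ (pt x (ζ x + s))).hasFDerivAt.comp x h2
  have h4 : (fun x => ψ (pt x (ζ x + s))) = ψ ∘ (ptL (d := d)) ∘ fun x => (x, ζ x + s) := rfl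
  have hgrad : fderiv ℝ ζ x h = ∑ j : Fin d, h j * gradient ζ x j := by
    have : fderiv ℝ ζ x h = inner ℝ (gradient ζ x) h := by
      rw [gradient, InnerProductSpace.toDual_symm_apply]
    rw [this, PiLp.inner_apply]
    simp
  have h5 : (ContinuousLinearMap.comp (ptL (d := d))
      ((ContinuousLinearMap.id ℝ (Base d)).prod (fderiv ℝ ζ x))) h = pt h (fderiv ℝ ζ x h) := rfl
  rw [h4, h3.fderiv, ContinuousLinearMap.comp_apply, h5, pt_eq_sum h, map_add, map_sum, map_smul,
    hgrad, Finset.sum_smul, ← Finset.sum_add_distrib]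
  refine Finset.sum_congr rfl fun j _ => ?_
  rw [map_smul, smul_add, smul_smul]
  rfl

lemma measurable_gradient (ζ : Base d → ℝ) : Measurable (gradient ζ) :=
  (InnerProductSpace.toDual ℝ (Base d)).symm.continuous.measurable.comp (measurable_fderiv ℝ ζ)

lemma measurable_gradient_apply (j : Fin d) : Measurable fun x => gradient ζ x j :=
  (EuclideanSpace.proj (𝕜 := ℝ) j).continuous.measurable.comp (measurable_gradient ζ)

/-- The derivative of `ψ` in the direction tangent to the surfaces `Γ + s` that lies over `h`. -/
def tangentialDeriv (ζ : Base d → ℝ) (ψ : Space d → F) (h : Base d) (x : Space d) : F :=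
  ∑ j : Fin d, h j • (pderiv j.castSucc ψ x
    + gradient ζ (horiz x) j • pderiv (Fin.last d) ψ x)

omit [CompleteSpace F] in
lemma stronglyMeasurable_tangentialDeriv {ψ : Space d → F} (hψ : ContDiff ℝ ∞ ψ) (h : Base d) :
    StronglyMeasurable (tangentialDeriv ζ ψ h) := by
  refine Finset.stronglyMeasurable_fun_sum _ fun j _ => ?_
  refine StronglyMeasurable.const_smul ?_ (h j)
  refine (continuous_pderiv hψ _).stronglyMeasurable.add ?_
  exact ((measurable_gradient_apply j).comp continuous_horiz.measurable).stronglyMeasurable.smul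
    (continuous_pderiv hψ _).stronglyMeasurable

/-- Translations of the vertical average of a smooth field vanishing near the lateral wall. -/
lemma lintegral_transDiff_avg_le (hG : IsOpen G) (hGb : Bornology.IsBounded G)
    (hζ : ContDiffOn ℝ 1 ζ G) {ψ : Space d → F} (hψ : ContDiff ℝ ∞ ψ) (hs : HasCompactSupport ψ)
    (hw : Disjoint (tsupport ψ) (lateralWall G ζ)) (h : Base d) :
    ∫⁻ x, ‖transDiff hG.measurableSet F h
        (avg hG hζ.continuousOn F (smoothLp (channel G ζ) hψ.continuous hs)) x‖ₑ ^ 2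
      ≤ ∫⁻ x in channel G ζ, ‖tangentialDeriv ζ ψ h x‖ₑ ^ 2 := by
  have hm := measurable_indicator_of_continuousOn hG hζ.continuousOn
  let U : Base d → ℝ → F := fun x s => G.indicator (fun x => ψ (pt x (ζ x + s))) x
  have hUm : StronglyMeasurable fun p : Base d × ℝ => U p.1 p.2 := by
    have h1 := (stronglyMeasurable_comp_shear hm hψ.continuous).indicator
      (s := Prod.fst ⁻¹' G) (measurable_fst hG.measurableSet)
    convert h1 using 1
    ext p
    by_cases hp : p.1 ∈ G
    · rw [indicator_of_mem (by exact hp)]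
      simp only [U, indicator_of_mem hp]
    · rw [indicator_of_notMem (by exact hp)]
      simp only [U, indicator_of_notMem hp]
  -- the projection of the support to the base is a compact subset of `G`
  set K : Set (Base d) := horiz '' (tsupport ψ ∩ closure (channel G ζ)) with hK
  have hKc : IsClosed K :=
    ((hs.isCompact.inter_right isClosed_closure).image continuous_horiz).isClosed
  have hKG : K ⊆ G := by
    rintro _ ⟨x, ⟨hx1, hx2⟩, rfl⟩
    exact closure_channel_diff_lateralWall hG hζ.continuousOn hx2
      (disjoint_left.1 hw hx1)
  have hU : ∀ s ∈ Ioo (0 : ℝ) 1, ContDiff ℝ 1 (fun x => U x s) ∧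
      ∀ x h, fderiv ℝ (fun x => U x s) x h
        = G.indicator (fun x => fderiv ℝ (fun x => ψ (pt x (ζ x + s))) x h) x := by
    intro s hs'
    refine contDiff_indicator hG hKc hKG ?_ fun x hx hxK => ?_
    · exact ((hψ.of_le (by simp)).comp ptL.contDiff).comp_contDiffOn
        (contDiffOn_id.prodMk (hζ.add contDiffOn_const))
    · by_contra hne
      exact hxK ⟨pt x (ζ x + s), ⟨subset_tsupport _ hne,
        subset_closure (mem_channel_of_mem hx hs')⟩, by simp⟩
  have e1 : ∀ᵐ x, transDiff hG.measurableSet F h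
      (avg hG hζ.continuousOn F (smoothLp (channel G ζ) hψ.continuous hs)) x
        = ∫ s in Ioo (0 : ℝ) 1, (U (x + h) s - U x s) := by
    have e2 : ∀ᵐ x, G.indicator
        (avg hG hζ.continuousOn F (smoothLp (channel G ζ) hψ.continuous hs)) x
          = ∫ s in Ioo (0 : ℝ) 1, U x s := by
      rw [avg_smoothLp hG hGb hζ.continuousOn hψ.continuous hs]
      filter_upwards [(ae_restrict_iff' hG.measurableSet).1 (memLp_vertical_integral hG hGb
        hζ.continuousOn hψ.continuous hs).coeFn_toLp] with x hx
      by_cases hxG : x ∈ G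
      · simp only [U, indicator_of_mem hxG]
        exact hx hxG
      · simp [U, indicator_of_notMem hxG]
    have hi : ∀ x, IntegrableOn (U x) (Ioo (0 : ℝ) 1) := by
      intro x
      by_cases hxG : x ∈ G
      · have hc : Continuous fun s : ℝ => ψ (pt x (ζ x + s)) :=
          hψ.continuous.comp ((continuous_pt x).comp (by fun_prop))
        have : U x = fun s : ℝ => ψ (pt x (ζ x + s)) := by
          funext s
          simp only [U, indicator_of_mem hxG]
        rw [this]
        exact (hc.integrableOn_Icc).mono_set Ioo_subset_Icc_self
      · have : U x = fun s : ℝ => 0 := by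
          funext s
          simp only [U, indicator_of_notMem hxG]
        rw [this]
        exact integrableOn_zero
    filter_upwards [transDiff_coe hG.measurableSet h
      (avg hG hζ.continuousOn F (smoothLp (channel G ζ) hψ.continuous hs)), e2,
      (measurePreserving_add_right (volume : Measure (Base d)) h).quasiMeasurePreserving.ae e2]
      with x h1 h2 h3
    rw [h1, h2, h3, integral_sub (hi _) (hi _)]
  have hsub : StronglyMeasurable fun p : Base d × ℝ => U (p.1 + h) p.2 - U p.1 p.2 :=
    (hUm.comp_measurable ((measurable_fst.add_const h).prodMk measurable_snd)).sub hUm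
  have hTm : Measurable fun x => ‖tangentialDeriv ζ ψ h x‖ₑ ^ 2 :=
    (stronglyMeasurable_tangentialDeriv hψ h).enorm.pow_const 2
  calc _ = ∫⁻ x, ‖∫ s in Ioo (0 : ℝ) 1, (U (x + h) s - U x s)‖ₑ ^ 2 :=
        lintegral_congr_ae (e1.mono fun x hx => congrArg (fun y => ‖y‖ₑ ^ 2) hx)
    _ ≤ ∫⁻ x, (∫⁻ s in Ioo (0 : ℝ) 1, ‖U (x + h) s - U x s‖ₑ ^ 2) :=
        lintegral_mono fun x => enorm_integral_sq_le
          (hsub.comp_measurable measurable_prodMk_left).aestronglyMeasurable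
    _ = ∫⁻ s in Ioo (0 : ℝ) 1, (∫⁻ x, ‖U (x + h) s - U x s‖ₑ ^ 2) :=
        lintegral_lintegral_swap (hsub.enorm.pow_const 2).aemeasurable
    _ ≤ ∫⁻ s in Ioo (0 : ℝ) 1, (∫⁻ x in G, ‖tangentialDeriv ζ ψ h (pt x (ζ x + s))‖ₑ ^ 2) := by
        refine setLIntegral_mono' measurableSet_Ioo fun s hs' => ?_
        refine (lintegral_translate_sub_le (hU s hs').1 h).trans_eq ?_
        rw [← lintegral_indicator hG.measurableSet]
        refine lintegral_congr fun x => ?_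
        rw [(hU s hs').2]
        by_cases hx : x ∈ G
        · rw [indicator_of_mem hx, indicator_of_mem hx, fderiv_comp_pt
            (hψ.differentiable (by simp))
            ((hζ.contDiffAt (hG.mem_nhds hx)).differentiableAt (by simp))]
          simp [tangentialDeriv]
        · rw [indicator_of_notMem hx, indicator_of_notMem hx]
          simp
    _ = ∫⁻ x in G, (∫⁻ s in Ioo (0 : ℝ) 1, ‖tangentialDeriv ζ ψ h (pt x (ζ x + s))‖ₑ ^ 2) := by
        have h2 : ∀ s, ∫⁻ x in G, ‖tangentialDeriv ζ ψ h (pt x (ζ x + s))‖ₑ ^ 2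
            = ∫⁻ x in G, ‖tangentialDeriv ζ ψ h (pt x (G.indicator ζ x + s))‖ₑ ^ 2 := fun s =>
          setLIntegral_congr_fun hG.measurableSet fun x hx => by simp only [indicator_of_mem hx]
        have h3 : ∀ x ∈ G, ∫⁻ s in Ioo (0 : ℝ) 1, ‖tangentialDeriv ζ ψ h (pt x (ζ x + s))‖ₑ ^ 2
            = ∫⁻ s in Ioo (0 : ℝ) 1, ‖tangentialDeriv ζ ψ h (pt x (G.indicator ζ x + s))‖ₑ ^ 2 :=
          fun x hx => by simp only [indicator_of_mem hx]
        simp_rw [h2]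
        rw [setLIntegral_congr_fun hG.measurableSet h3]
        refine lintegral_lintegral_swap ?_
        exact ((hTm.comp (shear _ hm).measurable).comp measurable_swap).aemeasurable
    _ = _ := (lintegral_channel hm hG.measurableSet hTm).symm

end average

section wall

variable {G : Set (Base d)} {ζ : Base d → ℝ}

lemma isBddField_gradient (F : Type*) [NormedAddCommGroup F] [NormedSpace ℝ F] (hG : IsOpen G)
    (hζ : ContinuousOn ζ G) {L : ℝ} (hL0 : 0 ≤ L)
    (hL : ∀ x ∈ G, ‖gradient ζ x‖ ≤ L) (j : Fin d) :
    IsBddField (volume.restrict (channel G ζ))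
      (fun x => gradient ζ (horiz x) j • ContinuousLinearMap.id ℝ F) L where
  meas := (((measurable_gradient_apply j).comp continuous_horiz.measurable).stronglyMeasurable.smul
    stronglyMeasurable_const).aestronglyMeasurable
  nonneg := hL0
  bound := by
    filter_upwards [ae_restrict_mem (isOpen_channel hG hζ).measurableSet] with x hx
    refine (ContinuousLinearMap.opNorm_le_bound _ hL0 fun y => ?_)
    rw [smul_apply, norm_smul, ContinuousLinearMap.id_apply]
    exact mul_le_mul_of_nonneg_right ((PiLp.norm_apply_le _ j).trans (hL _ hx.1)) (norm_nonneg _)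

/-- Translations of the vertical average of a field vanishing on the lateral wall are controlled by
its derivatives `∂_j w + ∂_j ζ ∂_z w` along the surfaces `Γ + s`. -/
lemma VanishesOnWall.norm_transDiff_avg_le (hG : IsOpen G) (hGb : Bornology.IsBounded G)
    (hζ : ContDiffOn ℝ 1 ζ G) {L : ℝ} (hL0 : 0 ≤ L) (hL : ∀ x ∈ G, ‖gradient ζ x‖ ≤ L)
    {w : H1V (channel G ζ)} (hw : VanishesOnWall G ζ w) (h : Base d) :
    ‖transDiff hG.measurableSet _ h (avg hG hζ.continuousOn _ w.fn)‖
      ≤ ‖∑ j : Fin d, h j • (w.partial j.castSucc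
          + fieldMul (isBddField_gradient (Space d) hG hζ.continuousOn hL0 hL j) w.dz)‖ := by
  obtain ⟨ψ, hψ, hs, hd, h1, h2⟩ := hw.exists_tendsto
  have t1 := (((transDiff hG.measurableSet _ h).continuous.tendsto _).comp
    (((avg hG hζ.continuousOn _).continuous.tendsto _).comp h1)).norm
  have t2 := (tendsto_finsetSum Finset.univ fun (j : Fin d) _ => ((h2 j.castSucc).add
    (((fieldMul (isBddField_gradient (Space d) hG hζ.continuousOn hL0 hL j)).continuous.tendsto
      _).comp (h2 (Fin.last d)))).const_smul (h j)).norm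
  refine le_of_tendsto_of_tendsto t1 t2 (Eventually.of_forall fun k => ?_)
  refine norm_le_of_lintegral_sq_le
    ((lintegral_transDiff_avg_le hG hGb hζ (hψ k) (hs k) (hd k) h).trans_eq ?_)
  have e1 : ∀ᵐ x ∂(volume.restrict (channel G ζ)), ∀ j : Fin d,
      (h j • (smoothLp (channel G ζ) (continuous_pderiv (hψ k) j.castSucc)
          (hasCompactSupport_pderiv (hs k) _)
        + fieldMul (isBddField_gradient (Space d) hG hζ.continuousOn hL0 hL j)
          (smoothLp (channel G ζ) (continuous_pderiv (hψ k) (Fin.last d))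
          (hasCompactSupport_pderiv (hs k) _)))) x
        = h j • (pderiv j.castSucc (ψ k) x
          + gradient ζ (horiz x) j • pderiv (Fin.last d) (ψ k) x) := by
    refine ae_all_iff.2 fun j => ?_
    filter_upwards [Lp.coeFn_smul (h j) (smoothLp (channel G ζ)
        (continuous_pderiv (hψ k) j.castSucc) (hasCompactSupport_pderiv (hs k) _)
        + fieldMul (isBddField_gradient (Space d) hG hζ.continuousOn hL0 hL j)
          (smoothLp (channel G ζ) (continuous_pderiv (hψ k) (Fin.last d))
          (hasCompactSupport_pderiv (hs k) _))),
      Lp.coeFn_add (smoothLp (channel G ζ)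
        (continuous_pderiv (hψ k) j.castSucc) (hasCompactSupport_pderiv (hs k) _))
        (fieldMul (isBddField_gradient (Space d) hG hζ.continuousOn hL0 hL j)
          (smoothLp (channel G ζ) (continuous_pderiv (hψ k) (Fin.last d))
          (hasCompactSupport_pderiv (hs k) _))),
      smoothLp_coe (channel G ζ) (continuous_pderiv (hψ k) j.castSucc)
        (hasCompactSupport_pderiv (hs k) _),
      smoothLp_coe (channel G ζ) (continuous_pderiv (hψ k) (Fin.last d))
        (hasCompactSupport_pderiv (hs k) _),
      fieldMul_coe (isBddField_gradient (Space d) hG hζ.continuousOn hL0 hL j)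
        (smoothLp (channel G ζ) (continuous_pderiv (hψ k) (Fin.last d))
          (hasCompactSupport_pderiv (hs k) _))] with x h3 h4 h5 h6 h7
    rw [h3, Pi.smul_apply, h4, Pi.add_apply, h5, h7, h6]
    rfl
  refine lintegral_congr_ae ?_
  filter_upwards [e1, Lp.coeFn_fun_finsetSum Finset.univ fun j : Fin d =>
    h j • (smoothLp (channel G ζ) (continuous_pderiv (hψ k) j.castSucc)
          (hasCompactSupport_pderiv (hs k) _)
        + fieldMul (isBddField_gradient (Space d) hG hζ.continuousOn hL0 hL j)
          (smoothLp (channel G ζ) (continuous_pderiv (hψ k) (Fin.last d))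
          (hasCompactSupport_pderiv (hs k) _)))] with x h3 h4
  have h5 := h4.trans (Finset.sum_congr rfl fun j _ => h3 j)
  exact congrArg (fun y => ‖y‖ₑ ^ 2) h5.symm

end wall

/-! ### Traces and normal components -/

section normal

lemma areaElement_pos (ζ : Base d → ℝ) (x' : Base d) : 0 < areaElement ζ x' :=
  Real.sqrt_pos.2 (by positivity)

lemma measurable_areaElement (ζ : Base d → ℝ) : Measurable (areaElement ζ) :=
  (((measurable_gradient ζ).norm.pow_const 2).const_add 1).sqrt

lemma measurable_normal (ζ : Base d → ℝ) : Measurable (normal ζ) := by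
  have h : Measurable fun x' : Base d => ptL (-gradient ζ x', (1 : ℝ)) :=
    ptL.continuous.measurable.comp ((measurable_gradient ζ).neg.prodMk measurable_const)
  exact (measurable_areaElement ζ).inv.smul h

lemma norm_normal (ζ : Base d → ℝ) (x' : Base d) : ‖normal ζ x'‖ = 1 := by
  have h : ‖pt (-gradient ζ x') 1‖ = areaElement ζ x' := by
    rw [EuclideanSpace.norm_eq, areaElement, EuclideanSpace.norm_eq, Fin.sum_univ_castSucc,
      Real.sq_sqrt (Finset.sum_nonneg fun _ _ => by positivity)]
    simp [add_comm]
  rw [normal, norm_smul, h, norm_inv, Real.norm_of_nonneg (areaElement_pos ζ x').le,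
    inv_mul_cancel₀ (areaElement_pos ζ x').ne']

lemma isBddField_normal (ζ : Base d → ℝ) {X : Type*} [MeasurableSpace X] (m : Measure X)
    {π : X → Base d} (hπ : Measurable π) :
    IsBddField m (fun x => innerSL ℝ (normal ζ (π x))) 1 where
  meas := ((innerSL ℝ).continuous.comp_stronglyMeasurable
    ((measurable_normal ζ).comp hπ).stronglyMeasurable).aestronglyMeasurable
  nonneg := zero_le_one
  bound := Eventually.of_forall fun x => by rw [innerSL_apply_norm, norm_normal]

/-- The normal component `w ↦ w · n̂` as an operator on `L²`, where `π` gives the horizontal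
coordinates. -/
def normalDot (ζ : Base d → ℝ) {X : Type*} [MeasurableSpace X] (m : Measure X)
    {π : X → Base d} (hπ : Measurable π) : Lp (Space d) 2 m →L[ℝ] Lp ℝ 2 m :=
  fieldMul (isBddField_normal ζ m hπ)

lemma normalDot_coe (ζ : Base d → ℝ) {X : Type*} [MeasurableSpace X] (m : Measure X)
    {π : X → Base d} (hπ : Measurable π) (u : Lp (Space d) 2 m) :
    ∀ᵐ x ∂m, normalDot ζ m hπ u x = inner ℝ (u x) (normal ζ (π x)) := by
  filter_upwards [fieldMul_coe (isBddField_normal ζ m hπ) u] with x hx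
  rw [normalDot, hx, innerSL_apply_apply, real_inner_comm]

lemma norm_normalDot_le (ζ : Base d → ℝ) {X : Type*} [MeasurableSpace X] (m : Measure X)
    {π : X → Base d} (hπ : Measurable π) (u : Lp (Space d) 2 m) :
    ‖normalDot ζ m hπ u‖ ≤ ‖u‖ := by
  exact (norm_fieldMul_le (isBddField_normal ζ m hπ) u).trans_eq (one_mul _)

end normal

section traces

variable {G : Set (Base d)} {ζ : Base d → ℝ}
variable {F : Type} [NormedAddCommGroup F] [InnerProductSpace ℝ F] [CompleteSpace F]

lemma isBddField_smul {X : Type*} [MeasurableSpace X] (m : Measure X) {φ : X → ℝ}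
    (hφ : AEStronglyMeasurable φ m) {C : ℝ} (hC0 : 0 ≤ C)
    (hC : ∀ᵐ x ∂m, |φ x| ≤ C) (F : Type*) [NormedAddCommGroup F] [NormedSpace ℝ F] :
    IsBddField m (fun x => φ x • ContinuousLinearMap.id ℝ F) C where
  meas := hφ.smul aestronglyMeasurable_const
  nonneg := hC0
  bound := by
    filter_upwards [hC] with x hx
    refine (ContinuousLinearMap.opNorm_le_bound _ hC0 fun y => ?_)
    rw [smul_apply, norm_smul, ContinuousLinearMap.id_apply]
    exact mul_le_mul_of_nonneg_right hx (norm_nonneg _)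

lemma isFiniteMeasure_restrict (hGb : Bornology.IsBounded G) :
    IsFiniteMeasure (volume.restrict G) := ⟨by simpa using hGb.measure_lt_top⟩

/-- Testing a vertical average against a compactly supported function on the base. -/
lemma integral_smul_avg (hG : IsOpen G) (hGb : Bornology.IsBounded G) (hζ : ContinuousOn ζ G)
    {η : Base d → ℝ} (hη : Continuous η) (hs : HasCompactSupport η) (u : L2 (channel G ζ) F) :
    ∫ x' in G, η x' • avg hG hζ F u x' = ∫ x in channel G ζ, η (horiz x) • u x := by
  have := isFiniteMeasure_restrict hGb
  obtain ⟨C, hC⟩ := hη.bounded_above_of_compact_support hs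
  have hηG : MemLp η 2 (volume.restrict G) := hη.memLp_of_hasCompactSupport hs
  have hηc : MemLp (η ∘ horiz) 2 (volume.restrict (channel G ζ)) :=
    hηG.comp_measurePreserving (measurePreserving_horiz hG hζ)
  have hi1 : Integrable (fun x' => η x' • avg hG hζ F u x') (volume.restrict G) :=
    memLp_one_iff_integrable.1 ((Lp.memLp _).smul (r := 1) hηG)
  have hi2 : Integrable (fun x => η (horiz x) • u x) (volume.restrict (channel G ζ)) :=
    memLp_one_iff_integrable.1 ((Lp.memLp u).smul (r := 1) hηc)
  refine ext_inner_left ℝ fun v => ?_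
  rw [← integral_inner hi1, ← integral_inner hi2]
  have hq : MemLp (fun x' => η x' • v) 2 (volume.restrict G) := by
    refine MemLp.of_bound (hη.smul continuous_const).aestronglyMeasurable (C * ‖v‖)
      (Eventually.of_forall fun x' => ?_)
    rw [norm_smul]
    exact mul_le_mul_of_nonneg_right (hC x') (norm_nonneg _)
  have h1 := inner_avg hG hζ hq.toLp u
  rw [L2.inner_def, L2.inner_def] at h1
  have e1 : ∫ x' in G, inner ℝ v (η x' • avg hG hζ F u x')
      = ∫ x' in G, inner ℝ ((hq.toLp : Lp F 2 (volume.restrict G)) x') (avg hG hζ F u x') := by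
    refine integral_congr_ae ?_
    filter_upwards [hq.coeFn_toLp] with x hx
    rw [hx, inner_smul_left, inner_smul_right]
    rfl
  have e2 : ∫ x in channel G ζ, inner ℝ v (η (horiz x) • u x)
      = ∫ x in channel G ζ, inner ℝ (lift hG hζ F hq.toLp x) (u x) := by
    refine integral_congr_ae ?_
    filter_upwards [lift_coe hG hζ hq.toLp,
      (measurePreserving_horiz hG hζ).quasiMeasurePreserving.ae hq.coeFn_toLp] with x h2 h3
    rw [h2, h3, inner_smul_left, inner_smul_right]
    rfl
  rw [e1, e2, h1]

lemma bddAbove_norm {φ : Space d → ℝ} (hφ : Continuous φ) (hs : HasCompactSupport φ) :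
    ∃ C, 0 ≤ C ∧ ∀ x, |φ x| ≤ C := by
  obtain ⟨C, hC⟩ := hφ.bounded_above_of_compact_support hs
  exact ⟨C, (norm_nonneg _).trans (hC 0), hC⟩

lemma pderiv_mul_horiz {φ : Space d → ℝ} {η : Base d → ℝ} (hφ : Differentiable ℝ φ)
    (hη : Differentiable ℝ η) (x : Space d) :
    pderiv (Fin.last d) (fun x => η (horiz x) * φ x) x
      = η (horiz x) * pderiv (Fin.last d) φ x := by
  have h1 : HasDerivAt (fun t : ℝ => η (horiz x) * φ (pt (horiz x) t))
      (η (horiz x) * pderiv (Fin.last d) φ x) (x (Fin.last d)) := by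
    have := hasDerivAt_comp_pt hφ (horiz x) 0 (x (Fin.last d))
    simp only [zero_add, pt_horiz] at this
    exact this.const_mul _
  have hd : Differentiable ℝ fun x : Space d => η (horiz x) * φ x :=
    (hη.comp (contDiff_horiz (n := 1) |>.differentiable (by simp))).mul hφ
  have h2 := hasDerivAt_comp_pt hd (horiz x) 0 (x (Fin.last d))
  simp only [zero_add, pt_horiz, horiz_pt] at h2
  exact h2.unique h1

/-- The definition of the traces, localized on the base: the vertical average of `∂_z (φ w)` is the
difference of the boundary values of `φ w`. -/
lemma HasTraces.avg_eq (hG : IsOpen G) (hGb : Bornology.IsBounded G) (hζ : ContinuousOn ζ G)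
    {w dw : L2 (channel G ζ) F} {g₀ g₁ : Lp F 2 (volume.restrict G)}
    (h : HasTraces G ζ w dw g₀ g₁) {φ : Space d → ℝ} (hφ : ContDiff ℝ ∞ φ)
    (hs : HasCompactSupport φ) {Y : L2 (channel G ζ) F}
    (hY : ∀ᵐ x ∂(volume.restrict (channel G ζ)),
      Y x = φ x • dw x + pderiv (Fin.last d) φ x • w x) :
    ∀ᵐ x' ∂(volume.restrict G), avg hG hζ F Y x'
      = φ (pt x' (ζ x' + 1)) • g₁ x' - φ (pt x' (ζ x')) • g₀ x' := by
  have := isFiniteMeasure_restrict hGb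
  have hint : ∀ c (g : Lp F 2 (volume.restrict G)),
      Integrable (fun x' => φ (pt x' (ζ x' + c)) • g x') (volume.restrict G) := fun c g =>
    memLp_one_iff_integrable.1
      ((Lp.memLp g).smul (r := 1) (memLp_comp_pt hφ.continuous hs hG hGb hζ c))
  have hi0 : Integrable (fun x' => φ (pt x' (ζ x')) • g₀ x') (volume.restrict G) := by
    simpa using hint 0 g₀
  have hi : Integrable (fun x' => avg hG hζ F Y x'
      - (φ (pt x' (ζ x' + 1)) • g₁ x' - φ (pt x' (ζ x')) • g₀ x')) (volume.restrict G) :=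
    ((Lp.memLp _).integrable one_le_two).sub ((hint 1 g₁).sub hi0)
  have hz := hG.ae_eq_zero_of_integral_contDiff_smul_eq_zero
    (IntegrableOn.locallyIntegrableOn (μ := volume) hi) fun η hη hηs hηG => by
    have e1 := integral_smul_avg hG hGb hζ hη.continuous hηs Y
    have hφη : ContDiff ℝ ∞ fun x : Space d => η (horiz x) * φ x :=
      (hη.comp contDiff_horiz).mul hφ
    have e2 := h _ hφη hs.mul_left
    have e3 : ∫ x in channel G ζ, η (horiz x) • Y x
        = ∫ x in channel G ζ, ((η (horiz x) * φ x) • dw x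
          + pderiv (Fin.last d) (fun x => η (horiz x) * φ x) x • w x) := by
      refine integral_congr_ae ?_
      filter_upwards [hY] with x hx
      rw [hx, pderiv_mul_horiz (hφ.differentiable (by simp)) (hη.differentiable (by simp)),
        smul_add, smul_smul, smul_smul]
    obtain ⟨C, hC⟩ := hη.continuous.bounded_above_of_compact_support hηs
    have hb : ∀ {f : Base d → F}, Integrable f (volume.restrict G) →
        Integrable (fun x' => η x' • f x') (volume.restrict G) := fun hf =>
      hf.bdd_smul C hη.continuous.aestronglyMeasurable (Eventually.of_forall hC)
    rw [← setIntegral_eq_integral_of_forall_compl_eq_zero (s := G)]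
    · simp_rw [smul_sub]
      have hi' : Integrable (fun x' => η x' • φ (pt x' (ζ x' + 1)) • g₁ x'
          - η x' • φ (pt x' (ζ x')) • g₀ x') (volume.restrict G) :=
        (hb (hint 1 g₁)).sub (hb hi0)
      rw [integral_sub (hb ((Lp.memLp _).integrable one_le_two)) hi',
        integral_sub (hb (hint 1 g₁)) (hb hi0), e1, e3, e2]
      simp only [horiz_pt, smul_smul, sub_self]
    · intro x hx
      rw [image_eq_zero_of_notMem_tsupport fun h => hx (hηG h), zero_smul]
  filter_upwards [(ae_restrict_iff' hG.measurableSet).2 hz] with x' hx'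
  exact sub_eq_zero.1 hx'

/-- Integration by parts with traces contains the weak vertical derivative. -/
lemma isWeakPartial_of_hasTraces {F : Type} [NormedAddCommGroup F] [NormedSpace ℝ F]
    {w dw : L2 (channel G ζ) F} {g₀ g₁ : Lp F 2 (volume.restrict G)}
    (h : HasTraces G ζ w dw g₀ g₁) : IsWeakPartial (channel G ζ) (Fin.last d) w dw := by
  intro φ hφ
  have h1 := h φ hφ.1 hφ.2.1
  have hz : ∀ x', ∀ c ∈ ({0, 1} : Set ℝ), φ (pt x' (ζ x' + c)) = 0 := fun x' c hc =>
    image_eq_zero_of_notMem_tsupport fun hx => by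
      have := hφ.2.2 hx
      simp only [channel, mem_ofPred_eq, pt_last, horiz_pt] at this
      rcases hc with rfl | rfl <;> linarith [this.2.1, this.2.2]
  have h0 : ∀ x', φ (pt x' (ζ x')) = 0 := fun x' => by simpa using hz x' 0 (by simp)
  simp only [hz _ 1 (by simp), h0, zero_smul, integral_zero, sub_zero] at h1
  rw [integral_add (integrable_smul_L2 hφ.1.continuous hφ.2.1 dw)
    (integrable_smul_L2 (hφ.pderiv _).1 (hφ.pderiv _).2 w)] at h1
  exact eq_neg_of_add_eq_zero_right h1

omit [CompleteSpace F] in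
/-- The vertical derivative of `φ w`, as an element of `L²`. -/
lemma exists_vertical_deriv_mul {φ : Space d → ℝ} (hφ : ContDiff ℝ ∞ φ) (hs : HasCompactSupport φ)
    (w dw : L2 (channel G ζ) F) :
    ∃ Y : L2 (channel G ζ) F, ∀ᵐ x ∂(volume.restrict (channel G ζ)),
      Y x = φ x • dw x + pderiv (Fin.last d) φ x • w x := by
  obtain ⟨C, hC0, hC⟩ := bddAbove_norm hφ.continuous hs
  obtain ⟨C', hC0', hC'⟩ := bddAbove_norm (continuous_pderiv hφ (Fin.last d))
    (hasCompactSupport_pderiv hs _)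
  have b1 := isBddField_smul (volume.restrict (channel G ζ)) hφ.continuous.aestronglyMeasurable
    hC0 (Eventually.of_forall hC) F
  have b2 := isBddField_smul (volume.restrict (channel G ζ))
    (continuous_pderiv hφ (Fin.last d)).aestronglyMeasurable
    hC0' (Eventually.of_forall hC') F
  refine ⟨fieldMul b1 dw + fieldMul b2 w, ?_⟩
  filter_upwards [Lp.coeFn_add (fieldMul b1 dw) (fieldMul b2 w), fieldMul_coe b1 dw,
    fieldMul_coe b2 w] with x h1 h2 h3
  rw [h1, Pi.add_apply, h2, h3]
  rfl

/-- The normal component of the traces is the trace of the normal component. -/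
lemma HasTraces.normal_component (hG : IsOpen G) (hGb : Bornology.IsBounded G)
    (hζ : ContinuousOn ζ G) {w dw : L2 (channel G ζ) (Space d)}
    {g₀ g₁ : Lp (Space d) 2 (volume.restrict G)} (h : HasTraces G ζ w dw g₀ g₁) :
    HasTraces G ζ (normalDot ζ _ continuous_horiz.measurable w)
      (normalDot ζ _ continuous_horiz.measurable dw)
      (normalDot ζ _ measurable_id g₀) (normalDot ζ _ measurable_id g₁) := by
  intro φ hφ hs
  have := isFiniteMeasure_restrict hGb
  obtain ⟨Y, hY⟩ := exists_vertical_deriv_mul hφ hs w dw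
  have hn : MemLp (normal ζ) 2 (volume.restrict G) :=
    MemLp.of_bound (measurable_normal ζ).aestronglyMeasurable 1
      (Eventually.of_forall fun x => (norm_normal ζ x).le)
  have key := inner_avg hG hζ hn.toLp Y
  rw [L2.inner_def, L2.inner_def] at key
  have hint : ∀ c (g : Lp ℝ 2 (volume.restrict G)),
      Integrable (fun x' => φ (pt x' (ζ x' + c)) • g x') (volume.restrict G) := fun c g =>
    memLp_one_iff_integrable.1
      ((Lp.memLp g).smul (r := 1) (memLp_comp_pt hφ.continuous hs hG hGb hζ c))
  have hi0 := hint 0 (normalDot ζ _ measurable_id g₀)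
  simp only [add_zero] at hi0
  rw [← integral_sub (hint 1 _) hi0]
  refine Eq.trans ?_ (key.symm.trans ?_)
  · refine integral_congr_ae ?_
    filter_upwards [hY, normalDot_coe ζ _ continuous_horiz.measurable w,
      normalDot_coe ζ _ continuous_horiz.measurable dw, lift_coe hG hζ hn.toLp,
      (measurePreserving_horiz hG hζ).quasiMeasurePreserving.ae hn.coeFn_toLp] with x h1 h2 h3 h4 h5
    rw [h1, h2, h3, h4, h5, inner_add_right, inner_smul_right, inner_smul_right,
      real_inner_comm, real_inner_comm (w x)]
    rfl
  · refine integral_congr_ae ?_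
    filter_upwards [h.avg_eq hG hGb hζ hφ hs hY, hn.coeFn_toLp,
      normalDot_coe ζ _ measurable_id g₀, normalDot_coe ζ _ measurable_id g₁] with x h1 h2 h3 h4
    rw [h1, h2, h3, h4, inner_sub_right, inner_smul_right, inner_smul_right,
      real_inner_comm, real_inner_comm (g₀ x)]
    rfl

lemma pt_mem_closure_channel {x' : Base d} (hx' : x' ∈ G) {s : ℝ} (hs : s ∈ Icc (0 : ℝ) 1) :
    pt x' (ζ x' + s) ∈ closure (channel G ζ) := by
  have hc : Continuous fun s : ℝ => pt x' (ζ x' + s) := (continuous_pt x').comp (by fun_prop)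
  have h1 := hc.continuousOn.image_closure (s := Ioo (0 : ℝ) 1)
  rw [closure_Ioo zero_ne_one] at h1
  refine closure_mono ?_ (h1 ⟨s, hs, rfl⟩)
  rintro _ ⟨t, ht, rfl⟩
  exact mem_channel_of_mem hx' ht

/-- If the trace on `Γ + 1` vanishes, then the trace on `Γ` and the vertical average are controlled
by the vertical derivative; test functions that are `1` and `z` near the channel show it. -/
lemma HasTraces.avg_eq_of_top_zero (hG : IsOpen G) (hGb : Bornology.IsBounded G)
    (hζ : ContinuousOn ζ G) {L : ℝ} (hL0 : 0 ≤ L) (hL : ∀ x ∈ G, |ζ x| ≤ L)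
    {u du : L2 (channel G ζ) F} {g₀ : Lp F 2 (volume.restrict G)}
    (h : HasTraces G ζ u du g₀ 0) :
    avg hG hζ F du = -g₀ ∧ ‖avg hG hζ F u‖ ≤ (2 * L + 1) * ‖du‖ := by
  obtain ⟨R, hR⟩ := (isBounded_channel hGb hL).closure.exists_norm_le
  have hR0 : 0 ≤ max R 0 := le_max_right _ _
  let b : ContDiffBump (0 : Space d) := ⟨max R 0 + 1, max R 0 + 2, by positivity, by linarith⟩
  have hb1 : ∀ x ∈ closure (channel G ζ), (b : Space d → ℝ) =ᶠ[𝓝 x] fun _ => 1 := fun x hx => by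
    refine b.eventuallyEq_one_of_mem_ball ?_
    rw [mem_ball_zero_iff]
    exact ((hR x hx).trans (le_max_left _ _)).trans_lt (lt_add_one _)
  have hz : ContDiff ℝ ∞ fun x : Space d => x (Fin.last d) :=
    (EuclideanSpace.proj (𝕜 := ℝ) (Fin.last d)).contDiff
  have hmem := ae_restrict_mem (μ := volume) (isOpen_channel hG hζ).measurableSet
  have hav : avg hG hζ F du = -g₀ := by
    have h1 := h.avg_eq hG hGb hζ b.contDiff b.hasCompactSupport (Y := du) (by
      filter_upwards [hmem] with x hx
      have h2 := hb1 x (subset_closure hx)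
      rw [h2.eq_of_nhds, pderiv, h2.fderiv_eq]
      simp)
    refine Lp.ext ?_
    filter_upwards [h1, ae_restrict_mem hG.measurableSet, Lp.coeFn_neg g₀,
      Lp.coeFn_zero F 2 (volume.restrict G)] with x' h2 h3 h4 h5
    have h6 := (hb1 _ (pt_mem_closure_channel h3 (s := 0) (by simp))).eq_of_nhds
    rw [add_zero] at h6
    rw [h2, h4, h5, h6]
    simp
  refine ⟨hav, ?_⟩
  have bz := isBddField_smul (volume.restrict (channel G ζ))
    hz.continuous.aestronglyMeasurable (C := L + 1) (by linarith) (by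
      filter_upwards [hmem] with x hx
      have := abs_le.1 (hL _ hx.1)
      exact abs_le.2 ⟨by linarith [hx.2.1], by linarith [hx.2.2]⟩) F
  have bζ := isBddField_smul (volume.restrict G) (hζ.aestronglyMeasurable hG.measurableSet) hL0
    (by filter_upwards [ae_restrict_mem hG.measurableSet] with x hx using hL x hx) F
  have h1 := h.avg_eq hG hGb hζ (b.contDiff.mul hz) b.hasCompactSupport.mul_right
    (Y := fieldMul bz du + u) (by
      filter_upwards [hmem, Lp.coeFn_add (fieldMul bz du) u, fieldMul_coe bz du] with x hx h2 h3
      have h4 : (fun x => b x * x (Fin.last d)) =ᶠ[𝓝 x] fun x => x (Fin.last d) := by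
        filter_upwards [hb1 x (subset_closure hx)] with y hy
        rw [hy, one_mul]
      have h5 : pderiv (Fin.last d) (fun x => b x * x (Fin.last d)) x = 1 := by
        rw [pderiv, h4.fderiv_eq]
        have := (EuclideanSpace.proj (𝕜 := ℝ) (Fin.last d)).hasFDerivAt (x := x)
        have h6 : (fun x : Space d => x (Fin.last d))
          = EuclideanSpace.proj (𝕜 := ℝ) (Fin.last d) := rfl
        rw [h6, this.fderiv]
        simp
      rw [h2, Pi.add_apply, h3, h5, h4.eq_of_nhds, one_smul]
      rfl)
  have h2 : avg hG hζ F u = fieldMul bζ (avg hG hζ F du) - avg hG hζ F (fieldMul bz du) := by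
    rw [eq_sub_iff_add_eq', ← map_add]
    refine Lp.ext ?_
    rw [hav]
    filter_upwards [h1, ae_restrict_mem hG.measurableSet, fieldMul_coe bζ (-g₀), Lp.coeFn_neg g₀,
      Lp.coeFn_zero F 2 (volume.restrict G)] with x' h2 h3 h4 h5 h6
    have h7 := (hb1 _ (pt_mem_closure_channel h3 (s := 0) (by simp))).eq_of_nhds
    rw [add_zero] at h7
    rw [h2, h4, h5, h6, h7]
    simp
  rw [h2]
  have n1 := norm_fieldMul_le bζ (avg hG hζ F du)
  have n2 := norm_avg_le hG hζ du
  have n3 := norm_avg_le hG hζ (fieldMul bz du)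
  have n4 := norm_fieldMul_le bz du
  have n5 := mul_le_mul_of_nonneg_left n2 hL0
  have n6 := norm_sub_le (fieldMul bζ (avg hG hζ F du)) (avg hG hζ F (fieldMul bz du))
  linarith

/-- The Poincaré inequality for the normal component of a field that vanishes on the lateral wall
and is tangential on `Γ + 1`. -/
lemma VanishesOnWall.norm_normal_component_le (hG : IsOpen G) (hGb : Bornology.IsBounded G)
    (hζ : ContinuousOn ζ G) {L : ℝ} (hL0 : 0 ≤ L) (hL : ∀ x ∈ G, |ζ x| ≤ L)
    {w : H1V (channel G ζ)} (hw : VanishesOnWall G ζ w) {g₀ : Lp ℝ 2 (volume.restrict G)}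
    (h : HasTraces G ζ (normalDot ζ _ continuous_horiz.measurable w.fn)
      (normalDot ζ _ continuous_horiz.measurable w.dz) g₀ 0) :
    ‖normalDot ζ (volume.restrict (channel G ζ)) continuous_horiz.measurable w.fn‖
      ≤ (2 * L + 2) * ‖w.dz‖ := by
  set N := normalDot ζ (volume.restrict (channel G ζ)) continuous_horiz.measurable
  set p := avg hG hζ _ w.fn with hp
  have h1 := (h.avg_eq_of_top_zero hG hGb hζ hL0 hL).2
  have h2 : N (lift hG hζ _ p) = lift hG hζ _ (normalDot ζ _ measurable_id p) := by
    refine Lp.ext ?_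
    filter_upwards [normalDot_coe ζ _ continuous_horiz.measurable (lift hG hζ _ p),
      lift_coe hG hζ p, lift_coe hG hζ (normalDot ζ _ measurable_id p),
      (measurePreserving_horiz hG hζ).quasiMeasurePreserving.ae
        (normalDot_coe ζ _ measurable_id p)] with x h3 h4 h5 h6
    rw [h3, h4, h5, h6]
    rfl
  have h3 : ‖N w.fn - lift hG hζ _ (avg hG hζ _ (N w.fn))‖ ≤ ‖w.dz‖ := by
    refine (DarcyStokes.norm_sub_lift_avg_le hG hζ _ (normalDot ζ _ measurable_id p)).trans ?_
    rw [← h2, ← map_sub]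
    exact (norm_normalDot_le _ _ _ _).trans (hw.norm_sub_lift_avg_le hG hGb hζ)
  have h4 : ‖N w.fn‖ ≤ ‖N w.fn - lift hG hζ _ (avg hG hζ _ (N w.fn))‖
      + ‖lift hG hζ _ (avg hG hζ _ (N w.fn))‖ := norm_le_norm_sub_add _ _
  rw [LinearIsometry.norm_map] at h4
  have h5 : (2 * L + 1) * ‖N w.dz‖ ≤ (2 * L + 1) * ‖w.dz‖ :=
    mul_le_mul_of_nonneg_left (norm_normalDot_le _ _ _ _) (by linarith)
  linarith

end traces

/-! ### A right inverse of the divergence on the lower domain -/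

section pressure

/-- If `|B v| ≤ M ‖A v‖`, then `B` factors through `A` by an element of norm at most `M`. -/
lemma exists_inner_eq_of_le {V H : Type*} [AddCommGroup V] [Module ℝ V] [NormedAddCommGroup H]
    [InnerProductSpace ℝ H] [CompleteSpace H] (A : V →ₗ[ℝ] H) (B : V →ₗ[ℝ] ℝ) {M : ℝ} (hM : 0 ≤ M)
    (h : ∀ v, |B v| ≤ M * ‖A v‖) : ∃ W : H, ‖W‖ ≤ M ∧ ∀ v, inner ℝ W (A v) = B v := by
  have hker : LinearMap.ker A ≤ LinearMap.ker B := fun v hv => by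
    have h1 := h v
    rw [LinearMap.mem_ker.1 hv, norm_zero, mul_zero] at h1
    exact abs_nonpos_iff.1 h1
  let f₀ : LinearMap.range A →ₗ[ℝ] ℝ :=
    ((LinearMap.ker A).liftQ B hker) ∘ₗ A.quotKerEquivRange.symm.toLinearMap
  have hf₀ : ∀ v, f₀ ⟨A v, LinearMap.mem_range_self A v⟩ = B v := fun v => by
    have : A.quotKerEquivRange.symm ⟨A v, LinearMap.mem_range_self A v⟩
        = (LinearMap.ker A).mkQ v := by
      rw [LinearEquiv.symm_apply_eq]
      rfl
    simp only [f₀, LinearMap.comp_apply, LinearEquiv.coe_coe, this]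
    exact Submodule.liftQ_apply _ _ _
  let f : StrongDual ℝ (LinearMap.range A) := f₀.mkContinuous M fun y => by
    obtain ⟨_, v, rfl⟩ := y
    rw [hf₀]
    exact h v
  obtain ⟨g, hg, hgn⟩ := exists_extension_norm_eq (LinearMap.range A) f
  refine ⟨(InnerProductSpace.toDual ℝ H).symm g, ?_, fun v => ?_⟩
  · rw [LinearIsometryEquiv.norm_map, hgn]
    exact LinearMap.mkContinuous_norm_le _ hM _
  · rw [InnerProductSpace.toDual_symm_apply]
    exact (hg ⟨A v, LinearMap.mem_range_self A v⟩).trans (hf₀ v)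

lemma IsTest.add {U : Set (Space d)} {φ ψ : Space d → ℝ} (hφ : IsTest U φ) (hψ : IsTest U ψ) :
    IsTest U (φ + ψ) :=
  ⟨hφ.1.add hψ.1, hφ.2.1.add hψ.2.1,
    (closure_minimal ((Function.support_add φ ψ).trans
      (union_subset_union (subset_tsupport φ) (subset_tsupport ψ)))
      ((isClosed_tsupport φ).union (isClosed_tsupport ψ))).trans (union_subset hφ.2.2 hψ.2.2)⟩

/-- The vector space `C_c^∞(U)`. -/
def testSpace (U : Set (Space d)) : Submodule ℝ (Space d → ℝ) where
  carrier := {φ | IsTest U φ}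
  zero_mem' := ⟨contDiff_const, HasCompactSupport.zero, by simp [tsupport]⟩
  add_mem' := IsTest.add
  smul_mem' := fun c φ hφ => ⟨contDiff_const.smul hφ.1, hφ.2.1.smul_left (f := fun _ => c),
    (closure_mono (Function.support_const_smul_subset c φ)).trans hφ.2.2⟩

/-- The vertical derivative on test functions, restricted to `Ω₁`. -/
def testDz (U Ω₁ : Set (Space d)) : testSpace U →ₗ[ℝ] L2 Ω₁ ℝ where
  toFun φ := smoothLp Ω₁ (continuous_pderiv φ.2.1 (Fin.last d)) (hasCompactSupport_pderiv φ.2.2.1 _)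
  map_add' φ ψ := by
    refine Lp.ext ?_
    filter_upwards [smoothLp_coe Ω₁ (continuous_pderiv (φ + ψ).2.1 (Fin.last d))
      (hasCompactSupport_pderiv (φ + ψ).2.2.1 _),
      Lp.coeFn_add (smoothLp Ω₁ (continuous_pderiv φ.2.1 (Fin.last d))
        (hasCompactSupport_pderiv φ.2.2.1 _)) (smoothLp Ω₁ (continuous_pderiv ψ.2.1 (Fin.last d))
        (hasCompactSupport_pderiv ψ.2.2.1 _)),
      smoothLp_coe Ω₁ (continuous_pderiv φ.2.1 (Fin.last d)) (hasCompactSupport_pderiv φ.2.2.1 _),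
      smoothLp_coe Ω₁ (continuous_pderiv ψ.2.1 (Fin.last d))
        (hasCompactSupport_pderiv ψ.2.2.1 _)] with x h1 h2 h3 h4
    rw [h1, h2, Pi.add_apply, h3, h4]
    simp only [pderiv, Submodule.coe_add]
    rw [fderiv_add (φ.2.1.differentiable (by simp) x) (ψ.2.1.differentiable (by simp) x)]
    rfl
  map_smul' c φ := by
    refine Lp.ext ?_
    filter_upwards [smoothLp_coe Ω₁ (continuous_pderiv (c • φ).2.1 (Fin.last d))
      (hasCompactSupport_pderiv (c • φ).2.2.1 _),
      Lp.coeFn_smul c (smoothLp Ω₁ (continuous_pderiv φ.2.1 (Fin.last d))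
        (hasCompactSupport_pderiv φ.2.2.1 _)),
      smoothLp_coe Ω₁ (continuous_pderiv φ.2.1 (Fin.last d))
        (hasCompactSupport_pderiv φ.2.2.1 _)] with x h1 h2 h3
    rw [h1, RingHom.id_apply, h2, Pi.smul_apply, h3]
    simp only [pderiv, Submodule.coe_smul]
    rw [fderiv_const_smul (φ.2.1.differentiable (by simp) x)]
    rfl

/-- The integral of a test function against `p ∈ L²(Ω₁)`, with a minus sign. -/
def testPairing (U : Set (Space d)) {Ω₁ : Set (Space d)} (p : L2 Ω₁ ℝ) : testSpace U →ₗ[ℝ] ℝ where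
  toFun φ := - ∫ x in Ω₁, φ.1 x * p x
  map_add' φ ψ := by
    have h1 := integrable_smul_L2 φ.2.1.continuous φ.2.2.1 p
    have h2 := integrable_smul_L2 ψ.2.1.continuous ψ.2.2.1 p
    simp only [smul_eq_mul] at h1 h2
    rw [← neg_add, ← integral_add h1 h2]
    simp [add_mul]
  map_smul' c φ := by
    rw [RingHom.id_apply, smul_eq_mul, mul_neg, ← integral_const_mul]
    simp [mul_assoc]

lemma integral_pderiv_eq_zero {Φ : Space d → ℝ} (hΦ : ContDiff ℝ 1 Φ) (hs : HasCompactSupport Φ)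
    (j : Fin (d + 1)) : ∫ x, pderiv j Φ x = 0 := by
  have hc : Continuous (pderiv j Φ) := (hΦ.continuous_fderiv (by simp)).clm_apply continuous_const
  have hcs : HasCompactSupport (pderiv j Φ) := hs.fderiv_apply (𝕜 := ℝ) _
  have h := integral_mul_fderiv_eq_neg_fderiv_mul_of_integrable (μ := (volume : Measure (Space d)))
    (f := fun _ => (1 : ℝ)) (g := Φ) (v := EuclideanSpace.single j 1) (by simp)
    (by simpa using! hc.integrable_of_hasCompactSupport hcs)
    (by simpa using hΦ.continuous.integrable_of_hasCompactSupport hs)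
    (fun x _ => differentiableAt_const _) (fun x _ => hΦ.differentiable (by simp) x)
  simpa [pderiv] using h

variable {G₀ G : Set (Base d)} {ζ : Base d → ℝ} {Ω₁ : Set (Space d)}

lemma IsGeometry.continuousOn (hg : IsGeometry G₀ G ζ Ω₁) : ContinuousOn ζ G :=
  hg.contDiffOn.continuousOn.mono (subset_closure.trans hg.closure_subset)

lemma IsGeometry.isBounded (hg : IsGeometry G₀ G ζ Ω₁) : Bornology.IsBounded G :=
  hg.isBounded_G₀.subset (subset_closure.trans hg.closure_subset)

lemma IsGeometry.contDiffOn_one (hg : IsGeometry G₀ G ζ Ω₁) : ContDiffOn ℝ 1 ζ G :=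
  (hg.contDiffOn.of_le (by norm_num)).mono (subset_closure.trans hg.closure_subset)

/-- `ζ` and its gradient are bounded on `G`. -/
lemma IsGeometry.exists_bound (hg : IsGeometry G₀ G ζ Ω₁) :
    ∃ L, 0 ≤ L ∧ (∀ x ∈ G, |ζ x| ≤ L) ∧ ∀ x ∈ G, ‖gradient ζ x‖ ≤ L := by
  have hK : IsCompact (closure G) := hg.isBounded.isCompact_closure
  have h1 : ContinuousOn ζ (closure G) := hg.contDiffOn.continuousOn.mono hg.closure_subset
  have h2 : ContinuousOn (fderiv ℝ ζ) (closure G) :=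
    (hg.contDiffOn.continuousOn_fderiv_of_isOpen hg.isOpen_G₀ (by norm_num)).mono hg.closure_subset
  obtain ⟨L₁, hL₁⟩ := hK.exists_bound_of_continuousOn h1
  obtain ⟨L₂, hL₂⟩ := hK.exists_bound_of_continuousOn h2
  refine ⟨max 0 (max L₁ L₂), le_max_left _ _, fun x hx => ?_, fun x hx => ?_⟩
  · exact (hL₁ x (subset_closure hx)).trans ((le_max_left _ _).trans (le_max_right _ _))
  · rw [gradient, LinearIsometryEquiv.norm_map]
    exact (hL₂ x (subset_closure hx)).trans ((le_max_right _ _).trans (le_max_right _ _))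

/-- The upper boundary `Γ + 1` of the channel lies outside `Ω`. -/
lemma IsGeometry.top_notMem (hg : IsGeometry G₀ G ζ Ω₁) {x' : Base d} (hx' : x' ∈ G) :
    pt x' (ζ x' + 1) ∉ wholeDomain Ω₁ G ζ := by
  rintro ((h | ⟨y, hy, h⟩) | h)
  · obtain ⟨y, hy⟩ := mem_closure_iff.1 (pt_mem_closure_channel hx' (s := 1) (by simp))
      Ω₁ hg.isOpen_Ω₁ h
    exact disjoint_left.1 hg.disjoint hy.1 hy.2
  · have h1 := congrArg horiz h
    have h2 := congrArg (fun x : Space d => x (Fin.last d)) h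
    simp only [horiz_pt, pt_last] at h1 h2
    rw [h1] at h2
    linarith
  · simp only [channel, mem_ofPred_eq, pt_last, horiz_pt] at h
    linarith [h.2.2]

/-- For a compactly supported `Φ` in `Ω`, the integral of `∂_z Φ` over `Ω₁` is a boundary integral
over the interface, since Fubini's theorem computes the integral over the channel. -/
lemma IsGeometry.integral_pderiv (hg : IsGeometry G₀ G ζ Ω₁) {Φ : Space d → ℝ}
    (hΦ : IsTest (wholeDomain Ω₁ G ζ) Φ) :
    ∫ x in Ω₁, pderiv (Fin.last d) Φ x = ∫ x' in G, Φ (pt x' (ζ x')) := by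
  have hm := measurable_indicator_of_continuousOn hg.isOpen_G hg.continuousOn
  have hc := continuous_pderiv hΦ.1 (Fin.last d)
  have hi : Integrable (pderiv (Fin.last d) Φ) :=
    hc.integrable_of_hasCompactSupport (hasCompactSupport_pderiv hΦ.2.1 _)
  have h0 : ∫ x in wholeDomain Ω₁ G ζ, pderiv (Fin.last d) Φ x = 0 := by
    rw [setIntegral_eq_integral_of_forall_compl_eq_zero,
      integral_pderiv_eq_zero (hΦ.1.of_le (by simp)) hΦ.2.1]
    intro x hx
    have h1 : x ∉ tsupport (fderiv ℝ Φ) := fun h => hx (hΦ.2.2 (tsupport_fderiv_subset ℝ h))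
    rw [pderiv, image_eq_zero_of_notMem_tsupport h1]
    rfl
  have h1 : (wholeDomain Ω₁ G ζ : Set (Space d)) =ᵐ[volume] (Ω₁ ∪ channel G ζ : Set (Space d)) := by
    have hn : (surface G ζ 0 : Set (Space d)) =ᵐ[volume] (∅ : Set (Space d)) :=
      ae_eq_empty.2 (volume_surface hg.isOpen_G hg.continuousOn)
    have := (ae_eq_set_union (ae_eq_refl Ω₁) hn).union (ae_eq_refl (channel G ζ))
    simpa [wholeDomain] using this
  rw [setIntegral_congr_set h1, setIntegral_union hg.disjoint
    (isOpen_channel hg.isOpen_G hg.continuousOn).measurableSet hi.integrableOn hi.integrableOn,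
    integral_channel hm hg.isOpen_G.measurableSet hi.integrableOn] at h0
  rw [eq_neg_of_add_eq_zero_left h0, ← integral_neg]
  refine setIntegral_congr_fun hg.isOpen_G.measurableSet fun x' hx' => ?_
  have htop : Φ (pt x' (ζ x' + 1)) = 0 :=
    image_eq_zero_of_notMem_tsupport fun h => hg.top_notMem hx' (hΦ.2.2 h)
  have hftc := intervalIntegral.integral_eq_sub_of_hasDerivAt (a := 0) (b := 1)
    (fun t _ => hasDerivAt_comp_pt (hΦ.1.differentiable (by simp)) x' (ζ x') t)
    ((hc.comp ((continuous_pt x').comp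
      (by fun_prop : Continuous fun s : ℝ => ζ x' + s))).intervalIntegrable 0 1)
  rw [intervalIntegral.integral_of_le zero_le_one, integral_Ioc_eq_integral_Ioo, htop, add_zero]
    at hftc
  rw [hftc]
  simp

/-- The Poincaré inequality in the vertical direction on `Ω₁` for functions in `C_c^∞(Ω)`, which
need not vanish on the interface. With the multiplier `z - L ≤ 0` on the interface the boundary
integral of `(z - L) φ²` has a sign. -/
lemma IsGeometry.exists_poincare (hg : IsGeometry G₀ G ζ Ω₁) :
    ∃ C, 0 ≤ C ∧ ∀ φ : testSpace (wholeDomain Ω₁ G ζ),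
      ‖smoothLp Ω₁ φ.2.1.continuous φ.2.2.1‖ ≤ C * ‖testDz (wholeDomain Ω₁ G ζ) Ω₁ φ‖ := by
  obtain ⟨L, hL0, hL, -⟩ := hg.exists_bound
  obtain ⟨R, hR⟩ := hg.isBounded_Ω₁.exists_norm_le
  have hz : Continuous fun x : Space d => x (Fin.last d) - L := by fun_prop
  have bz := isBddField_smul (volume.restrict Ω₁) hz.aestronglyMeasurable (C := max R 0 + L)
    (by positivity) (by
      filter_upwards [ae_restrict_mem hg.isOpen_Ω₁.measurableSet] with x hx
      refine (abs_sub _ _).trans (add_le_add ?_ (abs_of_nonneg hL0).le)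
      exact ((PiLp.norm_apply_le x (Fin.last d)).trans (hR x hx)).trans (le_max_left _ _)) ℝ
  refine ⟨2 * (max R 0 + L), by positivity, fun φ => ?_⟩
  set a := smoothLp Ω₁ φ.2.1.continuous φ.2.2.1 with ha
  set b := testDz (wholeDomain Ω₁ G ζ) Ω₁ φ with hb
  have hzs : ContDiff ℝ ∞ fun x : Space d => x (Fin.last d) - L :=
    (EuclideanSpace.proj (𝕜 := ℝ) (Fin.last d)).contDiff.sub contDiff_const
  have hΦ : IsTest (wholeDomain Ω₁ G ζ) fun x => (x (Fin.last d) - L) * (φ.1 x * φ.1 x) :=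
    ⟨hzs.mul (φ.2.1.mul φ.2.1), (φ.2.2.1.mul_right).mul_left,
      (closure_mono (Function.support_subset_iff'.2 fun x hx => by
        simp [Function.notMem_support.1 hx])).trans φ.2.2.2⟩
  have hd : ∀ x, pderiv (Fin.last d) (fun x => (x (Fin.last d) - L) * (φ.1 x * φ.1 x)) x
      = φ.1 x * φ.1 x + 2 * ((x (Fin.last d) - L) * (φ.1 x * pderiv (Fin.last d) φ.1 x)) := by
    intro x
    have h1 : HasFDerivAt (fun x : Space d => x (Fin.last d) - L)
        (EuclideanSpace.proj (𝕜 := ℝ) (Fin.last d)) x :=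
      (EuclideanSpace.proj (𝕜 := ℝ) (Fin.last d)).hasFDerivAt.sub_const L
    have h2 := (φ.2.1.differentiable (by simp) x).hasFDerivAt
    have h3 : HasFDerivAt (fun x : Space d => (x (Fin.last d) - L) * (φ.1 x * φ.1 x)) _ x :=
      h1.mul (h2.mul h2)
    rw [pderiv, h3.fderiv]
    simp [pderiv]
    ring
  have key := hg.integral_pderiv hΦ
  have hle : ∫ x' in G, (pt x' (ζ x') (Fin.last d) - L)
      * (φ.1 (pt x' (ζ x')) * φ.1 (pt x' (ζ x'))) ≤ 0 := by
    refine setIntegral_nonpos hg.isOpen_G.measurableSet fun x' hx' => ?_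
    rw [pt_last]
    exact mul_nonpos_of_nonpos_of_nonneg (by linarith [(abs_le.1 (hL x' hx')).2])
      (mul_self_nonneg _)
  have hinner : ∫ x in Ω₁, pderiv (Fin.last d)
      (fun x => (x (Fin.last d) - L) * (φ.1 x * φ.1 x)) x
        = inner ℝ a a + 2 * inner ℝ a (fieldMul bz b) := by
    rw [L2.inner_def, L2.inner_def, ← integral_const_mul, ← integral_add
      (L2.integrable_inner a a) ((L2.integrable_inner a (fieldMul bz b)).const_mul 2)]
    refine integral_congr_ae ?_
    filter_upwards [smoothLp_coe Ω₁ φ.2.1.continuous φ.2.2.1, fieldMul_coe bz b,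
      smoothLp_coe Ω₁ (continuous_pderiv φ.2.1 (Fin.last d)) (hasCompactSupport_pderiv φ.2.2.1 _)]
      with x h1 h2 h3
    have h3' : b x = pderiv (Fin.last d) φ.1 x := h3
    rw [hd, h1, h2, h3']
    simp
    ring
  rw [hinner, real_inner_self_eq_norm_sq] at key
  have h1 : ‖a‖ ^ 2 ≤ ‖a‖ * (2 * (max R 0 + L) * ‖b‖) := by
    have h2 := abs_real_inner_le_norm a (fieldMul bz b)
    have h3 := mul_le_mul_of_nonneg_left (norm_fieldMul_le bz b) (norm_nonneg a)
    have h4 := neg_abs_le (inner ℝ a (fieldMul bz b))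
    linarith
  rcases (norm_nonneg a).eq_or_lt with h0 | h0
  · rw [← h0]
    positivity
  · rw [sq] at h1
    exact le_of_mul_le_mul_left h1 h0

lemma continuous_gradient {φ : Space d → ℝ} (hφ : ContDiff ℝ ∞ φ) : Continuous (gradient φ) :=
  (InnerProductSpace.toDual ℝ (Space d)).symm.continuous.comp (hφ.continuous_fderiv (by simp))

lemma hasCompactSupport_gradient {φ : Space d → ℝ} (hs : HasCompactSupport φ) :
    HasCompactSupport (gradient φ) :=
  (hs.fderiv (𝕜 := ℝ)).comp_left (g := (InnerProductSpace.toDual ℝ (Space d)).symm) (map_zero _)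

lemma inner_gradLp {φ : Space d → ℝ} (hφ : ContDiff ℝ ∞ φ) (hs : HasCompactSupport φ)
    (u : L2 Ω₁ (Space d)) :
    ∀ᵐ x ∂(volume.restrict Ω₁),
      inner ℝ (smoothLp Ω₁ (continuous_gradient hφ) (hasCompactSupport_gradient hs) x) (u x)
        = inner ℝ (gradient φ x) (u x) := by
  filter_upwards [smoothLp_coe Ω₁ (continuous_gradient hφ) (hasCompactSupport_gradient hs)]
    with x hx
  rw [hx]

lemma integrable_inner_gradLp {φ : Space d → ℝ} (hφ : ContDiff ℝ ∞ φ) (hs : HasCompactSupport φ)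
    (u : L2 Ω₁ (Space d)) :
    Integrable (fun x => inner ℝ (gradient φ x) (u x)) (volume.restrict Ω₁) :=
  (L2.integrable_inner (𝕜 := ℝ) _ u).congr (inner_gradLp hφ hs u)

lemma inner_gradient_single {φ : Space d → ℝ} (x : Space d) (c : ℝ) :
    inner ℝ (gradient φ x) (c • EuclideanSpace.single (Fin.last d) (1 : ℝ))
      = c * pderiv (Fin.last d) φ x := by
  rw [inner_smul_right, gradient, InnerProductSpace.toDual_symm_apply]
  rfl

/-- Every `p ∈ L²(Ω₁)` is the divergence of a vertical field whose normal trace on the interface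
vanishes, with a bound. -/
lemma IsGeometry.exists_div_eq (hg : IsGeometry G₀ G ζ Ω₁) :
    ∃ C, 0 ≤ C ∧ ∀ p : L2 Ω₁ ℝ, ∃ w : HDiv Ω₁, w.div = p ∧ ‖w.fn‖ ≤ C * ‖p‖ ∧
      HasNormalTrace Ω₁ G ζ w fun _ => 0 := by
  obtain ⟨C, hC0, hC⟩ := hg.exists_poincare
  refine ⟨C, hC0, fun p => ?_⟩
  have hpair : ∀ φ : testSpace (wholeDomain Ω₁ G ζ), ∫ x in Ω₁, φ.1 x * p x
      = inner ℝ (smoothLp Ω₁ φ.2.1.continuous φ.2.2.1) p := fun φ => by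
    rw [L2.inner_def]
    refine integral_congr_ae ?_
    filter_upwards [smoothLp_coe Ω₁ φ.2.1.continuous φ.2.2.1] with x hx
    rw [hx]
    simp [mul_comm]
  obtain ⟨W, hW, hWe⟩ := exists_inner_eq_of_le (testDz (wholeDomain Ω₁ G ζ) Ω₁)
    (testPairing (wholeDomain Ω₁ G ζ) p) (M := C * ‖p‖) (by positivity) fun φ => by
      have h1 : |testPairing (wholeDomain Ω₁ G ζ) p φ|
          = |inner ℝ (smoothLp Ω₁ φ.2.1.continuous φ.2.2.1) p| := by
        rw [← hpair, ← abs_neg]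
        simp [testPairing]
      rw [h1]
      refine (abs_real_inner_le_norm _ _).trans ?_
      have := mul_le_mul_of_nonneg_right (hC φ) (norm_nonneg p)
      linarith
  have be : IsBddField (volume.restrict Ω₁)
      (fun _ => ContinuousLinearMap.toSpanSingleton ℝ
        (EuclideanSpace.single (Fin.last d) (1 : ℝ) : Space d)) 1 :=
    ⟨aestronglyMeasurable_const, zero_le_one, Eventually.of_forall fun _ => by simp⟩
  have hWc : ∀ᵐ x ∂(volume.restrict Ω₁), fieldMul be W x
      = W x • EuclideanSpace.single (Fin.last d) (1 : ℝ) := by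
    filter_upwards [fieldMul_coe be W] with x hx
    rw [hx, ContinuousLinearMap.toSpanSingleton_apply]
  have hgreen : ∀ φ, IsTest (wholeDomain Ω₁ G ζ) φ →
      ∫ x in Ω₁, inner ℝ (gradient φ x) (fieldMul be W x) = - ∫ x in Ω₁, φ x * p x := by
    intro φ hφ
    have h1 := hWe ⟨φ, hφ⟩
    rw [L2.inner_def] at h1
    refine Eq.trans (integral_congr_ae ?_) h1
    filter_upwards [hWc, smoothLp_coe Ω₁ (continuous_pderiv hφ.1 (Fin.last d))
      (hasCompactSupport_pderiv hφ.2.1 _)] with x h2 h3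
    have h3' : testDz (wholeDomain Ω₁ G ζ) Ω₁ ⟨φ, hφ⟩ x = pderiv (Fin.last d) φ x := h3
    rw [h2, inner_gradient_single, h3']
    simp [mul_comm]
  have hsub : Ω₁ ⊆ wholeDomain Ω₁ G ζ := fun x hx => Or.inl (Or.inl hx)
  refine ⟨⟨WithLp.toLp 2 (fieldMul be W, p), fun φ hφ => hgreen φ ⟨hφ.1, hφ.2.1,
    hφ.2.2.trans hsub⟩⟩, rfl, ?_, fun φ hφ => ?_⟩
  · refine (norm_fieldMul_le be W).trans ?_
    rw [one_mul]
    exact hW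
  · have h1 := integrable_smul_L2 hφ.1.continuous hφ.2.1 p
    simp only [smul_eq_mul] at h1
    have h2 : ∫ x in Ω₁, (inner ℝ (gradient φ x) (fieldMul be W x) + φ x * p x) = 0 := by
      rw [integral_add (integrable_inner_gradLp hφ.1 hφ.2.1 (fieldMul be W)) h1, hgreen φ hφ]
      ring
    simpa [HDiv.fn, HDiv.div] using h2

end pressure

/-! ### Weak convergence -/

section weak

/-- Bounded sequences in a Hilbert space have weakly convergent subsequences. -/
lemma exists_subseq_tendstoWeakly {H : Type*} [NormedAddCommGroup H] [InnerProductSpace ℝ H]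
    [CompleteSpace H] {u : ℕ → H} {B : ℝ} (hB : ∀ k, ‖u k‖ ≤ B) :
    ∃ s : ℕ → ℕ, StrictMono s ∧ ∃ l, TendstoWeakly (fun k => u (s k)) l := by
  -- the closed span of the sequence is separable
  set S : Submodule ℝ H := (Submodule.span ℝ (range u)).topologicalClosure with hS
  have hsep : TopologicalSpace.IsSeparable (S : Set H) := by
    rw [hS, Submodule.topologicalClosure_coe]
    exact ((countable_range u).isSeparable.span).closure
  have : TopologicalSpace.SeparableSpace S := hsep.separableSpace
  have hmem : ∀ k, u k ∈ S := fun k =>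
    Submodule.le_topologicalClosure _ (Submodule.subset_span (mem_range_self k))
  have : CompleteSpace S := (Submodule.isClosed_topologicalClosure _).completeSpace_coe
  let φ : ℕ → WeakDual ℝ S := fun k =>
    StrongDual.toWeakDual (InnerProductSpace.toDual ℝ S ⟨u k, hmem k⟩)
  obtain ⟨l, -, s, hs, hl⟩ := WeakDual.isSeqCompact_closedBall ℝ S 0 B (x := φ) fun k => by
    simp only [mem_preimage, mem_closedBall_zero_iff]
    exact (LinearIsometryEquiv.norm_map (InnerProductSpace.toDual ℝ S) _).le.trans (hB k)
  refine ⟨s, hs, ((InnerProductSpace.toDual ℝ S).symm (WeakDual.toStrongDual l) : S), fun f => ?_⟩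
  set y := (InnerProductSpace.toDual ℝ S).symm (f ∘L S.subtypeL) with hy
  have hf : ∀ x : S, f x = inner ℝ x y := fun x => by
    rw [real_inner_comm, hy, InnerProductSpace.toDual_symm_apply]
    rfl
  have h1 : Tendsto (fun k => φ (s k) y) atTop (𝓝 (l y)) :=
    ((WeakDual.eval_continuous y).tendsto l).comp hl
  have h2 : l y = f ((InnerProductSpace.toDual ℝ S).symm (WeakDual.toStrongDual l) : S) := by
    rw [hf, InnerProductSpace.toDual_symm_apply]
    rfl
  rw [← h2]
  refine h1.congr fun k => ?_
  exact (hf ⟨u (s k), hmem _⟩).symm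

variable {H K : Type*} [NormedAddCommGroup H] [NormedSpace ℝ H] [NormedAddCommGroup K]
  [NormedSpace ℝ K]

lemma TendstoWeakly.map {u : ℕ → H} {l : H} (h : TendstoWeakly u l) (T : H →L[ℝ] K) :
    TendstoWeakly (fun k => T (u k)) (T l) :=
  fun f => h (f ∘L T)

lemma TendstoWeakly.comp {u : ℕ → H} {l : H} (h : TendstoWeakly u l) {s : ℕ → ℕ}
    (hs : StrictMono s) : TendstoWeakly (fun k => u (s k)) l :=
  fun f => (h f).comp hs.tendsto_atTop

lemma tendstoWeakly_of_tendsto {u : ℕ → H} {l : H} (h : Tendsto u atTop (𝓝 l)) :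
    TendstoWeakly u l :=
  fun f => (f.continuous.tendsto l).comp h

lemma TendstoWeakly.unique {u : ℕ → H} {l l' : H} (h : TendstoWeakly u l)
    (h' : TendstoWeakly u l') : l = l' := by
  by_contra hne
  obtain ⟨f, -, hf⟩ := exists_dual_vector ℝ (l - l') (norm_ne_zero_iff.2 (sub_ne_zero.2 hne))
  have h1 := tendsto_nhds_unique (h f) (h' f)
  rw [map_sub, h1, sub_self] at hf
  exact hne (sub_eq_zero.1 (norm_eq_zero.1 (by simpa using hf.symm)))

end weak

section closed

variable {F : Type} [NormedAddCommGroup F] [NormedSpace ℝ F] {Ω : Set (Space d)}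

/-- Integration against a continuous function with compact support. -/
def testCLM {ψ : Space d → ℝ} (hc : Continuous ψ) (hs : HasCompactSupport ψ) (Ω : Set (Space d))
    (F : Type) [NormedAddCommGroup F] [NormedSpace ℝ F] : L2 Ω F →L[ℝ] F :=
  LinearMap.mkContinuous
    { toFun := fun u => ∫ x in Ω, ψ x • u x
      map_add' := integral_smul_add hc hs
      map_smul' := fun c u => integral_smul_smul ψ c u }
    (eLpNorm ψ 2 (volume.restrict Ω)).toReal fun u => by
      have hm : MemLp ψ 2 (volume.restrict Ω) := hc.memLp_of_hasCompactSupport hs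
      have h1 : ‖∫ x in Ω, ψ x • u x‖ₑ
          ≤ eLpNorm ψ 2 (volume.restrict Ω) * eLpNorm u 2 (volume.restrict Ω) := by
        refine (enorm_integral_le_lintegral_enorm _).trans ?_
        rw [← eLpNorm_one_eq_lintegral_enorm]
        exact eLpNorm_smul_le_mul_eLpNorm (r := 1) (Lp.aestronglyMeasurable u) hm.1
      have h2 := ENNReal.toReal_mono (ENNReal.mul_ne_top hm.2.ne (Lp.eLpNorm_ne_top u)) h1
      rwa [toReal_enorm, ENNReal.toReal_mul, ← Lp.norm_def] at h2

lemma isClosed_h1Submodule : IsClosed (h1Submodule Ω : Set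
    (WithLp 2 (L2 Ω (Space d) × PiLp 2 fun _ : Fin (d + 1) => L2 Ω (Space d)))) := by
  have : (h1Submodule Ω : Set (WithLp 2 (L2 Ω (Space d) × PiLp 2 fun _ : Fin (d + 1) =>
      L2 Ω (Space d)))) = ⋂ j, ⋂ φ, ⋂ hφ : IsTest Ω φ,
        {w | testCLM (hφ.pderiv j).1 (hφ.pderiv j).2 Ω _ w.fst
          = - testCLM hφ.1.continuous hφ.2.1 Ω _ (w.snd j)} := by
    ext w
    simp only [mem_iInter]
    rfl
  rw [this]
  refine isClosed_iInter fun j => isClosed_iInter fun φ => isClosed_iInter fun hφ =>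
    isClosed_eq ?_ ?_
  · exact (testCLM _ _ Ω _).continuous.comp (WithLp.fstL 2 ℝ _ _).continuous
  · exact ((testCLM _ _ Ω _).continuous.comp
      ((PiLp.continuous_apply 2 _ j).comp (WithLp.sndL 2 ℝ _ _).continuous)).neg

lemma isClosed_hzSubmodule :
    IsClosed (hzSubmodule Ω : Set (WithLp 2 (L2 Ω ℝ × L2 Ω ℝ))) := by
  have : (hzSubmodule Ω : Set (WithLp 2 (L2 Ω ℝ × L2 Ω ℝ))) = ⋂ φ, ⋂ hφ : IsTest Ω φ,
        {w | testCLM (hφ.pderiv (Fin.last d)).1 (hφ.pderiv (Fin.last d)).2 Ω _ w.fst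
          = - testCLM hφ.1.continuous hφ.2.1 Ω _ w.snd} := by
    ext w
    simp only [mem_iInter]
    rfl
  rw [this]
  refine isClosed_iInter fun φ => isClosed_iInter fun hφ => isClosed_eq ?_ ?_
  · exact (testCLM _ _ Ω _).continuous.comp (WithLp.fstL 2 ℝ _ _).continuous
  · exact ((testCLM _ _ Ω _).continuous.comp (WithLp.sndL 2 ℝ _ _).continuous).neg

/-- Integration of `∇φ · u`. -/
def gradCLM {φ : Space d → ℝ} (hφ : ContDiff ℝ ∞ φ) (hs : HasCompactSupport φ)
    (Ω : Set (Space d)) : L2 Ω (Space d) →L[ℝ] ℝ :=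
  innerSL ℝ (smoothLp Ω (continuous_gradient hφ) (hasCompactSupport_gradient hs))

lemma gradCLM_apply {φ : Space d → ℝ} (hφ : ContDiff ℝ ∞ φ) (hs : HasCompactSupport φ)
    (u : L2 Ω (Space d)) : gradCLM hφ hs Ω u = ∫ x in Ω, inner ℝ (gradient φ x) (u x) := by
  rw [gradCLM, innerSL_apply_apply, L2.inner_def]
  exact integral_congr_ae (inner_gradLp hφ hs u)

lemma isClosed_hdivSubmodule :
    IsClosed (hdivSubmodule Ω : Set (WithLp 2 (L2 Ω (Space d) × L2 Ω ℝ))) := by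
  have : (hdivSubmodule Ω : Set (WithLp 2 (L2 Ω (Space d) × L2 Ω ℝ))) = ⋂ φ, ⋂ hφ : IsTest Ω φ,
        {w | gradCLM hφ.1 hφ.2.1 Ω w.fst = - testCLM hφ.1.continuous hφ.2.1 Ω _ w.snd} := by
    ext w
    simp only [mem_iInter, mem_ofPred_eq, gradCLM_apply]
    rfl
  rw [this]
  refine isClosed_iInter fun φ => isClosed_iInter fun hφ => isClosed_eq ?_ ?_
  · exact (gradCLM _ _ Ω).continuous.comp (WithLp.fstL 2 ℝ _ _).continuous
  · exact ((testCLM _ _ Ω _).continuous.comp (WithLp.sndL 2 ℝ _ _).continuous).neg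

instance : CompleteSpace (H1V Ω) := isClosed_h1Submodule.completeSpace_coe
instance : CompleteSpace (Hz Ω) := isClosed_hzSubmodule.completeSpace_coe
instance : CompleteSpace (HDiv Ω) := isClosed_hdivSubmodule.completeSpace_coe

/-- `H1V.fn` as a continuous linear map. -/
def H1V.fnL (Ω : Set (Space d)) : H1V Ω →L[ℝ] L2 Ω (Space d) :=
  WithLp.fstL 2 ℝ _ _ ∘L (h1Submodule Ω).subtypeL

/-- `HDiv.fn` as a continuous linear map. -/
def HDiv.fnL (Ω : Set (Space d)) : HDiv Ω →L[ℝ] L2 Ω (Space d) :=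
  WithLp.fstL 2 ℝ _ _ ∘L (hdivSubmodule Ω).subtypeL

/-- `HDiv.div` as a continuous linear map. -/
def HDiv.divL (Ω : Set (Space d)) : HDiv Ω →L[ℝ] L2 Ω ℝ :=
  WithLp.sndL 2 ℝ _ _ ∘L (hdivSubmodule Ω).subtypeL

/-- `Hz.fn` as a continuous linear map. -/
def Hz.fnL (Ω : Set (Space d)) : Hz Ω →L[ℝ] L2 Ω ℝ :=
  WithLp.fstL 2 ℝ _ _ ∘L (hzSubmodule Ω).subtypeL

/-- `Hz.dz` as a continuous linear map. -/
def Hz.dzL (Ω : Set (Space d)) : Hz Ω →L[ℝ] L2 Ω ℝ :=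
  WithLp.sndL 2 ℝ _ _ ∘L (hzSubmodule Ω).subtypeL

lemma HDiv.divL_apply (w : HDiv Ω) : HDiv.divL Ω w = w.div := rfl
lemma Hz.fnL_apply (w : Hz Ω) : Hz.fnL Ω w = w.fn := rfl
lemma Hz.dzL_apply (w : Hz Ω) : Hz.dzL Ω w = w.dz := rfl

lemma sqrt_add_sq_le {a b : ℝ} (ha : 0 ≤ a) (hb : 0 ≤ b) : √(a ^ 2 + b ^ 2) ≤ a + b := by
  rw [Real.sqrt_le_left (by positivity)]
  nlinarith [mul_nonneg ha hb]

lemma HDiv.norm_le (w : HDiv Ω) : ‖w‖ ≤ ‖w.fn‖ + ‖w.div‖ := by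
  have h : ‖w‖ = √(‖w.fn‖ ^ 2 + ‖w.div‖ ^ 2) := WithLp.prod_norm_eq_of_L2 w.1
  rw [h]
  exact sqrt_add_sq_le (norm_nonneg _) (norm_nonneg _)

lemma Hz.norm_le (w : Hz Ω) : ‖w‖ ≤ ‖w.fn‖ + ‖w.dz‖ := by
  have h : ‖w‖ = √(‖w.fn‖ ^ 2 + ‖w.dz‖ ^ 2) := WithLp.prod_norm_eq_of_L2 w.1
  rw [h]
  exact sqrt_add_sq_le (norm_nonneg _) (norm_nonneg _)

lemma H1V.norm_le (w : H1V Ω) : ‖w‖ ≤ ‖w.fn‖ + ∑ j, ‖w.partial j‖ := by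
  have h : ‖w‖ = √(‖w.fn‖ ^ 2 + ‖w.1.snd‖ ^ 2) := WithLp.prod_norm_eq_of_L2 w.1
  rw [h]
  refine (sqrt_add_sq_le (norm_nonneg _) (norm_nonneg _)).trans (add_le_add_right ?_ _)
  rw [PiLp.norm_eq_of_L2, Real.sqrt_le_left (Finset.sum_nonneg fun _ _ => norm_nonneg _)]
  exact Finset.sum_sq_le_sq_sum_of_nonneg fun _ _ => norm_nonneg _

end closed

/-! ### A priori estimates -/

section energy

variable {G₀ G : Set (Base d)} {ζ : Base d → ℝ} {Ω₁ : Set (Space d)}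

/-- A matrix as a continuous linear map of Euclidean space. -/
def actL (A : Matrix (Fin (d + 1)) (Fin (d + 1)) ℝ) : Space d →L[ℝ] Space d :=
  LinearMap.toContinuousLinearMap
    { toFun := act A
      map_add' := fun x y => by
        ext i
        simp [act, Matrix.mulVec, dotProduct, mul_add, Finset.sum_add_distrib]
      map_smul' := fun c x => by
        ext i
        simp only [act, Matrix.mulVec, dotProduct, PiLp.smul_apply, smul_eq_mul, RingHom.id_apply,
          Finset.mul_sum]
        exact Finset.sum_congr rfl fun j _ => by ring }

lemma actL_apply (A : Matrix (Fin (d + 1)) (Fin (d + 1)) ℝ) (ξ : Space d) :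
    actL A ξ = act A ξ := rfl

lemma actL_eq_sum (A : Matrix (Fin (d + 1)) (Fin (d + 1)) ℝ) :
    actL A = ∑ i, ∑ j, A i j • actL (Matrix.single i j 1) := by
  ext ξ k
  have h1 : ∀ i j : Fin (d + 1), (Matrix.single i j (1 : ℝ)).mulVec (fun l => ξ l) k
      = if i = k then ξ j else 0 := fun i j => by
    simp only [Matrix.mulVec, dotProduct, Matrix.single_apply]
    by_cases hik : i = k
    · simp [hik]
    · simp [hik]
  simp only [sum_apply, smul_apply, actL_apply, act, WithLp.ofLp_sum,
    Finset.sum_apply, WithLp.ofLp_smul, Pi.smul_apply, h1, smul_eq_mul]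
  simp [Matrix.mulVec, dotProduct]

lemma IsCoefficients.exists_isBddField {μ : ℝ} {α β : Base d → ℝ}
    {Q : Space d → Matrix (Fin (d + 1)) (Fin (d + 1)) ℝ}
    (hc : IsCoefficients Ω₁ G ζ μ α β Q) (hΩ : MeasurableSet Ω₁) :
    ∃ C, IsBddField (volume.restrict Ω₁) (fun x => actL (Q x)) C := by
  obtain ⟨C, hC⟩ := hc.bound_Q
  refine ⟨∑ i : Fin (d + 1), ∑ j : Fin (d + 1),
    |C| * ‖actL (d := d) (Matrix.single i j 1)‖, ?_, ?_, ?_⟩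
  · simp_rw [fun x => actL_eq_sum (Q x)]
    refine Finset.aestronglyMeasurable_fun_sum _ fun i _ =>
      Finset.aestronglyMeasurable_fun_sum _ fun j _ => ?_
    exact (hc.measurable_Q i j).aestronglyMeasurable.smul aestronglyMeasurable_const
  · positivity
  · filter_upwards [ae_restrict_mem hΩ] with x hx
    rw [actL_eq_sum]
    refine (norm_sum_le _ _).trans (Finset.sum_le_sum fun i _ => (norm_sum_le _ _).trans
      (Finset.sum_le_sum fun j _ => ?_))
    rw [norm_smul]
    exact mul_le_mul_of_nonneg_right ((hC x (Or.inl hx) i j).trans (le_abs_self C)) (norm_nonneg _)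

lemma zero_le_inner_act_matSqrt (A : Matrix (Fin (d + 1)) (Fin (d + 1)) ℝ) (ξ : Space d) :
    0 ≤ inner ℝ (act (matSqrt A) ξ) ξ := by
  have key : ∀ R : Matrix (Fin (d + 1)) (Fin (d + 1)) ℝ,
      inner ℝ (act R ξ) ξ = R.mulVec (fun i => ξ i) ⬝ᵥ fun i => ξ i := fun R => by
    rw [PiLp.inner_apply]
    simp [act, dotProduct, mul_comm]
  rw [key, matSqrt]
  split_ifs with h
  · exact h.choose_spec.2 _
  · simp

/-- The zero field on the channel, together with a field on `Ω₁` without normal trace on the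
interface, is an admissible pair of test fields. -/
lemma memX_zero {w1 : HDiv Ω₁} (hw : HasNormalTrace Ω₁ G ζ w1 fun _ => 0) :
    MemX Ω₁ G ζ w1 0 0 := by
  have h0 : ∀ᵐ x ∂(volume.restrict (channel G ζ)),
      (0 : L2 (channel G ζ) (Space d)) x = 0 := Lp.coeFn_zero _ _ _
  have h0' : ∀ᵐ x ∂(volume.restrict G),
      (0 : Lp (Space d) 2 (volume.restrict G)) x = 0 := Lp.coeFn_zero _ _ _
  refine ⟨⟨fun _ _ => 0, fun k => ⟨contDiff_const, HasCompactSupport.zero, by simp [tsupport]⟩,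
    ?_, fun j => ?_⟩, ⟨0, ?_, ?_⟩, ?_⟩
  · have : eLpNorm (fun x => (0 : H1V (channel G ζ)).fn x - 0) 2 (volume.restrict (channel G ζ))
        = 0 := by
      have hfn : ∀ᵐ x ∂(volume.restrict (channel G ζ)), (0 : H1V (channel G ζ)).fn x - 0 = 0 :=
        h0.mono fun x hx => (sub_zero _).trans hx
      exact (eLpNorm_congr_ae (g := fun _ => (0 : Space d)) hfn).trans eLpNorm_zero'
    simp only [this, tendsto_const_nhds]
  · have : eLpNorm (fun x => (0 : H1V (channel G ζ)).partial j x
        - pderiv j (fun _ => (0 : Space d)) x) 2 (volume.restrict (channel G ζ)) = 0 := by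
      rw [eLpNorm_congr_ae (g := 0), eLpNorm_zero]
      filter_upwards [h0] with x hx
      have h1 : (0 : H1V (channel G ζ)).partial j x = 0 := hx
      rw [h1]
      simp [pderiv]
    simp only [this, tendsto_const_nhds]
  · intro φ _ _
    have e1 : ∫ x in channel G ζ, (φ x • (0 : H1V (channel G ζ)).dz x
        + pderiv (Fin.last d) φ x • (0 : H1V (channel G ζ)).fn x) = 0 := by
      refine integral_eq_zero_of_ae ?_
      filter_upwards [h0] with x hx
      have h1 : (0 : H1V (channel G ζ)).dz x = 0 := hx
      have h2 : (0 : H1V (channel G ζ)).fn x = 0 := hx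
      simp [h1, h2]
    have e2 : ∀ ψ : Base d → ℝ,
        ∫ x' in G, ψ x' • (0 : Lp (Space d) 2 (volume.restrict G)) x' = 0 := fun ψ => by
      refine integral_eq_zero_of_ae ?_
      filter_upwards [h0'] with x hx
      rw [hx, smul_zero]
      rfl
    rw [e1, e2, e2, sub_zero]
  · filter_upwards [h0'] with x hx
    rw [hx, inner_zero_left]
  · intro φ hφ
    rw [hw φ hφ]
    refine integral_congr_ae ?_
    filter_upwards [h0'] with x hx
    rw [hx, inner_zero_left]

/-- The pressure in `Ω₁` is controlled by the velocity in `Ω₁`: test the momentum equation with a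
field whose divergence is the pressure. -/
lemma IsGeometry.exists_pressure_bound (hg : IsGeometry G₀ G ζ Ω₁) {μ : ℝ} {α β : Base d → ℝ}
    {Q : Space d → Matrix (Fin (d + 1)) (Fin (d + 1)) ℝ}
    (hc : IsCoefficients Ω₁ G ζ μ α β Q) :
    ∃ C, 0 ≤ C ∧ ∀ (ε : ℝ) (f : L2 (channel G ζ) (Space d)) (h : L2 Ω₁ ℝ) (v1 : HDiv Ω₁)
      (v2 : H1V (channel G ζ)) (p1 : L2 Ω₁ ℝ) (p2 : L2 (channel G ζ) ℝ),
      IsSolution Ω₁ G ζ μ α β Q ε f h v1 v2 p1 p2 → ‖p1‖ ≤ C * ‖v1.fn‖ := by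
  obtain ⟨C, hC0, hC⟩ := hg.exists_div_eq
  obtain ⟨CQ, hQ⟩ := hc.exists_isBddField hg.isOpen_Ω₁.measurableSet
  refine ⟨CQ * C, mul_nonneg hQ.nonneg hC0, fun ε f h v1 v2 p1 p2 hsol => ?_⟩
  obtain ⟨w, hwd, hwn, hwt⟩ := hC p1
  obtain ⟨g, -, hmom, -⟩ := hsol
  have hm := hmom w 0 0 (memX_zero hwt)
  have h0 : ∀ᵐ x ∂(volume.restrict (channel G ζ)),
      (0 : L2 (channel G ζ) (Space d)) x = 0 := Lp.coeFn_zero _ _ _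
  have h0' : ∀ᵐ x ∂(volume.restrict G),
      (0 : Lp (Space d) 2 (volume.restrict G)) x = 0 := Lp.coeFn_zero _ _ _
  have hp : ∀ j, ∀ᵐ x ∂(volume.restrict (channel G ζ)),
      (0 : H1V (channel G ζ)).partial j x = 0 := fun j => h0
  have hdz : ∀ᵐ x ∂(volume.restrict (channel G ζ)), (0 : H1V (channel G ζ)).dz x = 0 := h0
  have hfn : ∀ᵐ x ∂(volume.restrict (channel G ζ)), (0 : H1V (channel G ζ)).fn x = 0 := h0
  have hpa := ae_all_iff.2 hp
  have t1 : ∫ x in channel G ζ,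
      p2 x * ∑ j : Fin d, (0 : H1V (channel G ζ)).partial j.castSucc x j.castSucc = 0 := by
    refine integral_eq_zero_of_ae ?_
    filter_upwards [hpa] with x hx
    simp [hx]
  have t2 : ∫ x in channel G ζ, p2 x * ∑ j : Fin d,
      (0 : H1V (channel G ζ)).dz x j.castSucc * gradient ζ (horiz x) j = 0 := by
    refine integral_eq_zero_of_ae ?_
    filter_upwards [hdz] with x hx
    simp [hx]
  have t3 : ∫ x in channel G ζ, p2 x * (0 : H1V (channel G ζ)).dz x (Fin.last d) = 0 := by
    refine integral_eq_zero_of_ae ?_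
    filter_upwards [hdz] with x hx
    simp [hx]
  have t4 : ∫ x in channel G ζ, μ * ∑ j : Fin d, inner ℝ (Deps G ζ ε v2 j x)
      (Deps G ζ ε (0 : H1V (channel G ζ)) j x) = 0 := by
    refine integral_eq_zero_of_ae ?_
    filter_upwards [hdz, hpa] with x hx hx'
    simp [Deps, hx, hx']
  have t5 : ∫ x in channel G ζ, μ * inner ℝ (v2.dz x) ((0 : H1V (channel G ζ)).dz x) = 0 := by
    refine integral_eq_zero_of_ae ?_
    filter_upwards [hdz] with x hx
    simp [hx]
  have t6 : ∫ x' in G, α x' * inner ℝ (g x') (normal ζ x')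
      * inner ℝ ((0 : Lp (Space d) 2 (volume.restrict G)) x') (normal ζ x')
        * areaElement ζ x' = 0 := by
    refine integral_eq_zero_of_ae ?_
    filter_upwards [h0'] with x hx
    rw [hx, inner_zero_left, mul_zero, zero_mul]
    rfl
  have t7 : ∫ x' in G, β x' *
      inner ℝ (act (matSqrt (Q (pt x' (ζ x')))) (tangential ζ x' (g x')))
        (tangential ζ x' ((0 : Lp (Space d) 2 (volume.restrict G)) x'))
        * areaElement ζ x' = 0 := by
    refine integral_eq_zero_of_ae ?_
    filter_upwards [h0'] with x hx
    rw [hx]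
    simp [tangential]
  have t8 : ∫ x in channel G ζ, inner ℝ (f x) ((0 : H1V (channel G ζ)).fn x) = 0 := by
    refine integral_eq_zero_of_ae ?_
    filter_upwards [hfn] with x hx
    simp [hx]
  rw [MomentumEq, t1, t2, t3, t4, t5, t6, t7, t8, hwd] at hm
  have e1 : ∫ x in Ω₁, inner ℝ (act (Q x) (v1.fn x)) (w.fn x)
      = inner ℝ (fieldMul hQ v1.fn) w.fn := by
    rw [L2.inner_def]
    refine integral_congr_ae ?_
    filter_upwards [fieldMul_coe hQ v1.fn] with x hx
    rw [hx, actL_apply]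
  have e2 : ∫ x in Ω₁, p1 x * p1 x = ‖p1‖ ^ 2 := by
    rw [← real_inner_self_eq_norm_sq, L2.inner_def]
    rfl
  rw [e1, e2] at hm
  have h1 : ‖p1‖ ^ 2 ≤ ‖p1‖ * (CQ * C * ‖v1.fn‖) := by
    have h2 := real_inner_le_norm (fieldMul hQ v1.fn) w.fn
    have h3 := mul_le_mul (norm_fieldMul_le hQ v1.fn) hwn (norm_nonneg _)
      (mul_nonneg hQ.nonneg (norm_nonneg _))
    linarith
  rcases (norm_nonneg p1).eq_or_lt with h0 | h0
  · rw [← h0]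
    exact mul_nonneg (mul_nonneg hQ.nonneg hC0) (norm_nonneg _)
  · rw [sq] at h1
    exact le_of_mul_le_mul_left h1 h0

/-- Mass conservation in `Ω₁`. -/
lemma IsSolution.div_eq {μ ε : ℝ} {α β : Base d → ℝ}
    {Q : Space d → Matrix (Fin (d + 1)) (Fin (d + 1)) ℝ} {f : L2 (channel G ζ) (Space d)}
    {h : L2 Ω₁ ℝ} {v1 : HDiv Ω₁} {v2 : H1V (channel G ζ)} {p1 : L2 Ω₁ ℝ} {p2 : L2 (channel G ζ) ℝ}
    (hsol : IsSolution Ω₁ G ζ μ α β Q ε f h v1 v2 p1 p2) : v1.div = h := by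
  obtain ⟨g, -, -, hmass⟩ := hsol
  refine ext_inner_left ℝ fun φ => ?_
  have hm := hmass φ 0
  have h0 : ∀ᵐ x ∂(volume.restrict (channel G ζ)), (0 : L2 (channel G ζ) ℝ) x = 0 :=
    Lp.coeFn_zero _ _ _
  have hz : ∀ a : Space d → ℝ, ∫ x in channel G ζ, a x * (0 : L2 (channel G ζ) ℝ) x = 0 :=
    fun a => integral_eq_zero_of_ae (h0.mono fun x hx => (congrArg (a x * ·) hx).trans (mul_zero _))
  rw [MassEq, hz, hz, hz] at hm
  rw [L2.inner_def, L2.inner_def]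
  simpa using hm

/-- `D^ε_j w` as an element of `L²`. -/
def depsLp (hG : IsOpen G) (hζ : ContinuousOn ζ G) {L : ℝ} (hL0 : 0 ≤ L)
    (hL : ∀ x ∈ G, ‖gradient ζ x‖ ≤ L) (ε : ℝ) (w : H1V (channel G ζ)) (j : Fin d) :
    L2 (channel G ζ) (Space d) :=
  w.partial j.castSucc
    + (1 - 1 / ε) • fieldMul (isBddField_gradient (Space d) hG hζ hL0 hL j) w.dz

lemma depsLp_coe (hG : IsOpen G) (hζ : ContinuousOn ζ G) {L : ℝ} (hL0 : 0 ≤ L)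
    (hL : ∀ x ∈ G, ‖gradient ζ x‖ ≤ L) (ε : ℝ) (w : H1V (channel G ζ)) (j : Fin d) :
    ∀ᵐ x ∂(volume.restrict (channel G ζ)),
      depsLp hG hζ hL0 hL ε w j x = Deps G ζ ε w j x := by
  filter_upwards [Lp.coeFn_add (w.partial j.castSucc)
      ((1 - 1 / ε) • fieldMul (isBddField_gradient (Space d) hG hζ hL0 hL j) w.dz),
    Lp.coeFn_smul (1 - 1 / ε) (fieldMul (isBddField_gradient (Space d) hG hζ hL0 hL j) w.dz),
    fieldMul_coe (isBddField_gradient (Space d) hG hζ hL0 hL j) w.dz] with x h1 h2 h3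
  rw [depsLp, h1, Pi.add_apply, h2, Pi.smul_apply, h3, Deps, mul_smul]
  rfl

/-- The energy inequality: the solution is admissible as a test field, and mass conservation tested
with the pressure removes all pressure terms but one. -/
lemma IsSolution.energy (hg : IsGeometry G₀ G ζ Ω₁) {L : ℝ} (hL0 : 0 ≤ L)
    (hL : ∀ x ∈ G, ‖gradient ζ x‖ ≤ L) {μ : ℝ} {α β : Base d → ℝ}
    {Q : Space d → Matrix (Fin (d + 1)) (Fin (d + 1)) ℝ}
    (hc : IsCoefficients Ω₁ G ζ μ α β Q) {c : ℝ}
    (hQc : ∀ x ∈ Ω₁ ∪ surface G ζ 0, ∀ ξ : Space d, c * ‖ξ‖ ^ 2 ≤ inner ℝ (act (Q x) ξ) ξ)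
    {ε : ℝ} {f : L2 (channel G ζ) (Space d)}
    {h : L2 Ω₁ ℝ} {v1 : HDiv Ω₁} {v2 : H1V (channel G ζ)} {p1 : L2 Ω₁ ℝ} {p2 : L2 (channel G ζ) ℝ}
    (hε : 0 < ε) (hsol : IsSolution Ω₁ G ζ μ α β Q ε f h v1 v2 p1 p2) :
    c * ‖v1.fn‖ ^ 2
      + μ * ∑ j, (ε * ‖depsLp hg.isOpen_G hg.continuousOn hL0 hL ε v2 j‖) ^ 2
      + μ * ‖v2.dz‖ ^ 2 ≤ ε * ‖f‖ * ‖v2.fn‖ + ‖h‖ * ‖p1‖ := by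
  obtain ⟨CQ, hQ⟩ := hc.exists_isBddField hg.isOpen_Ω₁.measurableSet
  obtain ⟨g, hX, hmom, hmass⟩ := hsol
  have hm := hmom v1 v2 g hX
  have hms := hmass p1 p2
  set D := depsLp hg.isOpen_G hg.continuousOn hL0 hL ε v2
  have e1 : c * ‖v1.fn‖ ^ 2 ≤ ∫ x in Ω₁, inner ℝ (act (Q x) (v1.fn x)) (v1.fn x) := by
    have h1 : ∫ x in Ω₁, inner ℝ (act (Q x) (v1.fn x)) (v1.fn x)
        = ∫ x in Ω₁, inner ℝ (fieldMul hQ v1.fn x) (v1.fn x) := by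
      refine integral_congr_ae ?_
      filter_upwards [fieldMul_coe hQ v1.fn] with x hx
      rw [hx, actL_apply]
    rw [h1, ← real_inner_self_eq_norm_sq, L2.inner_def, ← integral_const_mul]
    refine integral_mono_ae ((L2.integrable_inner _ _).const_mul c) (L2.integrable_inner _ _) ?_
    filter_upwards [fieldMul_coe hQ v1.fn, ae_restrict_mem hg.isOpen_Ω₁.measurableSet] with x hx hx'
    rw [hx, actL_apply, real_inner_self_eq_norm_sq]
    exact hQc x (Or.inl hx') _
  have e2 : ∫ x in channel G ζ, μ * ∑ j : Fin d, inner ℝ (Deps G ζ ε v2 j x) (Deps G ζ ε v2 j x)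
      = μ * ∑ j, ‖D j‖ ^ 2 := by
    rw [integral_const_mul]
    congr 1
    have h1 : ∫ x in channel G ζ, ∑ j : Fin d, inner ℝ (Deps G ζ ε v2 j x) (Deps G ζ ε v2 j x)
        = ∫ x in channel G ζ, ∑ j : Fin d, inner ℝ (D j x) (D j x) := by
      refine integral_congr_ae ?_
      filter_upwards [ae_all_iff.2 fun j =>
        depsLp_coe hg.isOpen_G hg.continuousOn hL0 hL ε v2 j] with x hx
      simp only [D, hx]
    rw [h1, integral_finsetSum _ fun j _ => L2.integrable_inner (𝕜 := ℝ) (D j) (D j)]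
    refine Finset.sum_congr rfl fun j _ => ?_
    rw [← real_inner_self_eq_norm_sq, L2.inner_def]
  have e3 : ∫ x in channel G ζ, μ * inner ℝ (v2.dz x) (v2.dz x) = μ * ‖v2.dz‖ ^ 2 := by
    rw [integral_const_mul, ← real_inner_self_eq_norm_sq, L2.inner_def]
  have e4 : 0 ≤ ∫ x' in G, α x' * inner ℝ (g x') (normal ζ x') * inner ℝ (g x') (normal ζ x')
      * areaElement ζ x' := by
    obtain ⟨Cα, hα⟩ := hc.bound_α
    refine integral_nonneg_of_ae ?_
    filter_upwards [hα] with x hx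
    rw [mul_assoc (α x)]
    exact mul_nonneg (mul_nonneg hx.1 (mul_self_nonneg _)) (areaElement_pos ζ x).le
  have e5 : 0 ≤ ∫ x' in G, β x' *
      inner ℝ (act (matSqrt (Q (pt x' (ζ x')))) (tangential ζ x' (g x')))
        (tangential ζ x' (g x')) * areaElement ζ x' := by
    obtain ⟨Cβ, hβ⟩ := hc.bound_β
    refine integral_nonneg_of_ae ?_
    filter_upwards [hβ] with x hx
    exact mul_nonneg (mul_nonneg hx.1 (zero_le_inner_act_matSqrt _ _)) (areaElement_pos ζ x).le
  have e6 : ∫ x in channel G ζ, inner ℝ (f x) (v2.fn x) ≤ ‖f‖ * ‖v2.fn‖ := by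
    have := real_inner_le_norm f v2.fn
    rwa [L2.inner_def] at this
  have e7 : ∫ x in Ω₁, h x * p1 x ≤ ‖h‖ * ‖p1‖ := by
    have := real_inner_le_norm h p1
    rw [L2.inner_def] at this
    simpa [mul_comm] using this
  rw [MomentumEq, e2, e3] at hm
  rw [MassEq] at hms
  simp only [mul_comm (p1 _), mul_comm (p2 _)] at hm
  have e8 : μ * ∑ j, (ε * ‖D j‖) ^ 2 = ε ^ 2 * (μ * ∑ j, ‖D j‖ ^ 2) := by
    simp only [mul_pow, ← Finset.mul_sum]
    ring
  have e9 := mul_le_mul_of_nonneg_left e6 hε.le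
  have e10 := mul_nonneg (sq_nonneg ε) e5
  rw [e8]
  linarith

/-- `∂_j w + ∂_j ζ ∂_z w` as an element of `L²`. -/
def tangLp (hG : IsOpen G) (hζ : ContinuousOn ζ G) {L : ℝ} (hL0 : 0 ≤ L)
    (hL : ∀ x ∈ G, ‖gradient ζ x‖ ≤ L) (w : H1V (channel G ζ)) (j : Fin d) :
    L2 (channel G ζ) (Space d) :=
  w.partial j.castSucc + fieldMul (isBddField_gradient (Space d) hG hζ hL0 hL j) w.dz

lemma mul_norm_add_le {E : Type*} [NormedAddCommGroup E] [NormedSpace ℝ E] {ε : ℝ} (hε : 0 < ε)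
    (a b : E) : ε * ‖a + b‖ ≤ ε * ‖a + (1 - 1 / ε) • b‖ + ‖b‖ := by
  have h2 : ε * (1 - 1 / ε) = ε - 1 := by field_simp
  have h1 : ε • (a + b) = ε • (a + (1 - 1 / ε) • b) + b := by
    rw [smul_add, smul_add, smul_smul, h2, sub_smul, one_smul]
    abel
  have h3 := norm_add_le (ε • (a + (1 - 1 / ε) • b)) b
  rwa [← h1, norm_smul, norm_smul, Real.norm_of_nonneg hε.le] at h3

lemma norm_smul_tangLp_le (hG : IsOpen G) (hζ : ContinuousOn ζ G) {L : ℝ} (hL0 : 0 ≤ L)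
    (hL : ∀ x ∈ G, ‖gradient ζ x‖ ≤ L) {ε : ℝ} (hε : 0 < ε) (w : H1V (channel G ζ)) (j : Fin d) :
    ε * ‖tangLp hG hζ hL0 hL w j‖ ≤ ε * ‖depsLp hG hζ hL0 hL ε w j‖ + L * ‖w.dz‖ := by
  have h1 := mul_norm_add_le hε (w.partial j.castSucc)
    (fieldMul (isBddField_gradient (Space d) hG hζ hL0 hL j) w.dz)
  have h2 := norm_fieldMul_le (isBddField_gradient (Space d) hG hζ hL0 hL j) w.dz
  exact h1.trans (add_le_add_right h2 _)

/-- The Poincaré inequality on the channel for fields vanishing on the lateral wall. -/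
lemma IsGeometry.exists_norm_fn_le (hg : IsGeometry G₀ G ζ Ω₁) (hd : 1 ≤ d) {L : ℝ} (hL0 : 0 ≤ L)
    (hL : ∀ x ∈ G, ‖gradient ζ x‖ ≤ L) :
    ∃ (C : ℝ) (j : Fin d), 0 ≤ C ∧ ∀ w : H1V (channel G ζ), VanishesOnWall G ζ w →
      ‖w.fn‖ ≤ ‖w.dz‖ + C * ‖tangLp hg.isOpen_G hg.continuousOn hL0 hL w j‖ := by
  obtain ⟨R, hR⟩ := hg.isBounded.exists_norm_le
  let j : Fin d := ⟨0, hd⟩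
  have hC : 0 ≤ 2 * max R 0 + 1 := by positivity
  refine ⟨2 * max R 0 + 1, j, hC, fun w hw => ?_⟩
  -- a translation by more than the diameter of `G`
  set h : Base d := EuclideanSpace.single j (2 * max R 0 + 1) with hh
  have hG : ∀ x ∈ G, x + h ∉ G := fun x hx hx' => by
    have h1 := hR _ hx
    have h2 := hR _ hx'
    have h3 : ‖h‖ ≤ ‖x + h‖ + ‖x‖ := by
      simpa using norm_sub_le (x + h) x
    rw [hh, PiLp.norm_single, Real.norm_of_nonneg hC] at h3
    linarith [le_max_left R 0]
  have h1 := norm_le_norm_transDiff hg.isOpen_G.measurableSet h hG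
    (avg hg.isOpen_G hg.continuousOn _ w.fn)
  have h2 := hw.norm_transDiff_avg_le hg.isOpen_G hg.isBounded hg.contDiffOn_one hL0 hL h
  have h3 : ∑ i : Fin d, h i • (w.partial i.castSucc
      + fieldMul (isBddField_gradient (Space d) hg.isOpen_G hg.continuousOn hL0 hL i) w.dz)
      = (2 * max R 0 + 1) • tangLp hg.isOpen_G hg.continuousOn hL0 hL w j := by
    rw [Finset.sum_eq_single j]
    · simp [hh, tangLp]
    · intro i _ hi
      simp [hh, hi]
    · simp
  rw [h3, norm_smul, Real.norm_of_nonneg hC] at h2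
  have h4 := hw.norm_sub_lift_avg_le hg.isOpen_G hg.isBounded hg.continuousOn
  have h5 : ‖w.fn‖ ≤ ‖w.fn - lift hg.isOpen_G hg.continuousOn _
      (avg hg.isOpen_G hg.continuousOn _ w.fn)‖ + ‖lift hg.isOpen_G hg.continuousOn _
      (avg hg.isOpen_G hg.continuousOn _ w.fn)‖ := norm_le_norm_sub_add _ _
  rw [LinearIsometry.norm_map] at h5
  linarith

/-- The bounds hidden in the energy inequality: `a`, `b`, `v`, `p` stand for the norms of `v¹`,
`∂_z v²`, `v²`, `p¹`, and `D j`, `t j` for those of the tangential derivatives. The left-hand side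
is quadratic, and the right-hand side is linear, in `√(a² + ∑ D_j² + b²)`. -/
lemma exists_bound_of_energy {c μ C M K L P : ℝ} (hc0 : 0 < c) (hμ : 0 < μ) (hK0 : 0 ≤ K)
    (hL0 : 0 ≤ L) (hP0 : 0 ≤ P) (i : Fin d) :
    ∃ B, 0 ≤ B ∧ ∀ (ε a b v f h p : ℝ) (D t : Fin d → ℝ), 0 < ε → ε ≤ M → f ≤ C → h ≤ C →
      0 ≤ a → 0 ≤ b → 0 ≤ v → 0 ≤ p → p ≤ P * a → v ≤ b + K * t i →
      (∀ j, ε * t j ≤ D j + L * b) →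
      c * a ^ 2 + μ * ∑ j, D j ^ 2 + μ * b ^ 2 ≤ ε * f * v + h * p →
      a ≤ B ∧ b ≤ B ∧ ε * v ≤ B ∧ ∀ j, ε * t j ≤ B := by
  set m := min c μ with hm
  have hm0 : 0 < m := lt_min hc0 hμ
  set A := |M| + K * (1 + L) with hA
  have hA0 : 0 ≤ A := by positivity
  set E₀ := |C| * (A + P) / m with hE₀
  have hE₀0 : 0 ≤ E₀ := by positivity
  refine ⟨E₀ * (1 + L + A), by positivity,
    fun ε a b v f h p D t hε hεM hf hh ha0 hb0 hv0 hp0 hp hpo htan hen => ?_⟩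
  set S := a ^ 2 + ∑ j, D j ^ 2 + b ^ 2 with hS
  have hS0 : 0 ≤ ∑ j, D j ^ 2 := Finset.sum_nonneg fun j _ => sq_nonneg _
  set E := √S with hE
  have hE0 : 0 ≤ E := Real.sqrt_nonneg _
  have hES : E ^ 2 = S := Real.sq_sqrt (by positivity)
  have haE : a ≤ E := Real.le_sqrt_of_sq_le (by rw [hS]; nlinarith [sq_nonneg b])
  have hbE : b ≤ E := Real.le_sqrt_of_sq_le (by rw [hS]; nlinarith [sq_nonneg a])
  have hDE : ∀ j, D j ≤ E := fun j => Real.le_sqrt_of_sq_le (by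
    have := Finset.single_le_sum (f := fun j => D j ^ 2) (fun j _ => sq_nonneg _)
      (Finset.mem_univ j)
    rw [hS]
    nlinarith [sq_nonneg a, sq_nonneg b])
  have htE : ∀ j, ε * t j ≤ (1 + L) * E := fun j => by
    have h1 := htan j
    have h2 := hDE j
    have h3 := mul_le_mul_of_nonneg_left hbE hL0
    linarith
  have hvE : ε * v ≤ A * E := by
    have h1 := mul_le_mul_of_nonneg_left hpo hε.le
    have h2 := mul_le_mul_of_nonneg_left (htE i) hK0
    have h3 : ε * b ≤ |M| * E := mul_le_mul (hεM.trans (le_abs_self M)) hbE hb0 (abs_nonneg M)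
    rw [hA]
    linarith
  have hmain : m * E ^ 2 ≤ |C| * (A + P) * E := by
    have h1 : m * S ≤ c * a ^ 2 + μ * ∑ j, D j ^ 2 + μ * b ^ 2 := by
      have g1 := mul_le_mul_of_nonneg_right (min_le_left c μ) (sq_nonneg a)
      have g2 := mul_le_mul_of_nonneg_right (min_le_right c μ) hS0
      have g3 := mul_le_mul_of_nonneg_right (min_le_right c μ) (sq_nonneg b)
      rw [hS]
      linarith
    have h2 : ε * f * v ≤ |C| * (A * E) := by
      rw [mul_comm ε, mul_assoc]
      exact mul_le_mul (hf.trans (le_abs_self C)) hvE (mul_nonneg hε.le hv0) (abs_nonneg C)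
    have h3 : h * p ≤ |C| * (P * E) :=
      mul_le_mul (hh.trans (le_abs_self C)) (hp.trans (mul_le_mul_of_nonneg_left haE hP0))
        hp0 (abs_nonneg C)
    rw [hES]
    linarith
  have hEE : E ≤ E₀ := by
    rcases hE0.eq_or_lt with h0 | h0
    · rw [← h0]
      exact hE₀0
    · rw [hE₀, le_div_iff₀ hm0]
      refine le_of_mul_le_mul_right ?_ h0
      linarith
  have hfin : ∀ x y : ℝ, 0 ≤ y → y ≤ 1 + L + A → x ≤ y * E → x ≤ E₀ * (1 + L + A) := by
    intro x y hy0 hy hx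
    refine hx.trans ?_
    rw [mul_comm]
    exact mul_le_mul hEE hy hy0 hE₀0
  refine ⟨hfin _ 1 zero_le_one (by linarith) (by linarith),
    hfin _ 1 zero_le_one (by linarith) (by linarith), hfin _ A hA0 (by linarith) hvE,
    fun j => hfin _ (1 + L) (by linarith) (by linarith) (htE j)⟩

/-- The a priori bounds, uniform for bounded `ε`. -/
lemma IsGeometry.exists_uniform_bound (hg : IsGeometry G₀ G ζ Ω₁) (hd : 1 ≤ d) {L : ℝ}
    (hL0 : 0 ≤ L) (hL : ∀ x ∈ G, ‖gradient ζ x‖ ≤ L) {μ : ℝ} {α β : Base d → ℝ}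
    {Q : Space d → Matrix (Fin (d + 1)) (Fin (d + 1)) ℝ}
    (hc : IsCoefficients Ω₁ G ζ μ α β Q) (C M : ℝ) :
    ∃ B, 0 ≤ B ∧ ∀ (ε : ℝ) (f : L2 (channel G ζ) (Space d)) (h : L2 Ω₁ ℝ) (v1 : HDiv Ω₁)
      (v2 : H1V (channel G ζ)) (p1 : L2 Ω₁ ℝ) (p2 : L2 (channel G ζ) ℝ), 0 < ε → ε ≤ M →
      ‖f‖ ≤ C → ‖h‖ ≤ C → IsSolution Ω₁ G ζ μ α β Q ε f h v1 v2 p1 p2 →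
      ‖v1.fn‖ ≤ B ∧ ‖v2.dz‖ ≤ B ∧ ε * ‖v2.fn‖ ≤ B ∧
        ∀ j, ε * ‖tangLp hg.isOpen_G hg.continuousOn hL0 hL v2 j‖ ≤ B := by
  obtain ⟨P, hP0, hP⟩ := hg.exists_pressure_bound hc
  obtain ⟨K, i, hK0, hK⟩ := hg.exists_norm_fn_le hd hL0 hL
  obtain ⟨c, hc0, hQc⟩ := hc.elliptic_Q
  obtain ⟨B, hB0, hB⟩ := exists_bound_of_energy (C := C) (M := M) hc0 hc.mu_pos hK0 hL0 hP0 i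
  refine ⟨B, hB0, fun ε f h v1 v2 p1 p2 hε hεM hf hh hsol => ?_⟩
  have hen := hsol.energy hg hL0 hL hc hQc hε
  have hp := hP ε f h v1 v2 p1 p2 hsol
  obtain ⟨g, hX, -⟩ := hsol
  exact hB ε ‖v1.fn‖ ‖v2.dz‖ ‖v2.fn‖ ‖f‖ ‖h‖ ‖p1‖ _
    (fun j => ‖tangLp hg.isOpen_G hg.continuousOn hL0 hL v2 j‖) hε hεM hf hh (norm_nonneg _)
    (norm_nonneg _) (norm_nonneg _) (norm_nonneg _) hp (hK v2 hX.1)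
    (norm_smul_tangLp_le hg.isOpen_G hg.continuousOn hL0 hL hε v2) hen

end energy

/-! ### Passage to the limit -/

section limit

variable {G₀ G : Set (Base d)} {ζ : Base d → ℝ} {Ω₁ : Set (Space d)}

lemma TendstoWeakly.tendsto_integral_mul {X : Type*} [MeasurableSpace X] {m : Measure X}
    {u : ℕ → Lp ℝ 2 m} {l : Lp ℝ 2 m} (h : TendstoWeakly u l) {b : X → ℝ} (hb : MemLp b 2 m) :
    Tendsto (fun k => ∫ x, b x * u k x ∂m) atTop (𝓝 (∫ x, b x * l x ∂m)) := by
  have key : ∀ v : Lp ℝ 2 m, innerSL ℝ hb.toLp v = ∫ x, b x * v x ∂m := fun v => by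
    rw [innerSL_apply_apply, L2.inner_def]
    refine integral_congr_ae ?_
    filter_upwards [hb.coeFn_toLp] with x hx
    rw [hx]
    exact mul_comm _ _
  simpa only [key] using h (innerSL ℝ hb.toLp)

/-- Traces are stable under weak convergence. -/
lemma HasTraces.of_tendstoWeakly (hG : IsOpen G) (hGb : Bornology.IsBounded G)
    (hζ : ContinuousOn ζ G) {u : ℕ → Hz (channel G ζ)} {l : Hz (channel G ζ)}
    {g₀ g₁ : ℕ → Lp ℝ 2 (volume.restrict G)} {l₀ l₁ : Lp ℝ 2 (volume.restrict G)}
    (hu : TendstoWeakly u l) (h₀ : TendstoWeakly g₀ l₀) (h₁ : TendstoWeakly g₁ l₁)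
    (h : ∀ k, HasTraces G ζ (u k).fn (u k).dz (g₀ k) (g₁ k)) :
    HasTraces G ζ l.fn l.dz l₀ l₁ := by
  intro φ hφ hs
  have hc := continuous_pderiv hφ (Fin.last d)
  have hcs := hasCompactSupport_pderiv hs (Fin.last d)
  have m₀ := memLp_comp_pt hφ.continuous hs hG hGb hζ 0
  simp only [add_zero] at m₀
  have t1 := ((hu.map (Hz.dzL _)).tendsto_integral_mul
    (hφ.continuous.memLp_of_hasCompactSupport hs)).add
    ((hu.map (Hz.fnL _)).tendsto_integral_mul (hc.memLp_of_hasCompactSupport hcs))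
  have t2 := (h₁.tendsto_integral_mul (memLp_comp_pt hφ.continuous hs hG hGb hζ 1)).sub
    (h₀.tendsto_integral_mul m₀)
  have e : ∀ w : Hz (channel G ζ),
      ∫ x in channel G ζ, (φ x • w.dz x + pderiv (Fin.last d) φ x • w.fn x)
        = (∫ x in channel G ζ, φ x * Hz.dzL _ w x)
          + ∫ x in channel G ζ, pderiv (Fin.last d) φ x * Hz.fnL _ w x := fun w =>
    integral_add (integrable_smul_L2 hφ.continuous hs w.dz) (integrable_smul_L2 hc hcs w.fn)
  rw [e]
  refine tendsto_nhds_unique t1 (t2.congr fun k => ?_)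
  rw [← e]
  exact (h k φ hφ hs).symm

lemma IsGeometry.memLp_mul_areaElement (hg : IsGeometry G₀ G ζ Ω₁) {φ : Space d → ℝ}
    (hφ : Continuous φ) (hs : HasCompactSupport φ) :
    MemLp (fun x' => φ (pt x' (ζ x')) * areaElement ζ x') 2 (volume.restrict G) := by
  obtain ⟨L, -, -, hL⟩ := hg.exists_bound
  have m₀ := memLp_comp_pt hφ hs hg.isOpen_G hg.isBounded hg.continuousOn 0
  simp only [add_zero] at m₀
  refine m₀.of_le_mul (c := √(1 + L ^ 2))
    (m₀.1.mul (measurable_areaElement ζ).aestronglyMeasurable) ?_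
  filter_upwards [ae_restrict_mem hg.isOpen_G.measurableSet] with x hx
  rw [norm_mul, mul_comm, Real.norm_of_nonneg (areaElement_pos ζ x).le]
  refine mul_le_mul_of_nonneg_right (Real.sqrt_le_sqrt ?_) (norm_nonneg _)
  gcongr
  exact hL x hx

/-- The left-hand side of Green's formula is a weakly continuous function of the field. -/
lemma TendstoWeakly.tendsto_green {v : ℕ → HDiv Ω₁} {l : HDiv Ω₁} (hv : TendstoWeakly v l)
    {φ : Space d → ℝ} (hφ : ContDiff ℝ ∞ φ) (hs : HasCompactSupport φ) :
    Tendsto (fun k => ∫ x in Ω₁, (inner ℝ (gradient φ x) ((v k).fn x) + φ x * (v k).div x)) atTop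
      (𝓝 (∫ x in Ω₁, (inner ℝ (gradient φ x) (l.fn x) + φ x * l.div x))) := by
  have e : ∀ w : HDiv Ω₁, ∫ x in Ω₁, (inner ℝ (gradient φ x) (w.fn x) + φ x * w.div x)
      = (gradCLM hφ hs Ω₁ ∘L HDiv.fnL Ω₁
        + testCLM hφ.continuous hs Ω₁ ℝ ∘L HDiv.divL Ω₁) w := fun w => by
    refine (integral_add (integrable_inner_gradLp hφ hs w.fn)
      (integrable_smul_L2 hφ.continuous hs w.div)).trans ?_
    rw [← gradCLM_apply hφ hs]
    rfl
  simp only [e]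
  exact hv _

/-- Normal traces are stable under weak convergence. -/
lemma HasNormalTrace.of_tendstoWeakly (hg : IsGeometry G₀ G ζ Ω₁) {v : ℕ → HDiv Ω₁} {l : HDiv Ω₁}
    {g : ℕ → Lp ℝ 2 (volume.restrict G)} {g' : Lp ℝ 2 (volume.restrict G)}
    (hv : TendstoWeakly v l) (hgw : TendstoWeakly g g')
    (h : ∀ k, HasNormalTrace Ω₁ G ζ (v k) (g k)) : HasNormalTrace Ω₁ G ζ l g' := by
  intro φ hφ
  have t2 := hgw.tendsto_integral_mul (hg.memLp_mul_areaElement hφ.1.continuous hφ.2.1)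
  simp only [mul_right_comm _ (areaElement ζ _)] at t2
  exact tendsto_nhds_unique (hv.tendsto_green hφ.1 hφ.2.1) (t2.congr fun k => (h k φ hφ).symm)

/-- The normal velocity in the channel, as an element of `H(∂_z, Ω₂)`. Its trace on `Γ`, which is
the normal trace of the velocity in `Ω₁`, is minus the vertical average of its derivative. -/
lemma MemX.exists_normal_velocity (hg : IsGeometry G₀ G ζ Ω₁) {L : ℝ} (hL0 : 0 ≤ L)
    (hL : ∀ x ∈ G, |ζ x| ≤ L) {w1 : HDiv Ω₁} {w2 : H1V (channel G ζ)}
    {g : Lp (Space d) 2 (volume.restrict G)} (h : MemX Ω₁ G ζ w1 w2 g) :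
    ∃ u : Hz (channel G ζ), u.fn = normalDot ζ _ continuous_horiz.measurable w2.fn ∧
      u.dz = normalDot ζ _ continuous_horiz.measurable w2.dz ∧ ‖u‖ ≤ (2 * L + 3) * ‖w2.dz‖ ∧
      HasTraces G ζ u.fn u.dz (-(avg hg.isOpen_G hg.continuousOn ℝ u.dz)) 0 ∧
      HasNormalTrace Ω₁ G ζ w1 (-(avg hg.isOpen_G hg.continuousOn ℝ u.dz) :) := by
  obtain ⟨hw, ⟨g₁, ht, hg₁⟩, hn⟩ := h
  have ht' := ht.normal_component hg.isOpen_G hg.isBounded hg.continuousOn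
  have h0 : normalDot ζ (volume.restrict G) measurable_id g₁ = 0 := by
    refine Lp.ext ?_
    filter_upwards [normalDot_coe ζ _ measurable_id g₁, hg₁,
      Lp.coeFn_zero ℝ 2 (volume.restrict G)] with x h1 h2 h3
    rw [h1, h3]
    exact h2
  rw [h0] at ht'
  have hav := (ht'.avg_eq_of_top_zero hg.isOpen_G hg.isBounded hg.continuousOn hL0 hL).1
  refine ⟨⟨WithLp.toLp 2 (normalDot ζ _ continuous_horiz.measurable w2.fn,
    normalDot ζ _ continuous_horiz.measurable w2.dz), isWeakPartial_of_hasTraces ht'⟩,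
    rfl, rfl, ?_, ?_, ?_⟩
  · refine (Hz.norm_le _).trans ?_
    have h1 := hw.norm_normal_component_le hg.isOpen_G hg.isBounded hg.continuousOn hL0 hL ht'
    have h2 := norm_normalDot_le ζ (volume.restrict (channel G ζ)) continuous_horiz.measurable w2.dz
    refine (add_le_add h1 h2).trans_eq ?_
    ring
  · have := ht'
    rw [← neg_eq_iff_eq_neg.2 hav] at this
    exact this
  · intro φ hφ
    rw [hn φ hφ]
    refine integral_congr_ae ?_
    have hav' : -(avg hg.isOpen_G hg.continuousOn ℝ
        (normalDot ζ _ continuous_horiz.measurable w2.dz))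
        = normalDot ζ (volume.restrict G) measurable_id g := by rw [hav, neg_neg]
    filter_upwards [normalDot_coe ζ _ measurable_id g] with x hx
    have : (-(avg hg.isOpen_G hg.continuousOn ℝ
        (normalDot ζ _ continuous_horiz.measurable w2.dz))) x = inner ℝ (g x) (normal ζ x) := by
      rw [hav', hx]
      rfl
    exact congrArg (fun t => φ (pt x (ζ x)) * t * areaElement ζ x) this.symm

/-- Compactness in the channel: if the tangential derivatives of `c_k u_k` are bounded and its
vertical derivative tends to zero, then weak convergence is strong, and the limit does not depend
on the vertical variable. -/
lemma IsGeometry.tendsto_of_vertical_tendsto_zero (hg : IsGeometry G₀ G ζ Ω₁) {L : ℝ}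
    (hL0 : 0 ≤ L) (hL : ∀ x ∈ G, ‖gradient ζ x‖ ≤ L) {u : ℕ → H1V (channel G ζ)} {c : ℕ → ℝ}
    (hc : ∀ k, 0 < c k) (hw : ∀ k, VanishesOnWall G ζ (u k)) {B : ℝ} (hB0 : 0 ≤ B)
    (hfn : ∀ k, c k * ‖(u k).fn‖ ≤ B)
    (ht : ∀ k j, c k * ‖tangLp hg.isOpen_G hg.continuousOn hL0 hL (u k) j‖ ≤ B)
    (hz : Tendsto (fun k => c k * ‖(u k).dz‖) atTop (𝓝 0)) {l : L2 (channel G ζ) (Space d)}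
    (hl : TendstoWeakly (fun k => c k • (u k).fn) l) :
    Tendsto (fun k => c k • (u k).fn) atTop (𝓝 l) ∧
      ∃ V, l = lift hg.isOpen_G hg.continuousOn (Space d) V := by
  set T := avg hg.isOpen_G hg.continuousOn (Space d) with hT
  set J := lift hg.isOpen_G hg.continuousOn (Space d) with hJ
  have hp : Tendsto (fun k => T (c k • (u k).fn)) atTop (𝓝 (T l)) := by
    refine tendsto_of_tendstoWeakly_of_transDiff hg.isOpen_G.measurableSet
      hg.isBounded.measure_lt_top.ne (hl.map T) (B := B) (fun k => ?_) (M := d * B)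
      (by positivity) fun k h => ?_
    · refine (norm_avg_le _ _ _).trans ?_
      rw [norm_smul, Real.norm_of_nonneg (hc k).le]
      exact hfn k
    · rw [map_smul, map_smul, norm_smul, Real.norm_of_nonneg (hc k).le]
      have h1 := (hw k).norm_transDiff_avg_le hg.isOpen_G hg.isBounded hg.contDiffOn_one hL0 hL h
      have h2 := h1.trans (norm_sum_le _ _)
      refine (mul_le_mul_of_nonneg_left h2 (hc k).le).trans ?_
      rw [Finset.mul_sum]
      have h3 : ∀ j ∈ (Finset.univ : Finset (Fin d)), c k * ‖h j • ((u k).partial j.castSucc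
          + fieldMul (isBddField_gradient (Space d) hg.isOpen_G hg.continuousOn hL0 hL j)
            (u k).dz)‖ ≤ ‖h‖ * B := fun j _ => by
        rw [norm_smul, mul_left_comm]
        exact mul_le_mul (PiLp.norm_apply_le h j) (ht k j)
          (mul_nonneg (hc k).le (norm_nonneg _)) (norm_nonneg _)
      refine (Finset.sum_le_card_nsmul _ _ _ h3).trans_eq ?_
      rw [Finset.card_univ, Fintype.card_fin, nsmul_eq_mul]
      ring
  have hd : Tendsto (fun k => c k • (u k).fn - J (T (c k • (u k).fn))) atTop (𝓝 0) := by
    refine squeeze_zero_norm (fun k => ?_) hz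
    rw [map_smul, map_smul, ← smul_sub, norm_smul, Real.norm_of_nonneg (hc k).le]
    exact mul_le_mul_of_nonneg_left
      ((hw k).norm_sub_lift_avg_le hg.isOpen_G hg.isBounded hg.continuousOn) (hc k).le
  have hs : Tendsto (fun k => c k • (u k).fn) atTop (𝓝 (J (T l))) := by
    have := hd.add ((J.continuous.tendsto _).comp hp)
    simpa [Function.comp_def] using this
  have he : l = J (T l) := hl.unique (tendstoWeakly_of_tendsto hs)
  exact ⟨he ▸ hs, T l, he⟩

lemma norm_partial_castSucc_le (hG : IsOpen G) (hζ : ContinuousOn ζ G) {L : ℝ} (hL0 : 0 ≤ L)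
    (hL : ∀ x ∈ G, ‖gradient ζ x‖ ≤ L) (w : H1V (channel G ζ)) (j : Fin d) :
    ‖w.partial j.castSucc‖ ≤ ‖tangLp hG hζ hL0 hL w j‖ + L * ‖w.dz‖ :=
  (norm_le_add_norm_add _ _).trans (add_le_add_right
    (norm_fieldMul_le (isBddField_gradient (Space d) hG hζ hL0 hL j) w.dz) _)

/-- A common weakly convergent subsequence of four bounded sequences. -/
lemma exists_common_subseq_tendstoWeakly {H₁ H₂ H₃ H₄ : Type*}
    [NormedAddCommGroup H₁] [InnerProductSpace ℝ H₁] [CompleteSpace H₁]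
    [NormedAddCommGroup H₂] [InnerProductSpace ℝ H₂] [CompleteSpace H₂]
    [NormedAddCommGroup H₃] [InnerProductSpace ℝ H₃] [CompleteSpace H₃]
    [NormedAddCommGroup H₄] [InnerProductSpace ℝ H₄] [CompleteSpace H₄]
    {u₁ : ℕ → H₁} {u₂ : ℕ → H₂} {u₃ : ℕ → H₃} {u₄ : ℕ → H₄} {B₁ B₂ B₃ B₄ : ℝ}
    (h₁ : ∀ k, ‖u₁ k‖ ≤ B₁) (h₂ : ∀ k, ‖u₂ k‖ ≤ B₂) (h₃ : ∀ k, ‖u₃ k‖ ≤ B₃)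
    (h₄ : ∀ k, ‖u₄ k‖ ≤ B₄) :
    ∃ s : ℕ → ℕ, StrictMono s ∧ ∃ l₁ l₂ l₃ l₄, TendstoWeakly (fun k => u₁ (s k)) l₁ ∧
      TendstoWeakly (fun k => u₂ (s k)) l₂ ∧ TendstoWeakly (fun k => u₃ (s k)) l₃ ∧
      TendstoWeakly (fun k => u₄ (s k)) l₄ := by
  obtain ⟨s₁, hs₁, l₁, c₁⟩ := exists_subseq_tendstoWeakly h₁
  obtain ⟨s₂, hs₂, l₂, c₂⟩ := exists_subseq_tendstoWeakly fun k => h₂ (s₁ k)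
  obtain ⟨s₃, hs₃, l₃, c₃⟩ := exists_subseq_tendstoWeakly fun k => h₃ (s₁ (s₂ k))
  obtain ⟨s₄, hs₄, l₄, c₄⟩ := exists_subseq_tendstoWeakly fun k => h₄ (s₁ (s₂ (s₃ k)))
  exact ⟨fun k => s₁ (s₂ (s₃ (s₄ k))), hs₁.comp (hs₂.comp (hs₃.comp hs₄)), l₁, l₂, l₃, l₄,
    c₁.comp (hs₂.comp (hs₃.comp hs₄)), c₂.comp (hs₃.comp hs₄), c₃.comp hs₄, c₄⟩

end limit

end

end DarcyStokes

open DarcyStokes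

set_option maxHeartbeats 1000000 in
theorem mainTheorem3 {d : ℕ} (hd : 1 ≤ d)
    (G₀ G : Set (DarcyStokes.Base d)) (ζ : DarcyStokes.Base d → ℝ)
    (Ω₁ : Set (DarcyStokes.Space d)) (hgeom : DarcyStokes.IsGeometry G₀ G ζ Ω₁)
    (μ : ℝ) (α β : DarcyStokes.Base d → ℝ)
    (Q : DarcyStokes.Space d → Matrix (Fin (d + 1)) (Fin (d + 1)) ℝ)
    (hcoef : DarcyStokes.IsCoefficients Ω₁ G ζ μ α β Q)
    -- forcing terms, bounded in `L²` uniformly in `ε`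
    (f : ℝ → DarcyStokes.L2 (DarcyStokes.channel G ζ) (DarcyStokes.Space d))
    (h : ℝ → DarcyStokes.L2 Ω₁ ℝ)
    (hforce : ∃ C : ℝ, ∀ ε > 0, ‖f ε‖ ≤ C ∧ ‖h ε‖ ≤ C)
    -- the solutions `[v^ε, p^ε]`
    (v1 : ℝ → DarcyStokes.HDiv Ω₁) (v2 : ℝ → DarcyStokes.H1V (DarcyStokes.channel G ζ))
    (p1 : ℝ → DarcyStokes.L2 Ω₁ ℝ) (p2 : ℝ → DarcyStokes.L2 (DarcyStokes.channel G ζ) ℝ)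
    (hsol : ∀ ε > 0,
      DarcyStokes.IsSolution Ω₁ G ζ μ α β Q ε (f ε) (h ε) (v1 ε) (v2 ε) (p1 ε) (p2 ε))
    -- any sequence of positive parameters tending to zero
    (ε : ℕ → ℝ) (hε : ∀ k, 0 < ε k) (hε0 : Tendsto ε atTop (𝓝 0)) :
    (∀ e > 0, (v1 e).div = h e) ∧
    ∃ s : ℕ → ℕ, StrictMono s ∧
    ∃ (v1lim : DarcyStokes.HDiv Ω₁) (h1 : DarcyStokes.L2 Ω₁ ℝ)
      (χ : DarcyStokes.L2 (DarcyStokes.channel G ζ) (DarcyStokes.Space d))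
      (v2lim : DarcyStokes.H1V (DarcyStokes.channel G ζ))
      (vn : ℝ → DarcyStokes.Hz (DarcyStokes.channel G ζ))
      (ξ : DarcyStokes.Hz (DarcyStokes.channel G ζ)),
      -- (i)
      DarcyStokes.TendstoWeakly (fun k => v1 (ε (s k))) v1lim ∧
      DarcyStokes.TendstoWeakly (fun k => h (ε (s k))) h1 ∧
      v1lim.div = h1 ∧
      -- (ii)
      DarcyStokes.TendstoWeakly (fun k => (v2 (ε (s k))).dz) χ ∧
      Tendsto (fun k => (ε (s k) • v2 (ε (s k))).dz) atTop (𝓝 0) ∧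
      DarcyStokes.TendstoWeakly (fun k => ε (s k) • v2 (ε (s k))) v2lim ∧
      Tendsto (fun k => (ε (s k) • v2 (ε (s k))).fn) atTop (𝓝 v2lim.fn) ∧
      (∃ V : Lp (DarcyStokes.Space d) 2 (volume.restrict G),
        ∀ᵐ x ∂(volume.restrict (DarcyStokes.channel G ζ)),
          v2lim.fn x = V (DarcyStokes.horiz x)) ∧
      -- (iii): `vn e` is the normal velocity `v^{2,e} · n̂`, as an element of `H(∂_z, Ω₂)`
      (∀ e > 0, ∀ᵐ x ∂(volume.restrict (DarcyStokes.channel G ζ)),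
        (vn e).fn x
          = inner ℝ ((v2 e).fn x) (DarcyStokes.normal ζ (DarcyStokes.horiz x))) ∧
      DarcyStokes.TendstoWeakly (fun k => vn (ε (s k))) ξ ∧
      Tendsto (fun k => ε (s k) • vn (ε (s k))) atTop (𝓝 0) ∧
      (∃ g₀ : Lp ℝ 2 (volume.restrict G),
        DarcyStokes.HasTraces G ζ ξ.fn ξ.dz g₀ 0 ∧
        DarcyStokes.HasNormalTrace Ω₁ G ζ v1lim g₀) ∧
      -- (iv)
      (∀ᵐ x ∂(volume.restrict (DarcyStokes.channel G ζ)),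
        inner ℝ (v2lim.fn x) (DarcyStokes.normal ζ (DarcyStokes.horiz x)) = 0) ∧
      (∀ᵐ x ∂(volume.restrict (DarcyStokes.channel G ζ)),
        inner ℝ (χ x) (DarcyStokes.normal ζ (DarcyStokes.horiz x)) = ξ.dz x) := by
  choose L hL0 hLζ hL using hgeom.exists_bound
  choose C hC using hforce
  choose M hM using hε0.bddAbove_range
  choose B hB0 hB using hgeom.exists_uniform_bound hd hL0 hL hcoef C M
  have hdiv : ∀ e > 0, (v1 e).div = h e := fun e he => (hsol e he).div_eq
  -- the normal velocities
  have hex : ∀ e > 0, ∃ u : Hz (channel G ζ),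
      u.fn = normalDot ζ _ continuous_horiz.measurable (v2 e).fn ∧
      u.dz = normalDot ζ _ continuous_horiz.measurable (v2 e).dz ∧
      ‖u‖ ≤ (2 * L + 3) * ‖(v2 e).dz‖ ∧
      HasTraces G ζ u.fn u.dz (-(avg hgeom.isOpen_G hgeom.continuousOn ℝ u.dz)) 0 ∧
      HasNormalTrace Ω₁ G ζ (v1 e) (-(avg hgeom.isOpen_G hgeom.continuousOn ℝ u.dz) :) :=
    fun e he => by
      obtain ⟨g, hX, -⟩ := hsol e he
      exact hX.exists_normal_velocity hgeom hL0 hLζ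
  choose! vn hvnf hvnd hvnb hvnt hvnn using hex
  -- uniform bounds along the sequence
  have hb := fun k => hB (ε k) _ _ _ _ _ _ (hε k) (hM (mem_range_self k)) (hC _ (hε k)).1
    (hC _ (hε k)).2 (hsol _ (hε k))
  have hwall : ∀ k, VanishesOnWall G ζ (v2 (ε k)) := fun k => by
    obtain ⟨g, hX, -⟩ := hsol _ (hε k)
    exact hX.1
  have b1 : ∀ k, ‖v1 (ε k)‖ ≤ B + C := fun k => by
    refine (HDiv.norm_le _).trans (add_le_add (hb k).1 ?_)
    rw [hdiv _ (hε k)]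
    exact (hC _ (hε k)).2
  have bz : ∀ k, ε k * ‖(v2 (ε k)).dz‖ ≤ M * B := fun k =>
    mul_le_mul (hM (mem_range_self k)) (hb k).2.1 (norm_nonneg _)
      ((hε k).le.trans (hM (mem_range_self k)))
  have b2 : ∀ k, ‖ε k • v2 (ε k)‖ ≤ B + ((∑ _j : Fin d, (B + L * (M * B))) + M * B) := fun k => by
    have h1 := mul_le_mul_of_nonneg_left (H1V.norm_le (v2 (ε k))) (hε k).le
    rw [norm_smul, Real.norm_of_nonneg (hε k).le]
    refine h1.trans ?_
    rw [mul_add, Fin.sum_univ_castSucc, mul_add, Finset.mul_sum]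
    refine add_le_add (hb k).2.2.1 (add_le_add (Finset.sum_le_sum fun j _ => ?_) (bz k))
    have h2 := mul_le_mul_of_nonneg_left (norm_partial_castSucc_le hgeom.isOpen_G
      hgeom.continuousOn hL0 hL (v2 (ε k)) j) (hε k).le
    have h3 := (hb k).2.2.2 j
    have h4 := mul_le_mul_of_nonneg_left (bz k) hL0
    rw [mul_add, mul_left_comm] at h2
    exact h2.trans (add_le_add h3 h4)
  have bn : ∀ k, ‖vn (ε k)‖ ≤ (2 * L + 3) * B := fun k =>
    (hvnb _ (hε k)).trans (mul_le_mul_of_nonneg_left (hb k).2.1 (by linarith))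
  -- weakly convergent subsequences
  choose s hs v1lim χ v2lim ξ c1 c2 c3 c4 using
    exists_common_subseq_tendstoWeakly b1 (fun k => (hb k).2.1) b2 bn
  have hεs : Tendsto (fun k => ε (s k)) atTop (𝓝 0) := hε0.comp hs.tendsto_atTop
  -- a bounded sequence times `ε` tends to zero
  have hzero : ∀ {H : Type} [NormedAddCommGroup H] [NormedSpace ℝ H] {u : ℕ → H} {b : ℝ},
      (∀ k, ‖u k‖ ≤ b) → Tendsto (fun k => ε (s k) • u k) atTop (𝓝 0) := fun hu =>
    hεs.zero_smul_isBoundedUnder_le (isBoundedUnder_of ⟨_, hu⟩)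
  have hdz := hzero fun k => (hb (s k)).2.1
  have hdzn : Tendsto (fun k => ε (s k) * ‖(v2 (ε (s k))).dz‖) atTop (𝓝 0) := by
    have := hdz.norm
    simp only [norm_smul, Real.norm_of_nonneg (hε _).le, norm_zero] at this
    exact this
  have hcpt := hgeom.tendsto_of_vertical_tendsto_zero hL0 hL
    (u := fun k => v2 (ε (s k))) (c := fun k => ε (s k)) (fun k => hε _) (fun k => hwall _) hB0
    (fun k => (hb _).2.2.1) (fun k => (hb _).2.2.2) hdzn (c3.map (H1V.fnL _))
  choose hstrong V hV using hcpt
  have hvn0 := hzero fun k => bn (s k)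
  have hav := ((c4.map (Hz.dzL _)).map (avg hgeom.isOpen_G hgeom.continuousOn ℝ)).map
    (-(ContinuousLinearMap.id ℝ _))
  refine ⟨hdiv, s, hs, v1lim, v1lim.div, χ, v2lim, vn, ξ, c1, ?_, rfl, c2, hdz, c3, hstrong,
    ⟨V, ?_⟩, ?_, c4, hvn0, ⟨-(avg hgeom.isOpen_G hgeom.continuousOn ℝ ξ.dz), ?_, ?_⟩, ?_, ?_⟩
  · have h1 := c1.map (HDiv.divL Ω₁)
    simp only [HDiv.divL_apply, hdiv _ (hε _)] at h1
    exact h1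
  · have h1 := lift_coe hgeom.isOpen_G hgeom.continuousOn V
    rw [← hV] at h1
    exact h1
  · intro e he
    rw [hvnf e he]
    exact normalDot_coe ζ _ continuous_horiz.measurable _
  · exact HasTraces.of_tendstoWeakly hgeom.isOpen_G hgeom.isBounded hgeom.continuousOn c4 hav
      (g₁ := fun _ => 0) (tendstoWeakly_of_tendsto tendsto_const_nhds) fun k => hvnt _ (hε _)
  · exact HasNormalTrace.of_tendstoWeakly hgeom c1 hav fun k => hvnn _ (hε _)
  · -- the normal component of `ε v²` tends to zero
    have h1 := ((normalDot ζ _ continuous_horiz.measurable).continuous.tendsto _).comp hstrong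
    have h2 := ((Hz.fnL (channel G ζ)).continuous.tendsto _).comp hvn0
    have h3 : normalDot ζ _ continuous_horiz.measurable v2lim.fn = 0 := by
      refine tendsto_nhds_unique h1 ?_
      rw [map_zero] at h2
      refine h2.congr fun k => ?_
      simp only [Function.comp_apply, map_smul, Hz.fnL_apply, hvnf _ (hε _)]
    filter_upwards [normalDot_coe ζ _ continuous_horiz.measurable v2lim.fn,
      Lp.coeFn_zero ℝ 2 (volume.restrict (channel G ζ))] with x h4 h5
    rw [← h4, h3, h5]
    rfl
  · have h1 := c2.map (normalDot ζ _ continuous_horiz.measurable)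
    have h2 := c4.map (Hz.dzL (channel G ζ))
    simp only [Hz.dzL_apply, hvnd _ (hε _)] at h2
    rw [← h1.unique h2]
    filter_upwards [normalDot_coe ζ _ continuous_horiz.measurable χ] with x h4
    exact h4.symm
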